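/- Let $d\ge 3$ be odd and $\lambda\in\mathbb C$. On $\mathbb C^{1+d}$ put $\beta(z,w)=z_0w_0-z_1w_1-\dots-z_dw_d$, and let $\mathrm{dS}^d=\{x\in\mathbb R^{1+d}:\beta(x,x)=-1\}$ be de Sitter space with its Lorentz-invariant volume, $G=\mathrm{SO}_{1,d}(\mathbb R)^{\uparrow}$ the orthochronous proper Lorentz group, $e_0,\dots,e_d$ the standard basis, and for $x\in \mathrm{dS}^d$ $$I(x)=\{y\in\mathrm{dS}^d:\beta(y-x,y-x)>0\},\qquad I^{\pm}(x)=\{y\in I(x):\pm(y_0-x_0)>0\}.$$ Let ${}_2F_1(a,b;c;\cdot)$ denote the holomorphic continuation of the Gauss hypergeometric series from the unit disc to $\mathbb C\setminus[1,\infty)$, and let $$Q_\lambda(z,w)={}_2F_1\Big(\tfrac{d-1}2+\lambda,\tfrac{d-1}2-\lambda;\tfrac d2;\tfrac{1-\beta(z,\overline w)}2\Big),\qquad \overline Q_\lambda(z,w)=Q_\lambda(\overline w,\overline z),\qquad z_t=i\cos(t)\,e_0+\sin(t)\,e_1 .$$ Then for every $x\in\mathrm{dS}^d$ there are distributions $D^{\pm}_{\lambda,x}$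 on $\mathrm{dS}^d$ such that for every $g\in G$ with $g e_1=x$, $$D^+_{\lambda,x}=\lim_{t\to\frac\pi2-}Q_\lambda(g z_t,\cdot\,),\qquad D^-_{\lambda,x}=\lim_{t\to\frac\pi2-}\overline Q_\lambda(g\overline{z_t},\cdot\,)$$ in the sense of distributions on $\mathrm{dS}^d$ (i.e. after integration against every test function). With $$c_\lambda=2i(-1)^{\frac{d-1}2}\,\frac{\Gamma(\frac d2)\,\Gamma(\frac{d-2}2)}{\Gamma(\frac{d-1}2+\lambda)\,\Gamma(\frac{d-1}2-\lambda)}$$ (where $1/\Gamma=0$ at the poles of $\Gamma$), the distribution $D^+_{\lambda,x}-D^-_{\lambda,x}$ is $0$ on the open set $\mathrm{dS}^d\setminus\overline{I(x)}$, and on the open sets $I^{\pm}(x)$ it is given by the function $$y\longmapsto \pm\,c_\lambda\Big(-\frac{1+\beta(x,y)}2\Big)^{\frac{2-d}2}\,{}_2F_1\Big(\tfrac12-\lambda,\tfrac12+\lambda;\tfrac{4-d}2;\tfrac{1+\beta(x,y)}2\Big).$$ -/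

import Mathlib

open scoped Distributions

noncomputable section

namespace DeSitter

/-! ### Analytic continuation of the Gauss hypergeometric function -/

/-- `f` is a holomorphic continuation of the Gauss hypergeometric series `₂F₁(a, b; c; ·)` from the
unit disc to the slit plane `ℂ \ [1, ∞)`. Such an `f` is unique on the slit plane. -/
def IsHypergeometricContinuation (a b c : ℂ) (f : ℂ → ℂ) : Prop :=
  DifferentiableOn ℂ f {z : ℂ | 1 - z ∈ Complex.slitPlane} ∧
    ∀ z : ℂ, ‖z‖ < 1 → f z = ₂F₁ a b c z

/-- The holomorphic continuation of `₂F₁(a, b; c; ·)` to `ℂ \ [1, ∞)`. -/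
def hypergeometric (a b c z : ℂ) : ℂ :=
  open Classical in
  if h : ∃ f : ℂ → ℂ, IsHypergeometricContinuation a b c f then h.choose z else 0

/-- The value of `hypergeometric` on `ℂ \ [1, ∞)` does not depend on the choice made in its
definition. -/
theorem hypergeometric_eq {a b c : ℂ} {f : ℂ → ℂ} (hf : IsHypergeometricContinuation a b c f)
    {z : ℂ} (hz : 1 - z ∈ Complex.slitPlane) : hypergeometric a b c z = f z := by
  have h : ∃ f : ℂ → ℂ, IsHypergeometricContinuation a b c f := ⟨f, hf⟩
  have hopen : IsOpen {z : ℂ | 1 - z ∈ Complex.slitPlane} :=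
    Complex.isOpen_slitPlane.preimage (continuous_const.sub continuous_id)
  have hstar : StarConvex ℝ (0 : ℂ) {z : ℂ | 1 - z ∈ Complex.slitPlane} := by
    intro y hy s t hs ht hst
    have hs' : s = 1 - t := by linarith
    subst hs'
    rcases (show 0 < (1 - y).re ∨ (1 - y).im ≠ 0 from hy) with h1 | h1
    · left
      simp only [Complex.sub_re, Complex.one_re] at h1
      simp only [smul_zero, zero_add, Complex.sub_re, Complex.one_re, Complex.real_smul,
        Complex.re_ofReal_mul]
      rcases eq_or_lt_of_le ht with h0 | h0
      · rw [← h0]; norm_num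
      · nlinarith
    · rcases eq_or_lt_of_le ht with h0 | h0
      · left
        rw [← h0]; simp
      · right
        simp only [Complex.sub_im, Complex.one_im, zero_sub, neg_ne_zero] at h1
        simp [h1, h0.ne']
  have hmem : (0 : ℂ) ∈ {z : ℂ | 1 - z ∈ Complex.slitPlane} := by
    simp
  have key := AnalyticOnNhd.eqOn_of_preconnected_of_eventuallyEq
    (h.choose_spec.1.analyticOnNhd hopen) (hf.1.analyticOnNhd hopen)
    (StarConvex.isPathConnected hstar hmem).isConnected.isPreconnected hmem
    (by
      filter_upwards [Metric.ball_mem_nhds (0 : ℂ) one_pos] with w hw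
      have hw' : ‖w‖ < 1 := by simpa using hw
      rw [h.choose_spec.2 w hw', hf.2 w hw'])
  have hdef : hypergeometric a b c z = h.choose z := by
    unfold hypergeometric
    rw [dif_pos h]
  rw [hdef]
  exact key hz

/-! ### Minkowski space, the Lorentz group and de Sitter space -/

/-- The Lorentzian form `β(x, y) = x₀ y₀ - x₁ y₁ - ⋯ - x_d y_d` on `R^{1+d}`
(used for `R = ℝ` and, bilinearly, for `R = ℂ`). -/
def beta {R : Type*} [CommRing R] {d : ℕ} (x y : Fin (d + 1) → R) : R :=
  x 0 * y 0 - ∑ i : Fin d, x i.succ * y i.succ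

/-- The open future light cone `V₊`. -/
def futureCone (d : ℕ) : Set (Fin (d + 1) → ℝ) :=
  {x | 0 < x 0 ∧ 0 < beta x x}

/-- The orthochronous proper Lorentz group `SO_{1,d}(ℝ)^↑`. -/
def lorentzGroup (d : ℕ) : Set (Matrix (Fin (d + 1)) (Fin (d + 1)) ℝ) :=
  {g | (∀ x y : Fin (d + 1) → ℝ, beta (g.mulVec x) (g.mulVec y) = beta x y) ∧ g.det = 1 ∧
    ∀ x ∈ futureCone d, g.mulVec x ∈ futureCone d}

/-- De Sitter space `dS^d = {x ∈ ℝ^{1+d} : β(x, x) = -1}`. -/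
def deSitter (d : ℕ) : Set (Fin (d + 1) → ℝ) :=
  {x | beta x x = -1}

/-- The base point `e₁` of de Sitter space. -/
def basePoint (d : ℕ) : Fin (d + 1) → ℝ := Pi.single 1 1

/-- `I(x) = {x + v ∈ dS^d : β(v, v) > 0}`. -/
def chronological {d : ℕ} (x : Fin (d + 1) → ℝ) : Set (Fin (d + 1) → ℝ) :=
  {y | y ∈ deSitter d ∧ 0 < beta (y - x) (y - x)}

/-- `I⁺(x) = {x + v ∈ I(x) : v₀ > 0}`. -/
def chronologicalFuture {d : ℕ} (x : Fin (d + 1) → ℝ) : Set (Fin (d + 1) → ℝ) :=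
  {y | y ∈ chronological x ∧ 0 < (y - x) 0}

/-- `I⁻(x) = {x + v ∈ I(x) : v₀ < 0}`. -/
def chronologicalPast {d : ℕ} (x : Fin (d + 1) → ℝ) : Set (Fin (d + 1) → ℝ) :=
  {y | y ∈ chronological x ∧ (y - x) 0 < 0}

/-- The Lorentz-invariant volume on `dS^d`, as a measure on the ambient space: the cone measure
`A ↦ (d + 1) · Leb {r y : 0 < r < 1, y ∈ A ∩ dS^d}`. In coordinates `v = r y` on
`{v : β(v, v) < 0}` with `r > 0` and `y ∈ dS^d`, Lebesgue measure is `r^d dr` times the Lorentzian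
volume. -/
def volumeMeasure (d : ℕ) : MeasureTheory.Measure (Fin (d + 1) → ℝ) :=
  ((d : ENNReal) + 1) •
    (MeasureTheory.volume.restrict
      {v : Fin (d + 1) → ℝ | -1 < beta v v ∧ beta v v < 0}).map
      (fun v => (Real.sqrt (-beta v v))⁻¹ • v)

/-! ### Distributions on de Sitter space -/

/-- Test functions on the ambient space `ℝ^{1+d}`. As `dS^d` is a closed submanifold, the
restrictions of these to `dS^d` are exactly the compactly supported smooth functions on `dS^d`. -/
abbrev AmbientTest (d : ℕ) : Type := 𝓓((⊤ : TopologicalSpace.Opens (Fin (d + 1) → ℝ)), ℝ)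

/-- Complex-valued distributions on `dS^d`, i.e. continuous linear functionals on
`C_c^∞(dS^d)`. Restriction to the closed submanifold `dS^d` identifies `C_c^∞(dS^d)`
topologically with the quotient of `C_c^∞(ℝ^{1+d})` by the functions vanishing on `dS^d`, so these
are the distributions `T` on `ℝ^{1+d}` for which `T φ` depends only on the restriction of `φ`
to `dS^d`. -/
def distributions (d : ℕ) :
    Submodule ℝ 𝓓'((⊤ : TopologicalSpace.Opens (Fin (d + 1) → ℝ)), ℂ) where
  carrier := {T | ∀ φ : AmbientTest d, (∀ y ∈ deSitter d, φ y = 0) → T φ = 0}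
  zero_mem' := fun _ _ => rfl
  add_mem' := by
    intro S T hS hT φ hφ
    change S φ + T φ = 0
    rw [hS φ hφ, hT φ hφ, add_zero]
  smul_mem' := by
    intro r T hT φ hφ
    change r • T φ = 0
    rw [hT φ hφ, smul_zero]

/-- On the relatively open set `U ⊆ dS^d` the distribution `T` is given by the function `f`:
`T φ = ∫ f φ` for all test functions `φ` on `dS^d` with support in `U`. -/
def IsGivenOn {d : ℕ} (T : distributions d) (U : Set (Fin (d + 1) → ℝ))
    (f : (Fin (d + 1) → ℝ) → ℂ) : Prop :=
  ∀ φ : AmbientTest d, closure {y | y ∈ deSitter d ∧ φ y ≠ 0} ⊆ U →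
    MeasureTheory.Integrable (fun y => f y * (φ y : ℂ)) (volumeMeasure d) ∧
      T.1 φ = ∫ y, f y * (φ y : ℂ) ∂(volumeMeasure d)

/-- The functions `F t` on `dS^d` (for `t < t₀` close to `t₀`) converge to the distribution `T`
on `dS^d` as `t → t₀-`. -/
def HasLeftLimit {d : ℕ} (F : ℝ → (Fin (d + 1) → ℝ) → ℂ) (t₀ : ℝ) (T : distributions d) : Prop :=
  ∀ φ : AmbientTest d,
    (∀ᶠ t in nhdsWithin t₀ (Set.Iio t₀),
      MeasureTheory.Integrable (fun y => F t y * (φ y : ℂ)) (volumeMeasure d)) ∧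
    Filter.Tendsto (fun t => ∫ y, F t y * (φ y : ℂ) ∂(volumeMeasure d))
      (nhdsWithin t₀ (Set.Iio t₀)) (nhds (T.1 φ))

/-! ### The spherical kernel and its boundary values -/

/-- The spherical kernel
`Q_λ(z, w) = ₂F₁((d-1)/2 + λ, (d-1)/2 - λ; d/2; (1 - β(z, w̄))/2)`. -/
def kernel {d : ℕ} (lam : ℂ) (z w : Fin (d + 1) → ℂ) : ℂ :=
  hypergeometric (((d : ℂ) - 1) / 2 + lam) (((d : ℂ) - 1) / 2 - lam) ((d : ℂ) / 2)
    ((1 - beta z (star w)) / 2)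

/-- The conjugate kernel `Q̄_λ(z, w) = Q_λ(w̄, z̄)`. -/
def conjKernel {d : ℕ} (lam : ℂ) (z w : Fin (d + 1) → ℂ) : ℂ :=
  kernel lam (star w) (star z)

/-- The inclusion `ℝ^{1+d} ⊆ ℂ^{1+d}`. -/
def toComplex {d : ℕ} (y : Fin (d + 1) → ℝ) : Fin (d + 1) → ℂ := fun i => (y i : ℂ)

/-- The point `z_t = i cos(t) e₀ + sin(t) e₁` of `ℂ^{1+d}`. -/
def zPoint (d : ℕ) (t : ℝ) : Fin (d + 1) → ℂ :=
  (Complex.I * (Real.cos t : ℂ)) • Pi.single 0 1 + (Real.sin t : ℂ) • Pi.single 1 1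

/-- The linear action of a real matrix on `ℂ^{1+d}`. -/
def act {d : ℕ} (g : Matrix (Fin (d + 1)) (Fin (d + 1)) ℝ) (z : Fin (d + 1) → ℂ) :
    Fin (d + 1) → ℂ :=
  (g.map (fun r : ℝ => (r : ℂ))).mulVec z

/-- `D = D⁺_{λ,x}`: whenever `g ∈ SO_{1,d}(ℝ)^↑` and `g e₁ = x`, the distribution `D` is
the limit of `y ↦ Q_λ(g z_t, y)` for `t → π/2-`. -/
def IsDPlus {d : ℕ} (lam : ℂ) (x : Fin (d + 1) → ℝ) (D : distributions d) : Prop :=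
  ∀ g ∈ lorentzGroup d, g.mulVec (basePoint d) = x →
    HasLeftLimit (fun t y => kernel lam (act g (zPoint d t)) (toComplex y)) (Real.pi / 2) D

/-- `D = D⁻_{λ,x}`: whenever `g ∈ SO_{1,d}(ℝ)^↑` and `g e₁ = x`, the distribution `D` is
the limit of `y ↦ Q̄_λ(g z̄_t, y)` for `t → π/2-`, where `g z̄_t` is the complex conjugate of
`g z_t`. -/
def IsDMinus {d : ℕ} (lam : ℂ) (x : Fin (d + 1) → ℝ) (D : distributions d) : Prop :=
  ∀ g ∈ lorentzGroup d, g.mulVec (basePoint d) = x →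
    HasLeftLimit (fun t y => conjKernel lam (act g (star (zPoint d t))) (toComplex y))
      (Real.pi / 2) D

/-! ### The jump -/

/-- `c_λ = 2i (-1)^{(d-1)/2} Γ(d/2) Γ((d-2)/2) / (Γ((d-1)/2 + λ) Γ((d-1)/2 - λ))` for odd `d ≥ 3`,
where `1/Γ` is understood to be `0` at the poles of `Γ` (Mathlib's convention). -/
def jumpConstant (d : ℕ) (lam : ℂ) : ℂ :=
  2 * Complex.I * (-1) ^ ((d - 1) / 2) *
    (Complex.Gamma ((d : ℂ) / 2) * Complex.Gamma (((d : ℂ) - 2) / 2) /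
      (Complex.Gamma (((d : ℂ) - 1) / 2 + lam) * Complex.Gamma (((d : ℂ) - 1) / 2 - lam)))

/-- `(-(1+β(x,y))/2)^{(2-d)/2} ₂F₁(1/2 - λ, 1/2 + λ; (4-d)/2; (1+β(x,y))/2)`, for `y ∈ I(x)`. -/
def jumpProfile {d : ℕ} (lam : ℂ) (x y : Fin (d + 1) → ℝ) : ℂ :=
  (((-((1 + beta x y) / 2)) ^ ((2 - (d : ℝ)) / 2) : ℝ) : ℂ) *
    hypergeometric (1 / 2 - lam) (1 / 2 + lam) ((4 - (d : ℂ)) / 2)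
      (((1 + beta x y) / 2 : ℝ) : ℂ)

end DeSitter

end

/-!
Write `d = 2k + 1`. For `g` in the Lorentz group with `g e₁ = x` the vector `n = g e₀` is a
future-directed unit vector orthogonal to `x`, and `Q_λ(g z_t, y) = f(s_t(y))` with
`s_t(y) = sin t β(x, y) + i cos t β(n, y)` and `f = spherical k λ` holomorphic on `ℂ \ (-∞, -1]`.
The conjugate kernel is the same expression with `-n` in place of `n`.

*The spherical function.* The hypergeometric series continues to `ℂ \ [1, ∞)`
(`exists_hypergeometricContinuation`) by Euler's integral and contiguity relations. The connection
formula between the points `0` and `1` (`connection_formula`) is elementary in odd dimensions: for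
`k = 0` the functions are `cos 2λθ` and `sin 2λθ` in the variable `z = sin² θ`, differentiation
raises `k`, and integral `λ` follow by continuity. It shows that `f` is `O(|1 + s|⁻ᵏ)` near the cut
(`moderateGrowth_spherical`) and computes the jump of `f` across the cut (`sphericalBoundary_sub`).

*Existence of the limits.* On de Sitter space `|1 + s_t(y)| ≥ cos⁴ t / 2` (`IsFrame.le_norm`), so
the pairings `∫ f(s_t) φ` grow at most like a power of `(π/2 - t)⁻¹`. The `t`-derivative of `s_t(y)` is
`i` times its derivative along the infinitesimal boost in the plane of `x` and `n`. As the volume is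
invariant under boosts, differentiating the pairing in `t` only replaces `φ` by its boost derivative
(`IsFrame.hasDerivAt_framePairing`). Integrating the growth bound often enough gives a bound by
finitely many boost derivatives of `φ`, uniform in `t`
(`ModerateGrowth.exists_norm_framePairing_le`), and the existence of the limit, which is therefore a distribution (`boundaryDistribution`).

*Independence of `g`.* Two frames at `x` with the same time orientation are joined by a smooth curve
of frames. The derivative of `s_t` along it has the factor `cos t`, and what is left is again a
uniformly bounded pairing, so the limits agree (`IsFrame.tendsto_framePairing_sub`).

*The difference.* Away from the light cone of `x` the limits may be taken pointwise, by dominated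
convergence (`IsFrame.boundaryValue_eq_integral`). Outside the closure of `I(x)` one has
`β(x, y) > -1` (`mem_closure_chronological`), and both limits are `f(β(x, y))`. On `I^±(x)` one has
`β(x, y) < -1` and `±β(n, y) > 0`, so the two limits are the boundary values of `f` from the two
sides of the cut.
-/

namespace DeSitter

open Complex Filter Topology MeasureTheory
open scoped ContDiff

/-! ### The Gauss hypergeometric series on the unit disc -/

theorem one_le_radius_hypergeometricSeries (a b c : ℂ) :
    1 ≤ (ordinaryHypergeometricSeries ℂ a b c).radius := by
  by_cases h : ∀ kn : ℕ, (kn : ℂ) ≠ -a ∧ (kn : ℂ) ≠ -b ∧ (kn : ℂ) ≠ -c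
  · rw [ordinaryHypergeometricSeries_radius_eq_one ℂ a b c h]
  · push Not at h
    obtain ⟨k, hk⟩ := h
    have key : (ordinaryHypergeometricSeries ℂ a b c).radius = ⊤ := by
      by_cases h1 : (k : ℂ) = -a
      · rw [show a = -(k : ℂ) by rw [h1, neg_neg]]
        exact ordinaryHypergeometric_radius_top_of_neg_nat₁ ℂ b c
      · by_cases h2 : (k : ℂ) = -b
        · rw [show b = -(k : ℂ) by rw [h2, neg_neg]]
          exact ordinaryHypergeometric_radius_top_of_neg_nat₂ ℂ a c
        · rw [show c = -(k : ℂ) by rw [hk h1 h2, neg_neg]]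
          exact ordinaryHypergeometric_radius_top_of_neg_nat₃ ℂ a b
    rw [key]; exact le_top

theorem summable_norm_hypergeometricCoefficient (a b c : ℂ) {r : ℝ} (hr0 : 0 ≤ r) (hr : r < 1) :
    Summable (fun n => ‖ordinaryHypergeometricCoefficient a b c n‖ * r ^ n) := by
  lift r to NNReal using hr0
  have h : (r : ENNReal) < (ordinaryHypergeometricSeries ℂ a b c).radius :=
    lt_of_lt_of_le (by exact_mod_cast hr) (one_le_radius_hypergeometricSeries a b c)
  have := (ordinaryHypergeometricSeries ℂ a b c).summable_norm_mul_pow h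
  refine this.congr fun n => ?_
  rw [ordinaryHypergeometricSeries, FormalMultilinearSeries.ofScalars_norm]

theorem hasSum_ordinaryHypergeometric (a b c : ℂ) {z : ℂ} (hz : ‖z‖ < 1) :
    HasSum (fun n => ordinaryHypergeometricCoefficient a b c n * z ^ n) (₂F₁ a b c z) := by
  have hs : Summable (fun n => ordinaryHypergeometricCoefficient a b c n * z ^ n) := by
    refine Summable.of_norm ?_
    simpa using summable_norm_hypergeometricCoefficient a b c (norm_nonneg z) hz
  rw [ordinaryHypergeometric_eq_tsum]
  simpa [smul_eq_mul] using hs.hasSum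

theorem differentiableAt_ordinaryHypergeometric (a b c : ℂ) {z : ℂ} (hz : ‖z‖ < 1) :
    DifferentiableAt ℂ (₂F₁ a b c) z := by
  have h := (ordinaryHypergeometricSeries ℂ a b c).hasFPowerSeriesOnBall
    (lt_of_lt_of_le one_pos (one_le_radius_hypergeometricSeries a b c))
  have h2 := h.analyticAt_of_mem (y := z) (by
    simp only [Metric.mem_eball, edist_zero_right]
    refine lt_of_lt_of_le ?_ (one_le_radius_hypergeometricSeries a b c)
    rw [← ofReal_norm, ENNReal.ofReal_lt_one]
    exact hz)
  exact h2.differentiableAt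

theorem hasSum_deriv_ordinaryHypergeometric (a b c : ℂ) {z : ℂ} (hz : ‖z‖ < 1) :
    HasSum (fun n : ℕ => ((n : ℂ) + 1) * ordinaryHypergeometricCoefficient a b c (n + 1) * z ^ n)
      (deriv (₂F₁ a b c) z) := by
  obtain ⟨r, hr0, hr1⟩ := exists_between hz
  have hr0' : 0 ≤ r := (norm_nonneg z).trans hr0.le
  have h := hasSum_deriv_of_summable_norm
    (F := fun n (w : ℂ) => ordinaryHypergeometricCoefficient a b c n * w ^ n)
    (U := Metric.ball (0 : ℂ) r) (z := z)
    (summable_norm_hypergeometricCoefficient a b c hr0' hr1)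
    (fun i => by fun_prop) Metric.isOpen_ball
    (fun i w hw => by
      rw [norm_mul, norm_pow]
      have : ‖w‖ ≤ r := by simpa using (mem_ball_zero_iff.1 hw).le
      gcongr) (by simpa using hr0)
  have h2 : (fun w : ℂ => ∑' i, ordinaryHypergeometricCoefficient a b c i * w ^ i) = ₂F₁ a b c := by
    rw [ordinaryHypergeometric_eq_tsum]; rfl
  rw [h2] at h
  rw [← hasSum_nat_add_iff' 1] at h
  simp only [Finset.range_one, Finset.sum_singleton, pow_zero, deriv_const, sub_zero] at h
  refine h.congr_fun ?_ |> fun h => by simpa using h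
  intro n
  simp
  ring

theorem hypergeometricCoefficient_succ_eq (a b c : ℂ) (hc0 : c ≠ 0) (n : ℕ) :
    ((n : ℂ) + 1) * ordinaryHypergeometricCoefficient a b c (n + 1) =
      a * b / c * ordinaryHypergeometricCoefficient (a + 1) (b + 1) (c + 1) n := by
  have h : ∀ x : ℂ, (ascPochhammer ℂ (n + 1)).eval x = x * (ascPochhammer ℂ n).eval (x + 1) := by
    intro x; rw [ascPochhammer_succ_left]; simp
  have hn : ((n : ℂ) + 1) ≠ 0 := by exact_mod_cast n.succ_ne_zero
  simp only [ordinaryHypergeometricCoefficient, h, Nat.factorial_succ, Nat.cast_mul, Nat.cast_succ,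
    mul_inv]
  field_simp

theorem hasDerivAt_ordinaryHypergeometric (a b c : ℂ) (hc0 : c ≠ 0) {z : ℂ} (hz : ‖z‖ < 1) :
    HasDerivAt (₂F₁ a b c) (a * b / c * ₂F₁ (a + 1) (b + 1) (c + 1) z) z := by
  have h1 := hasSum_deriv_ordinaryHypergeometric a b c hz
  have h2 := (hasSum_ordinaryHypergeometric (a + 1) (b + 1) (c + 1) hz).mul_left (a * b / c)
  have h3 : deriv (₂F₁ a b c) z = a * b / c * ₂F₁ (a + 1) (b + 1) (c + 1) z := by
    refine h1.unique (h2.congr_fun ?_)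
    intro n
    rw [hypergeometricCoefficient_succ_eq a b c hc0 n, mul_assoc]
  rw [← h3]
  exact (differentiableAt_ordinaryHypergeometric a b c hz).hasDerivAt

/-- The Euler derivative `z d/dz` multiplies the `n`-th coefficient by `n`. -/
theorem hasSum_mul_deriv_ordinaryHypergeometric (a b c : ℂ) {z : ℂ} (hz : ‖z‖ < 1) :
    HasSum (fun n : ℕ => (n : ℂ) * ordinaryHypergeometricCoefficient a b c n * z ^ n)
      (z * deriv (₂F₁ a b c) z) := by
  rw [← hasSum_nat_add_iff' 1]
  simp only [Finset.range_one, Finset.sum_singleton, Nat.cast_zero, zero_mul, sub_zero]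
  refine ((hasSum_deriv_ordinaryHypergeometric a b c hz).mul_left z).congr_fun ?_
  intro n
  push_cast
  ring

/-- Lowering of the third parameter: `(z d/dz + c) F(a, b; c + 1) = c F(a, b; c)`. -/
theorem lower_third (a b c : ℂ) (hc0 : ∀ n : ℕ, c + n ≠ 0) {z : ℂ} (hz : ‖z‖ < 1) :
    z * deriv (₂F₁ a b (c + 1)) z + c * ₂F₁ a b (c + 1) z = c * ₂F₁ a b c z := by
  have h1 := (hasSum_mul_deriv_ordinaryHypergeometric a b (c + 1) hz).add
    ((hasSum_ordinaryHypergeometric a b (c + 1) hz).mul_left c)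
  have h2 := (hasSum_ordinaryHypergeometric a b c hz).mul_left c
  refine h1.unique (h2.congr_fun ?_)
  intro n
  have hp : (ascPochhammer ℂ n).eval (c + 1) * c = (ascPochhammer ℂ n).eval c * (c + n) := by
    rw [← ascPochhammer_succ_eval, ascPochhammer_succ_left]; simp [mul_comm]
  have hz0 : ∀ x : ℂ, (∀ m : ℕ, x + m ≠ 0) → (ascPochhammer ℂ n).eval x ≠ 0 := by
    intro x hx h0
    obtain ⟨k, -, hk⟩ := (ascPochhammer_eval_eq_zero_iff n x).1 h0
    exact hx k (by rw [hk]; ring)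
  have e1 := hz0 c hc0
  have e2 := hz0 (c + 1)
    (fun m => by have := hc0 (m + 1); push_cast at this; rwa [add_assoc, add_comm 1])
  have e3 : ((ascPochhammer ℂ n).eval (c + 1))⁻¹ * (c + n) =
      ((ascPochhammer ℂ n).eval c)⁻¹ * c := by
    field_simp
    linear_combination -hp
  simp only [ordinaryHypergeometricCoefficient]
  linear_combination ((n.factorial : ℂ)⁻¹ * (ascPochhammer ℂ n).eval a *
    (ascPochhammer ℂ n).eval b * z ^ n) * e3

/-- Lowering of the second parameter:
`(z (1 - z) d/dz + c - b - 1 - a z) F(a, b + 1; c) = (c - b - 1) F(a, b; c)`. -/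
theorem lower_second (a b c : ℂ) (hc0 : ∀ n : ℕ, c + n ≠ 0) {z : ℂ} (hz : ‖z‖ < 1) :
    z * (1 - z) * deriv (₂F₁ a (b + 1) c) z + (c - b - 1 - a * z) * ₂F₁ a (b + 1) c z =
      (c - b - 1) * ₂F₁ a b c z := by
  have h1 := hasSum_mul_deriv_ordinaryHypergeometric a (b + 1) c hz
  have h0 := hasSum_ordinaryHypergeometric a (b + 1) c hz
  have h2 := (hasSum_ordinaryHypergeometric a b c hz).mul_left (c - b - 1)
  have h4 := (hasSum_nat_add_iff' 1).2 (h1.add (h0.mul_left (c - b - 1)))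
  have h5 := ((h1.add (h0.mul_left a)).mul_left (-z))
  have h6 := (h4.add h5)
  have h7 := (hasSum_nat_add_iff' 1).2 h2
  have key := h6.unique (h7.congr_fun ?_)
  · simp only [Finset.range_one, Finset.sum_singleton, pow_zero, mul_one, Nat.cast_zero,
      zero_add, ordinaryHypergeometricCoefficient, Nat.factorial_zero, ascPochhammer_zero,
      Polynomial.eval_one, Nat.cast_one, inv_one] at key
    linear_combination key
  intro n
  have hb : (ascPochhammer ℂ (n + 1)).eval b = b * (ascPochhammer ℂ n).eval (b + 1) := by
    rw [ascPochhammer_succ_left]; simp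
  have hz0 : ∀ m, (ascPochhammer ℂ m).eval c ≠ 0 := by
    intro m h0
    obtain ⟨k, -, hk⟩ := (ascPochhammer_eval_eq_zero_iff m c).1 h0
    exact hc0 k (by rw [hk]; ring)
  have e1 := hz0 n
  have e2 := hc0 n
  have hn : ((n : ℂ) + 1) ≠ 0 := by exact_mod_cast n.succ_ne_zero
  have hf : (n.factorial : ℂ) ≠ 0 := by exact_mod_cast n.factorial_ne_zero
  simp only [ordinaryHypergeometricCoefficient, hb, ascPochhammer_succ_eval, Nat.factorial_succ,
    Nat.cast_mul, Nat.cast_succ, mul_inv]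
  field_simp
  ring

/-! ### Analytic continuation of the hypergeometric series -/

/-- The slit plane `ℂ \ [1, ∞)`. -/
def cutPlane : Set ℂ := {z : ℂ | 1 - z ∈ Complex.slitPlane}

theorem isOpen_cutPlane : IsOpen cutPlane :=
  Complex.isOpen_slitPlane.preimage (continuous_const.sub continuous_id)

theorem mem_cutPlane_of_norm_lt_one {z : ℂ} (hz : ‖z‖ < 1) : z ∈ cutPlane := by
  left
  have := (Complex.re_le_norm z).trans_lt hz
  simp only [sub_re, one_re]; linarith

theorem mul_ofReal_mem_cutPlane {z : ℂ} (hz : z ∈ cutPlane) {t : ℝ} (ht0 : 0 ≤ t) (ht1 : t ≤ 1) :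
    z * t ∈ cutPlane := by
  rcases ht0.eq_or_lt with rfl | ht
  · exact mem_cutPlane_of_norm_lt_one (by simp)
  rcases (show 0 < (1 - z).re ∨ (1 - z).im ≠ 0 from hz) with h1 | h1
  · left
    simp only [sub_re, one_re, re_mul_ofReal] at h1 ⊢
    nlinarith
  · right
    simp only [sub_im, one_im, zero_sub, neg_ne_zero, im_mul_ofReal] at h1 ⊢
    exact mul_ne_zero h1 ht.ne'

/-- A weighted integral over `[0, 1]` of functions holomorphic in `z` is holomorphic in `z`. -/
theorem differentiableOn_intervalIntegral {U : Set ℂ} (hU : IsOpen U) {w : ℝ → ℂ}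
    (hw : IntervalIntegrable w MeasureTheory.volume 0 1) {k : ℂ → ℝ → ℂ}
    (hk : ContinuousOn (Function.uncurry k) (U ×ˢ Set.Icc (0 : ℝ) 1))
    (hd : ∀ t ∈ Set.Icc (0 : ℝ) 1, DifferentiableOn ℂ (fun z => k z t) U) :
    DifferentiableOn ℂ (fun z => ∫ t in (0 : ℝ)..1, w t * k z t) U := by
  intro z₀ hz₀
  obtain ⟨r, hr, hrU⟩ := Metric.isOpen_iff.1 hU z₀ hz₀
  have hcb : Metric.closedBall z₀ (r / 2) ⊆ U :=
    (Metric.closedBall_subset_ball (by linarith)).trans hrU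
  obtain ⟨C, hC⟩ := ((isCompact_closedBall z₀ (r / 2)).prod
    (isCompact_Icc (a := (0 : ℝ)) (b := 1))).exists_bound_of_continuousOn
    (hk.mono (Set.prod_mono hcb subset_rfl))
  have hIoc : Set.uIoc (0 : ℝ) 1 = Set.Ioc 0 1 := Set.uIoc_of_le zero_le_one
  have hmeas : ∀ z ∈ U, MeasureTheory.AEStronglyMeasurable (fun t => w t * k z t)
      (MeasureTheory.volume.restrict (Set.uIoc (0 : ℝ) 1)) := by
    intro z hz
    refine (hw.aestronglyMeasurable_restrict_uIoc).mul ?_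
    rw [hIoc]
    have : ContinuousOn (fun t => k z t) (Set.Icc (0 : ℝ) 1) :=
      hk.comp (f := fun t => (z, t)) (by fun_prop) (fun t ht => ⟨hz, ht⟩)
    exact (this.mono Set.Ioc_subset_Icc_self).aestronglyMeasurable measurableSet_Ioc
  have hsub : ∀ x ∈ Metric.ball z₀ (r / 4), ∀ t ∈ Set.Icc (0 : ℝ) 1,
      ‖deriv (fun z => k z t) x‖ ≤ C / (r / 4) := by
    intro x hx t ht
    refine Complex.norm_deriv_le_of_forall_mem_sphere_norm_le (by linarith) ?_ ?_
    · refine ((hd t ht).mono ?_).diffContOnCl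
      refine (Metric.closure_ball_subset_closedBall).trans (subset_trans ?_ hcb)
      refine Metric.closedBall_subset_closedBall' ?_
      have := Metric.mem_ball.1 hx
      linarith
    · intro y hy
      refine hC (y, t) ⟨?_, ht⟩
      have h1 := Metric.mem_ball.1 hx
      have h2 := Metric.mem_sphere.1 hy
      rw [Metric.mem_closedBall]
      linarith [dist_triangle y x z₀]
  have hbU : Metric.ball z₀ (r / 4) ⊆ U :=
    (Metric.ball_subset_ball (by linarith)).trans hrU
  have hz₀i : IntervalIntegrable (fun t => w t * k z₀ t) MeasureTheory.volume 0 1 := by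
    refine hw.mul_continuousOn ?_
    rw [Set.uIcc_of_le zero_le_one]
    exact hk.comp (f := fun t => (z₀, t)) (by fun_prop) (fun t ht => ⟨hz₀, ht⟩)
  have hderivmeas : MeasureTheory.AEStronglyMeasurable (fun t => w t * deriv (fun z => k z t) z₀)
      (MeasureTheory.volume.restrict (Set.uIoc (0 : ℝ) 1)) := by
    -- the derivative is the limit of difference quotients
    refine aestronglyMeasurable_of_tendsto_ae (u := (atTop : Filter ℕ))
      (f := fun (n : ℕ) t => w t * ((((r / 4) / (n + 2) : ℝ) : ℂ)⁻¹ *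
        (k (z₀ + ((r / 4) / (n + 2) : ℝ)) t - k z₀ t))) ?_ ?_
    · intro n
      have hmem : z₀ + ((r / 4) / (n + 2) : ℝ) ∈ U := by
        refine hbU ?_
        rw [Metric.mem_ball, dist_eq_norm, add_sub_cancel_left, norm_real, Real.norm_eq_abs,
          abs_of_pos (by positivity)]
        exact div_lt_self (by positivity) (by have : (0 : ℝ) ≤ n := by positivity
                                              linarith)
      have := ((hmeas _ hmem).sub (hmeas _ hz₀)).const_mul ((((r / 4) / (n + 2) : ℝ) : ℂ)⁻¹)
      refine this.congr (Eventually.of_forall fun t => ?_)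
      simp only [Pi.sub_apply]
      ring
    · rw [hIoc]
      refine (MeasureTheory.ae_restrict_mem measurableSet_Ioc).mono fun t ht => ?_
      refine Tendsto.const_mul _ ?_
      have hda := ((hd t (Set.Ioc_subset_Icc_self ht)).differentiableAt
        (hU.mem_nhds hz₀)).hasDerivAt
      have hl := hasDerivAt_iff_tendsto_slope_zero.1 hda
      refine hl.comp (tendsto_nhdsWithin_iff.2 ⟨?_, Eventually.of_forall fun n => ?_⟩)
      · have h0 : Tendsto (fun n : ℕ => (r / 4) / ((n : ℝ) + 2)) atTop (𝓝 0) :=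
          tendsto_const_nhds.div_atTop (tendsto_atTop_add_const_right _ _
            tendsto_natCast_atTop_atTop)
        exact_mod_cast (continuous_ofReal.tendsto 0).comp h0
      · simp only [Set.mem_compl_iff, Set.mem_singleton_iff, ofReal_eq_zero]
        positivity
  have := intervalIntegral.hasDerivAt_integral_of_dominated_loc_of_deriv_le
    (F := fun z t => w t * k z t) (F' := fun z t => w t * deriv (fun z => k z t) z)
    (x₀ := z₀) (s := Metric.ball z₀ (r / 4)) (bound := fun t => ‖w t‖ * (C / (r / 4)))
    (Metric.ball_mem_nhds z₀ (by positivity))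
    (by filter_upwards [hU.mem_nhds hz₀] with z hz using hmeas z hz) hz₀i hderivmeas
    (Eventually.of_forall fun t ht x hx => by
      rw [norm_mul]
      gcongr
      exact hsub x hx t (Set.Ioc_subset_Icc_self (hIoc ▸ ht)))
    (hw.norm.mul_const _)
    (Eventually.of_forall fun t ht x hx => by
      refine HasDerivAt.const_mul _ ?_
      exact ((hd t (Set.Ioc_subset_Icc_self (hIoc ▸ ht))).differentiableAt
        (hU.mem_nhds (hbU hx))).hasDerivAt)
  exact this.2.differentiableAt.differentiableWithinAt

theorem ordinaryHypergeometric_self_right (a : ℂ) {b : ℂ} (hb : ∀ n : ℕ, b + n ≠ 0) {z : ℂ}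
    (hz : ‖z‖ < 1) : ₂F₁ a b b z = (1 - z) ^ (-a) := by
  have h := one_add_cpow_hasFPowerSeriesOnBall_zero (a := -a)
  have h1 := h.hasSum (y := -z) (by
    simp only [Metric.mem_eball, edist_zero_right, enorm_neg]
    rwa [← ofReal_norm, ENNReal.ofReal_lt_one])
  rw [binomialSeries_eq_ordinaryHypergeometricSeries (b := b)
    (fun k h => hb k (by rw [h]; ring))] at h1
  have h2 := hasSum_ordinaryHypergeometric a b b hz
  rw [neg_neg] at h1
  rw [zero_add, ← sub_eq_add_neg] at h1
  refine h2.unique (h1.congr_fun ?_)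
  intro n
  simp [ordinaryHypergeometricSeries, FormalMultilinearSeries.compContinuousLinearMap,
    FormalMultilinearSeries.ofScalars]

theorem betaIntegral_add_natCast {b e : ℂ} (hb : 0 < b.re) (he : 0 < e.re) (n : ℕ) :
    (ascPochhammer ℂ n).eval (b + e) * betaIntegral (b + n) e =
      (ascPochhammer ℂ n).eval b * betaIntegral b e := by
  have hG : ∀ s : ℂ, 0 < s.re → Gamma (s + n) = (ascPochhammer ℂ n).eval s * Gamma s := by
    intro s hs
    induction n with
    | zero => simp
    | succ n ih =>
      rw [ascPochhammer_succ_eval, Nat.cast_succ, ← add_assoc, Gamma_add_one, ih]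
      · ring
      · intro h0
        have := congrArg re h0
        simp only [add_re, natCast_re, zero_re] at this
        have h1 : (0 : ℝ) ≤ n := n.cast_nonneg
        linarith
  have h1 := Gamma_mul_Gamma_eq_betaIntegral hb he
  have h2 := Gamma_mul_Gamma_eq_betaIntegral (s := b + n) (t := e) (by
    simp only [add_re, natCast_re]; positivity) he
  have hbe : 0 < (b + e).re := by simp only [add_re]; positivity
  rw [hG b hb, show b + n + e = b + e + n by ring, hG (b + e) hbe] at h2
  have h3 : Gamma (b + e) ≠ 0 := Gamma_ne_zero_of_re_pos hbe
  apply mul_left_cancel₀ h3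
  linear_combination -h2 + (ascPochhammer ℂ n).eval b * h1

/-- Euler's integral: continuation of the hypergeometric series for `0 < Re b < Re c`. -/
theorem exists_continuation_of_re_pos {a b e : ℂ} (hb : 0 < b.re) (he : 0 < e.re) :
    ∃ f, IsHypergeometricContinuation a b (b + e) f := by
  set w : ℝ → ℂ := fun x => (x : ℂ) ^ (b - 1) * (1 - (x : ℂ)) ^ (e - 1) with hw
  have hwi : IntervalIntegrable w MeasureTheory.volume 0 1 := betaIntegral_convergent hb he
  have hbe : 0 < (b + e).re := by simp only [add_re]; positivity
  have hne : ∀ s : ℂ, 0 < s.re → ∀ n : ℕ, s + n ≠ 0 := by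
    intro s hs n h0
    have := congrArg re h0
    simp only [add_re, natCast_re, zero_re] at this
    have h1 : (0 : ℝ) ≤ n := n.cast_nonneg
    linarith
  have hB : betaIntegral b e ≠ 0 := by
    intro h0
    have h1 := Gamma_mul_Gamma_eq_betaIntegral hb he
    rw [h0, mul_zero] at h1
    exact mul_ne_zero (Gamma_ne_zero_of_re_pos hb) (Gamma_ne_zero_of_re_pos he) h1
  refine ⟨fun z => (betaIntegral b e)⁻¹ * ∫ t in (0 : ℝ)..1, w t * (1 - z * t) ^ (-a), ?_, ?_⟩
  · refine DifferentiableOn.const_mul ?_ _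
    refine differentiableOn_intervalIntegral isOpen_cutPlane hwi
      (k := fun z t => (1 - z * t) ^ (-a)) ?_ ?_
    · refine ContinuousOn.cpow (by fun_prop) (by fun_prop) ?_
      rintro ⟨z, t⟩ ⟨hz, ht⟩
      exact mul_ofReal_mem_cutPlane hz ht.1 ht.2
    · intro t ht z hz
      refine DifferentiableAt.differentiableWithinAt ?_
      exact DifferentiableAt.cpow (by fun_prop) (by fun_prop)
        (mul_ofReal_mem_cutPlane hz ht.1 ht.2)
  · intro z hz
    have key : HasSum (fun n => ∫ t in (0 : ℝ)..1,
          w t * (ordinaryHypergeometricCoefficient a 1 1 n * (z * t) ^ n))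
        (∫ t in (0 : ℝ)..1, w t * (1 - z * t) ^ (-a)) := by
      refine intervalIntegral.hasSum_integral_of_dominated_convergence
        (fun n t => ‖w t‖ * (‖ordinaryHypergeometricCoefficient a 1 1 n‖ * ‖z‖ ^ n)) ?_ ?_ ?_ ?_ ?_
      · intro n
        refine hwi.aestronglyMeasurable_restrict_uIoc.mul ?_
        exact Continuous.aestronglyMeasurable (by fun_prop)
      · refine fun n => Eventually.of_forall fun t ht => ?_
        rw [Set.uIoc_of_le zero_le_one] at ht
        rw [norm_mul (w t), norm_mul (ordinaryHypergeometricCoefficient a 1 1 n), norm_pow,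
          norm_mul z]
        have : ‖(t : ℂ)‖ ≤ 1 := by
          rw [norm_real, Real.norm_eq_abs, abs_of_pos ht.1]; exact ht.2
        gcongr
        exact mul_le_of_le_one_right (norm_nonneg _) this
      · refine Eventually.of_forall fun t _ => ?_
        exact (summable_norm_hypergeometricCoefficient a 1 1 (norm_nonneg z) hz).mul_left _
      · simp_rw [tsum_mul_left]
        exact hwi.norm.mul_const _
      · refine Eventually.of_forall fun t ht => ?_
        rw [Set.uIoc_of_le zero_le_one] at ht
        have hzt : ‖z * t‖ < 1 := by
          rw [norm_mul, norm_real, Real.norm_eq_abs, abs_of_pos ht.1]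
          exact (mul_le_of_le_one_right (norm_nonneg _) ht.2).trans_lt hz
        have := hasSum_ordinaryHypergeometric a 1 1 hzt
        rw [ordinaryHypergeometric_self_right a (hne 1 (by simp)) hzt] at this
        exact this.mul_left _
    have key2 := key.mul_left (betaIntegral b e)⁻¹
    refine key2.unique ((hasSum_ordinaryHypergeometric a b (b + e) hz).congr_fun ?_)
    intro n
    have h1 : ∫ t in (0 : ℝ)..1, w t * (ordinaryHypergeometricCoefficient a 1 1 n * (z * t) ^ n) =
        ordinaryHypergeometricCoefficient a 1 1 n * z ^ n * betaIntegral (b + n) e := by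
      rw [betaIntegral, ← intervalIntegral.integral_const_mul]
      refine intervalIntegral.integral_congr_ae (Eventually.of_forall fun t ht => ?_)
      rw [Set.uIoc_of_le zero_le_one] at ht
      have ht0 : (t : ℂ) ≠ 0 := by exact_mod_cast ht.1.ne'
      simp only [hw]
      rw [show b + n - 1 = (b - 1) + n by ring, cpow_add _ _ ht0, cpow_natCast, mul_pow]
      ring
    have h2 := betaIntegral_add_natCast hb he n
    have hz0 : ∀ m, (ascPochhammer ℂ m).eval (b + e) ≠ 0 := by
      intro m h0
      obtain ⟨k, -, hk⟩ := (ascPochhammer_eval_eq_zero_iff m (b + e)).1 h0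
      exact hne _ hbe k (by rw [hk]; ring)
    have h3 : betaIntegral (b + n) e =
        (ascPochhammer ℂ n).eval b * betaIntegral b e / (ascPochhammer ℂ n).eval (b + e) := by
      rw [eq_div_iff (hz0 n), ← h2]; ring
    have h4 : (ascPochhammer ℂ n).eval (1 : ℂ) ≠ 0 := by
      intro h0
      obtain ⟨k, -, hk⟩ := (ascPochhammer_eval_eq_zero_iff n (1 : ℂ)).1 h0
      exact hne 1 (by simp) k (by rw [hk]; ring)
    rw [h1, h3]
    simp only [ordinaryHypergeometricCoefficient]
    have := hz0 n
    field_simp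

theorem continuation_deriv {a b c : ℂ} {f : ℂ → ℂ} (hf : IsHypergeometricContinuation a b c f)
    {z : ℂ} (hz : ‖z‖ < 1) : deriv f z = deriv (₂F₁ a b c) z := by
  refine EventuallyEq.deriv_eq ?_
  filter_upwards [Metric.isOpen_ball.mem_nhds (mem_ball_zero_iff.2 hz)] with w hw
  exact hf.2 w (mem_ball_zero_iff.1 hw)

theorem exists_continuation_lower_third {a b c : ℂ} (hc0 : ∀ n : ℕ, c + n ≠ 0)
    (h : ∃ f, IsHypergeometricContinuation a b (c + 1) f) :
    ∃ f, IsHypergeometricContinuation a b c f := by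
  obtain ⟨f, hf⟩ := h
  have hc : c ≠ 0 := by simpa using hc0 0
  have hf1 : DifferentiableOn ℂ f cutPlane := hf.1
  refine ⟨fun z => c⁻¹ * (z * deriv f z + c * f z), ?_, fun z hz => ?_⟩
  · have := hf1.deriv isOpen_cutPlane
    change DifferentiableOn ℂ _ cutPlane
    fun_prop
  · beta_reduce
    rw [continuation_deriv hf hz, hf.2 z hz, lower_third a b c hc0 hz, inv_mul_cancel_left₀ hc]

theorem exists_continuation_lower_second {a b c : ℂ} (hc0 : ∀ n : ℕ, c + n ≠ 0)
    (hbc : c - b - 1 ≠ 0) (h : ∃ f, IsHypergeometricContinuation a (b + 1) c f) :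
    ∃ f, IsHypergeometricContinuation a b c f := by
  obtain ⟨f, hf⟩ := h
  have hf1 : DifferentiableOn ℂ f cutPlane := hf.1
  refine ⟨fun z => (c - b - 1)⁻¹ * (z * (1 - z) * deriv f z + (c - b - 1 - a * z) * f z), ?_,
    fun z hz => ?_⟩
  · have := hf1.deriv isOpen_cutPlane
    change DifferentiableOn ℂ _ cutPlane
    fun_prop
  · beta_reduce
    rw [continuation_deriv hf hz, hf.2 z hz, lower_second a b c hc0 hz, inv_mul_cancel_left₀ hbc]

/-- The hypergeometric series continues to `ℂ \ [1, ∞)` for all parameters: Euler's integral covers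
large parameters, and contiguity relations lower them. -/
theorem exists_hypergeometricContinuation (a b c : ℂ) (hc0 : ∀ n : ℕ, c + n ≠ 0) :
    ∃ f, IsHypergeometricContinuation a b c f := by
  have lowerSecond : ∀ (N : ℕ) (b c : ℂ), 0 < b.re + N → b.re + N < c.re → (∀ n : ℕ, c + n ≠ 0) →
      ∃ f, IsHypergeometricContinuation a b c f := by
    intro N
    induction N with
    | zero =>
      intro b c h1 h2 _
      have := exists_continuation_of_re_pos (a := a) (b := b) (e := c - b) (by simpa using h1)
        (by simpa using h2)
      simpa using this
    | succ N ih =>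
      intro b c h1 h2 hc
      push_cast at h1 h2
      refine exists_continuation_lower_second hc ?_ (ih (b + 1) c ?_ ?_ hc)
      · intro h0
        have := congrArg re h0
        simp only [sub_re, one_re, zero_re] at this
        have h3 : (0 : ℝ) ≤ N := N.cast_nonneg
        linarith
      · simp only [add_re, one_re]; linarith
      · simp only [add_re, one_re]; linarith
  have lowerThird : ∀ (M : ℕ) (c : ℂ), (∀ n : ℕ, c + n ≠ 0) →
      (∃ f, IsHypergeometricContinuation a b (c + M) f) →
      ∃ f, IsHypergeometricContinuation a b c f := by
    intro M
    induction M with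
    | zero => intro c _ h; simpa using h
    | succ M ih =>
      intro c hc h
      refine exists_continuation_lower_third hc (ih (c + 1) (fun n => ?_) ?_)
      · have := hc (n + 1); push_cast at this; rwa [add_assoc, add_comm 1]
      · push_cast at h; rwa [add_assoc, add_comm 1]
  obtain ⟨N, hN⟩ := exists_nat_gt (-b.re)
  obtain ⟨M, hM⟩ := exists_nat_gt (b.re + N - c.re)
  refine lowerThird M c hc0 (lowerSecond N b (c + M) (by linarith) ?_ ?_)
  · simp only [add_re, natCast_re]; linarith
  · intro n; have := hc0 (M + n); push_cast at this; rwa [add_assoc]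

theorem isHypergeometricContinuation_hypergeometric (a b c : ℂ) (hc0 : ∀ n : ℕ, c + n ≠ 0) :
    IsHypergeometricContinuation a b c (hypergeometric a b c) := by
  obtain ⟨f, hf⟩ := exists_hypergeometricContinuation a b c hc0
  have h : ∀ z ∈ cutPlane, hypergeometric a b c z = f z := fun z hz => hypergeometric_eq hf hz
  exact ⟨hf.1.congr h, fun z hz => by rw [h z (mem_cutPlane_of_norm_lt_one hz), hf.2 z hz]⟩

/-! ### The connection formula -/

theorem ascPochhammer_eval_ne_zero {c : ℂ} (hc0 : ∀ n : ℕ, c + n ≠ 0) (m : ℕ) :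
    (ascPochhammer ℂ m).eval c ≠ 0 := by
  intro h0
  obtain ⟨k, -, hk⟩ := (ascPochhammer_eval_eq_zero_iff m c).1 h0
  exact hc0 k (by rw [hk]; ring)

theorem ascPochhammer_eval_succ_left (n : ℕ) (x : ℂ) :
    (ascPochhammer ℂ (n + 1)).eval x = x * (ascPochhammer ℂ n).eval (x + 1) := by
  rw [ascPochhammer_succ_left]; simp

/-- The hypergeometric differential equation, written in terms of `F(a + 1, b + 1; c + 1)`, a
multiple of the derivative of `F(a, b; c)`. -/
theorem hypergeometric_ode (a b c : ℂ) (hc0 : ∀ n : ℕ, c + n ≠ 0) {z : ℂ} (hz : ‖z‖ < 1) :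
    z * (1 - z) * deriv (₂F₁ (a + 1) (b + 1) (c + 1)) z +
      (c - (a + b + 1) * z) * ₂F₁ (a + 1) (b + 1) (c + 1) z = c * ₂F₁ a b c z := by
  have h1 := hasSum_mul_deriv_ordinaryHypergeometric (a + 1) (b + 1) (c + 1) hz
  have h0 := hasSum_ordinaryHypergeometric (a + 1) (b + 1) (c + 1) hz
  have h2 := (hasSum_ordinaryHypergeometric a b c hz).mul_left c
  have h4 := (hasSum_nat_add_iff' 1).2 (h1.add (h0.mul_left c))
  have h5 := ((h1.add (h0.mul_left (a + b + 1))).mul_left (-z))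
  have h6 := (h4.add h5)
  have h7 := (hasSum_nat_add_iff' 1).2 h2
  have key := h6.unique (h7.congr_fun ?_)
  · simp only [Finset.range_one, Finset.sum_singleton, pow_zero, mul_one, Nat.cast_zero,
      zero_add, ordinaryHypergeometricCoefficient, Nat.factorial_zero, ascPochhammer_zero,
      Polynomial.eval_one, Nat.cast_one, inv_one] at key
    linear_combination key
  intro n
  have e1 := ascPochhammer_eval_ne_zero (c := c + 1)
    (fun m => by have := hc0 (m + 1); push_cast at this; rwa [add_assoc, add_comm 1]) n
  have e2 : c + 1 + n ≠ 0 := by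
    have := hc0 (n + 1); push_cast at this; rwa [add_assoc, add_comm 1]
  have e3 : c ≠ 0 := by simpa using hc0 0
  have hn : ((n : ℂ) + 1) ≠ 0 := by exact_mod_cast n.succ_ne_zero
  have hf : (n.factorial : ℂ) ≠ 0 := by exact_mod_cast n.factorial_ne_zero
  simp only [ordinaryHypergeometricCoefficient, ascPochhammer_eval_succ_left n a,
    ascPochhammer_eval_succ_left n b, ascPochhammer_eval_succ_left n c,
    ascPochhammer_succ_eval, Nat.factorial_succ,
    Nat.cast_mul, Nat.cast_succ, mul_inv]
  field_simp
  ring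

/-- Raising of the third parameter:
`c ((1 - z) d/dz + c - a - b) F(a, b; c) = (c - a) (c - b) F(a, b; c + 1)`. -/
theorem raise_third (a b c : ℂ) (hc0 : ∀ n : ℕ, c + n ≠ 0) {z : ℂ} (hz : ‖z‖ < 1) :
    c * ((1 - z) * deriv (₂F₁ a b c) z + (c - a - b) * ₂F₁ a b c z) =
      (c - a) * (c - b) * ₂F₁ a b (c + 1) z := by
  have h1 := hasSum_mul_deriv_ordinaryHypergeometric a b c hz
  have h1' := hasSum_deriv_ordinaryHypergeometric a b c hz
  have h0 := hasSum_ordinaryHypergeometric a b c hz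
  have h2 := (hasSum_ordinaryHypergeometric a b (c + 1) hz).mul_left ((c - a) * (c - b))
  have h6 := ((h1'.add (h1.mul_left (-1))).add (h0.mul_left (c - a - b))).mul_left c
  have key := h6.unique (h2.congr_fun ?_)
  · linear_combination key
  intro n
  have e1 := ascPochhammer_eval_ne_zero hc0 n
  have e2 := ascPochhammer_eval_ne_zero (c := c + 1)
    (fun m => by have := hc0 (m + 1); push_cast at this; rwa [add_assoc, add_comm 1]) n
  have e3 := hc0 n
  have hn : ((n : ℂ) + 1) ≠ 0 := by exact_mod_cast n.succ_ne_zero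
  have hf : (n.factorial : ℂ) ≠ 0 := by exact_mod_cast n.factorial_ne_zero
  have hp : (ascPochhammer ℂ n).eval (c + 1) * c = (ascPochhammer ℂ n).eval c * (c + n) := by
    rw [← ascPochhammer_succ_eval, ascPochhammer_succ_left]; simp [mul_comm]
  have hp' : ((ascPochhammer ℂ n).eval (c + 1))⁻¹ =
      c * ((ascPochhammer ℂ n).eval c)⁻¹ * (c + n)⁻¹ := by
    field_simp
    linear_combination -hp
  simp only [ordinaryHypergeometricCoefficient, ascPochhammer_succ_eval, Nat.factorial_succ,
    Nat.cast_mul, Nat.cast_succ, mul_inv, hp']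
  field_simp
  ring

/-- A solution of `q' = s`, `s' = -μ² q` with `q(0) = 0`, `s(0) = 1` is `s = cos μθ`,
`μ q = sin μθ`. -/
theorem eq_cos_sin_of_hasDerivAt {μ : ℂ} {R : ℝ} {q s : ℝ → ℂ}
    (hq : ∀ θ ∈ Set.Ioo (-R) R, HasDerivAt q (s θ) θ)
    (hs : ∀ θ ∈ Set.Ioo (-R) R, HasDerivAt s (-μ ^ 2 * q θ) θ) (hq0 : q 0 = 0) (hs0 : s 0 = 1)
    {θ : ℝ} (hθ : θ ∈ Set.Ioo (-R) R) : s θ = cos (μ * θ) ∧ μ * q θ = sin (μ * θ) := by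
  have hR : 0 < R := by have := hθ.1.trans hθ.2; linarith
  have hcos : ∀ θ : ℝ, HasDerivAt (fun θ : ℝ => cos (μ * θ)) (-sin (μ * θ) * μ) θ := by
    intro θ
    have := ((hasDerivAt_id (θ : ℂ)).const_mul μ).ccos.comp_ofReal
    simpa using this
  have hsin : ∀ θ : ℝ, HasDerivAt (fun θ : ℝ => sin (μ * θ)) (cos (μ * θ) * μ) θ := by
    intro θ
    have := ((hasDerivAt_id (θ : ℂ)).const_mul μ).csin.comp_ofReal
    simpa using this
  have hconst : ∀ h : ℝ → ℂ, (∀ θ ∈ Set.Ioo (-R) R, HasDerivAt h 0 θ) → h θ = h 0 := by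
    intro h hh
    exact isOpen_Ioo.is_const_of_deriv_eq_zero isPreconnected_Ioo
      (fun x hx => (hh x hx).differentiableAt.differentiableWithinAt)
      (fun x hx => (hh x hx).deriv) hθ ⟨by linarith, hR⟩
  have h1 := hconst (fun θ => s θ * cos (μ * θ) + μ * q θ * sin (μ * θ)) (fun x hx => by
    have := ((hs x hx).mul (hcos x)).add (((hq x hx).const_mul μ).mul (hsin x))
    refine this.congr_deriv ?_
    ring)
  have h2 := hconst (fun θ => s θ * sin (μ * θ) - μ * q θ * cos (μ * θ)) (fun x hx => by
    have := ((hs x hx).mul (hsin x)).sub (((hq x hx).const_mul μ).mul (hcos x))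
    refine this.congr_deriv ?_
    ring)
  simp only [hq0, hs0, ofReal_zero, mul_zero, cos_zero, sin_zero, add_zero, mul_one,
    sub_zero] at h1 h2
  have h3 := cos_sq_add_sin_sq (μ * θ)
  constructor
  · linear_combination cos (μ * θ) * h1 + sin (μ * θ) * h2 - s θ * h3
  · linear_combination sin (μ * θ) * h1 - cos (μ * θ) * h2 - μ * q θ * h3

theorem half_sub_add_natCast_ne_zero (k n : ℕ) : (1 / 2 - k + n : ℂ) ≠ 0 := by
  intro h
  have h1 : ((1 - 2 * k + 2 * n : ℤ) : ℂ) = 0 := by push_cast; linear_combination 2 * h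
  have h2 : (1 - 2 * k + 2 * n : ℤ) = 0 := by exact_mod_cast h1
  lia

theorem norm_sin_sq_lt_one {θ : ℝ} (hθ : θ ∈ Set.Ioo (-(Real.pi / 2)) (Real.pi / 2)) :
    ‖(sin (θ : ℂ)) ^ 2‖ < 1 := by
  have h := Real.cos_pos_of_mem_Ioo hθ
  rw [← ofReal_sin, ← ofReal_pow, norm_real, Real.norm_eq_abs, abs_of_nonneg (sq_nonneg _)]
  have := Real.sin_sq_add_cos_sq θ
  nlinarith

theorem hasDerivAt_ordinaryHypergeometric_sin_sq (a b c : ℂ) {θ : ℝ}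
    (hθ : θ ∈ Set.Ioo (-(Real.pi / 2)) (Real.pi / 2)) :
    HasDerivAt (fun θ : ℝ => ₂F₁ a b c (sin (θ : ℂ) ^ 2))
      (deriv (₂F₁ a b c) (sin (θ : ℂ) ^ 2) * (2 * sin (θ : ℂ) * cos θ)) θ := by
  have h1 := (differentiableAt_ordinaryHypergeometric a b c (norm_sin_sq_lt_one hθ)).hasDerivAt
  have h2 := ((hasDerivAt_sin (θ : ℂ)).pow 2)
  have := (h1.comp (θ : ℂ) h2).comp_ofReal
  refine this.congr_deriv ?_
  simp

/-- `F(λ, -λ; 1/2; sin² θ) = cos 2λθ`. -/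
theorem hypergeometric_sin_sq_eq_cos (lam : ℂ) {θ : ℝ}
    (hθ : θ ∈ Set.Ioo (-(Real.pi / 2)) (Real.pi / 2)) :
    ₂F₁ lam (-lam) (1 / 2 : ℂ) (sin (θ : ℂ) ^ 2) = cos (2 * lam * θ) := by
  have hc0 : ∀ n : ℕ, (1 / 2 + n : ℂ) ≠ 0 := by simpa using half_sub_add_natCast_ne_zero 0
  refine (eq_cos_sin_of_hasDerivAt (μ := 2 * lam)
    (q := fun θ : ℝ => sin (θ : ℂ) * cos θ *
      ₂F₁ (lam + 1) (-lam + 1) (1 / 2 + 1 : ℂ) (sin (θ : ℂ) ^ 2))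
    (s := fun θ : ℝ => ₂F₁ lam (-lam) (1 / 2 : ℂ) (sin (θ : ℂ) ^ 2)) ?_ ?_ ?_ ?_ hθ).1
  · intro θ hθ
    have h1 := (hasDerivAt_sin (θ : ℂ)).comp_ofReal
    have h2 := (hasDerivAt_cos (θ : ℂ)).comp_ofReal
    have h3 := hasDerivAt_ordinaryHypergeometric_sin_sq (lam + 1) (-lam + 1) (1 / 2 + 1) hθ
    refine ((h1.mul h2).mul h3).congr_deriv ?_
    have h4 := hypergeometric_ode lam (-lam) (1 / 2) hc0 (norm_sin_sq_lt_one hθ)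
    have h5 := cos_sq' (θ : ℂ)
    simp only [Pi.mul_apply]
    linear_combination 2 * h4 + (₂F₁ (lam + 1) (-lam + 1) (1 / 2 + 1 : ℂ) (sin (θ : ℂ) ^ 2) +
      2 * sin (θ : ℂ) ^ 2 *
        deriv (₂F₁ (lam + 1) (-lam + 1) (1 / 2 + 1 : ℂ)) (sin (θ : ℂ) ^ 2)) * h5
  · intro θ hθ
    have h3 := hasDerivAt_ordinaryHypergeometric_sin_sq lam (-lam) (1 / 2) hθ
    refine h3.congr_deriv ?_
    rw [(hasDerivAt_ordinaryHypergeometric lam (-lam) (1 / 2) (by norm_num)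
      (norm_sin_sq_lt_one hθ)).deriv]
    ring
  · simp
  · simp

/-- `2λ sin θ F(1/2 - λ, 1/2 + λ; 3/2; sin² θ) = sin 2λθ`. -/
theorem hypergeometric_sin_sq_eq_sin (lam : ℂ) {θ : ℝ}
    (hθ : θ ∈ Set.Ioo (-(Real.pi / 2)) (Real.pi / 2)) :
    2 * lam * (sin (θ : ℂ) * ₂F₁ (1 / 2 - lam) (1 / 2 + lam) (1 / 2 + 1 : ℂ) (sin (θ : ℂ) ^ 2)) =
      sin (2 * lam * θ) := by
  have hc0 : ∀ n : ℕ, (1 / 2 + n : ℂ) ≠ 0 := by simpa using half_sub_add_natCast_ne_zero 0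
  refine (eq_cos_sin_of_hasDerivAt (μ := 2 * lam)
    (q := fun θ : ℝ => sin (θ : ℂ) *
      ₂F₁ (1 / 2 - lam) (1 / 2 + lam) (1 / 2 + 1 : ℂ) (sin (θ : ℂ) ^ 2))
    (s := fun θ : ℝ => cos (θ : ℂ) *
      ₂F₁ (1 / 2 - lam) (1 / 2 + lam) (1 / 2 : ℂ) (sin (θ : ℂ) ^ 2)) ?_ ?_ ?_ ?_ hθ).2
  · intro θ hθ
    have h1 := (hasDerivAt_sin (θ : ℂ)).comp_ofReal
    have h3 := hasDerivAt_ordinaryHypergeometric_sin_sq (1 / 2 - lam) (1 / 2 + lam) (1 / 2 + 1) hθ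
    refine (h1.mul h3).congr_deriv ?_
    have h4 := lower_third (1 / 2 - lam) (1 / 2 + lam) (1 / 2) hc0 (norm_sin_sq_lt_one hθ)
    linear_combination 2 * cos (θ : ℂ) * h4
  · intro θ hθ
    have h1 := (hasDerivAt_cos (θ : ℂ)).comp_ofReal
    have h3 := hasDerivAt_ordinaryHypergeometric_sin_sq (1 / 2 - lam) (1 / 2 + lam) (1 / 2) hθ
    refine (h1.mul h3).congr_deriv ?_
    have h4 := raise_third (1 / 2 - lam) (1 / 2 + lam) (1 / 2) hc0 (norm_sin_sq_lt_one hθ)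
    have h5 := cos_sq' (θ : ℂ)
    linear_combination 4 * sin (θ : ℂ) * h4 + 2 * sin (θ : ℂ) *
      deriv (₂F₁ (1 / 2 - lam) (1 / 2 + lam) (1 / 2 : ℂ)) (sin (θ : ℂ) ^ 2) * h5
  · simp
  · simp

/-- The coefficient of the singular term in the connection formula,
`Γ(k + 1/2) Γ(k - 1/2) / (Γ(k + λ) Γ(k - λ))`. -/
noncomputable def connectionCoeff (k : ℕ) (lam : ℂ) : ℂ :=
  Gamma (k + 1 / 2) * Gamma (k - 1 / 2) * ((Gamma (k + lam))⁻¹ * (Gamma (k - lam))⁻¹)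

theorem connectionCoeff_zero (lam : ℂ) :
    connectionCoeff 0 lam = 2 * lam * sin (Real.pi * lam) := by
  by_cases hl : lam = 0
  · simp [connectionCoeff, hl]
  have h1 : Gamma (1 / 2 : ℂ) = (-1 / 2) * Gamma (-1 / 2 : ℂ) := by
    have := Gamma_add_one (-1 / 2 : ℂ) (by norm_num)
    rw [← this]; norm_num
  have h2 : Gamma (1 / 2 : ℂ) * Gamma (1 / 2 : ℂ) = Real.pi := by
    have := Gamma_mul_Gamma_one_sub (1 / 2 : ℂ)
    rw [show (1 : ℂ) - 1 / 2 = 1 / 2 by norm_num] at this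
    rw [this, show (Real.pi : ℂ) * (1 / 2) = Real.pi / 2 by ring, sin_pi_div_two, div_one]
  have h3 : Gamma (1 - lam) = -lam * Gamma (-lam) := by
    have := Gamma_add_one (-lam) (by simpa using hl)
    rw [← this]; ring_nf
  have h4 := Gamma_mul_Gamma_one_sub lam
  have hpi : (Real.pi : ℂ) ≠ 0 := by exact_mod_cast Real.pi_ne_zero
  have h5 : (Gamma lam)⁻¹ * (Gamma (-lam))⁻¹ = -lam * sin (Real.pi * lam) / Real.pi := by
    rw [h3] at h4
    rw [← mul_inv, show Gamma lam * Gamma (-lam) = Real.pi / sin (Real.pi * lam) / (-lam) by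
      rw [← h4]; field_simp]
    simp only [div_eq_mul_inv, mul_inv, inv_inv, inv_neg]
    ring
  simp only [connectionCoeff, Nat.cast_zero, zero_add, zero_sub]
  rw [h5, show -(1 / 2 : ℂ) = -1 / 2 by norm_num,
    show Gamma (1 / 2 : ℂ) * Gamma (-1 / 2 : ℂ) = -2 * Real.pi by rw [← h2, h1]; ring]
  field_simp

theorem connectionCoeff_succ (k : ℕ) {lam : ℂ} (h1 : k + lam ≠ 0) (h2 : k - lam ≠ 0) :
    (k + lam) * (k - lam) * connectionCoeff (k + 1) lam =
      (k + 1 / 2) * (k - 1 / 2) * connectionCoeff k lam := by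
  have e1 : (k + 1 / 2 : ℂ) ≠ 0 := by
    have := half_sub_add_natCast_ne_zero 0 k
    push_cast at this; rw [sub_zero] at this; rwa [add_comm]
  have e2 : (k - 1 / 2 : ℂ) ≠ 0 := by
    have := half_sub_add_natCast_ne_zero k 0
    rw [Nat.cast_zero, add_zero] at this
    rw [← neg_sub]; exact neg_ne_zero.2 this
  simp only [connectionCoeff, Nat.cast_add, Nat.cast_one]
  rw [show (k : ℂ) + 1 + 1 / 2 = k + 1 / 2 + 1 by ring, Gamma_add_one _ e1,
    show (k : ℂ) + 1 - 1 / 2 = k - 1 / 2 + 1 by ring, Gamma_add_one _ e2,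
    show (k : ℂ) + 1 + lam = k + lam + 1 by ring, Gamma_add_one _ h1,
    show (k : ℂ) + 1 - lam = k - lam + 1 by ring, Gamma_add_one _ h2]
  simp only [mul_inv]
  field_simp

/-- The connection formula between `0` and `1` on the real interval for non-integral `λ`, by
differentiating the trigonometric case `k = 0`. -/
theorem connection_formula_real_of_ne (k : ℕ) {lam : ℂ}
    (hlam : ∀ n : ℕ, (n + lam : ℂ) ≠ 0 ∧ (n - lam : ℂ) ≠ 0)
    {t : ℝ} (ht : t ∈ Set.Ioo (0 : ℝ) 1) :
    ₂F₁ (k + lam) (k - lam) (k + 1 / 2 : ℂ) (t : ℂ) =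
      (-1) ^ k * cos (Real.pi * lam) * ₂F₁ (k + lam) (k - lam) (k + 1 / 2 : ℂ) (1 - t : ℂ) +
      connectionCoeff k lam * ((1 - t : ℂ) ^ (1 / 2 - k : ℂ) *
        ₂F₁ (1 / 2 - lam) (1 / 2 + lam) (1 / 2 - k + 1 : ℂ) (1 - t : ℂ)) := by
  induction k generalizing t with
  | zero =>
    -- substitute `t = sin² θ`, so that `1 - t = sin² (π/2 - θ)`
    set θ := Real.arcsin (Real.sqrt t) with hθ
    have hs1 : Real.sqrt t < 1 := by rw [Real.sqrt_lt' one_pos]; simpa using ht.2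
    have hs0 : 0 < Real.sqrt t := Real.sqrt_pos.2 ht.1
    have hsin : Real.sin θ = Real.sqrt t := Real.sin_arcsin (by linarith) hs1.le
    have hθ0 : 0 < θ := Real.arcsin_pos.2 hs0
    have hθ1 : θ < Real.pi / 2 := Real.arcsin_lt_pi_div_two.2 hs1
    have hm1 : θ ∈ Set.Ioo (-(Real.pi / 2)) (Real.pi / 2) := ⟨by linarith [Real.pi_pos], hθ1⟩
    have hm2 : Real.pi / 2 - θ ∈ Set.Ioo (-(Real.pi / 2)) (Real.pi / 2) :=
      ⟨by linarith, by linarith⟩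
    have ht1 : (t : ℂ) = sin (θ : ℂ) ^ 2 := by
      rw [← ofReal_sin, hsin, ← ofReal_pow, Real.sq_sqrt ht.1.le]
    have ht2 : (1 - t : ℂ) = sin ((Real.pi / 2 - θ : ℝ) : ℂ) ^ 2 := by
      rw [ht1, ← cos_sq']; push_cast; rw [sin_pi_div_two_sub]
    have hpow : (1 - t : ℂ) ^ (1 / 2 : ℂ) = sin ((Real.pi / 2 - θ : ℝ) : ℂ) := by
      rw [ht2, ← ofReal_sin, ← ofReal_pow]
      have h0 : 0 ≤ Real.sin (Real.pi / 2 - θ) :=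
        Real.sin_nonneg_of_nonneg_of_le_pi (by linarith) (by linarith [Real.pi_pos])
      have : ((1 / 2 : ℝ) : ℂ) = (1 / 2 : ℂ) := by push_cast; rfl
      rw [← this, ← ofReal_cpow (sq_nonneg _), ← Real.sqrt_eq_rpow, Real.sqrt_sq h0]
    rw [connectionCoeff_zero]
    simp only [Nat.cast_zero, zero_add, zero_sub, sub_zero, pow_zero, one_mul]
    rw [hpow, ht2, ht1, hypergeometric_sin_sq_eq_cos lam hm1, hypergeometric_sin_sq_eq_cos lam hm2]
    have h6 := hypergeometric_sin_sq_eq_sin lam hm2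
    have h7 : (2 * lam * θ : ℂ) = Real.pi * lam - 2 * lam * ((Real.pi / 2 - θ : ℝ) : ℂ) := by
      push_cast; ring
    rw [h7, cos_sub, ← h6]
    ring
  | succ k ih =>
    obtain ⟨hl1, hl2⟩ := hlam k
    have e1 : (k + 1 / 2 : ℂ) ≠ 0 := by
      have := half_sub_add_natCast_ne_zero 0 k
      push_cast at this; rw [sub_zero] at this; rwa [add_comm]
    have htn : ‖(t : ℂ)‖ < 1 := by
      rw [norm_real, Real.norm_eq_abs, abs_of_pos ht.1]; exact ht.2
    have hun : ‖(1 - t : ℂ)‖ < 1 := by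
      rw [← ofReal_one, ← ofReal_sub, norm_real, Real.norm_eq_abs, abs_of_pos (by linarith [ht.2])]
      linarith [ht.1]
    have hu0 : (1 - t : ℂ) ≠ 0 := by
      rw [← ofReal_one, ← ofReal_sub]; exact_mod_cast (by linarith [ht.2] : 1 - t ≠ 0)
    have hsl : (1 - t : ℂ) ∈ slitPlane := by
      rw [← ofReal_one, ← ofReal_sub, ofReal_mem_slitPlane]; linarith [ht.2]
    -- both sides of the formula for `k`, and their derivatives
    have hL :=
      (hasDerivAt_ordinaryHypergeometric (k + lam) (k - lam) (k + 1 / 2) e1 htn).comp_ofReal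
    have hsub : HasDerivAt (fun z : ℂ => 1 - z) (-1) (t : ℂ) := by
      simpa using (hasDerivAt_id (t : ℂ)).const_sub 1
    have hR1 := ((hasDerivAt_ordinaryHypergeometric (k + lam) (k - lam) (k + 1 / 2) e1 hun).comp
      (t : ℂ) hsub).comp_ofReal.const_mul ((-1) ^ k * cos (Real.pi * lam))
    have hF2 := (differentiableAt_ordinaryHypergeometric (1 / 2 - lam) (1 / 2 + lam)
      (1 / 2 - k + 1) hun).hasDerivAt
    have hP := (hasDerivAt_id (1 - t : ℂ)).cpow_const (c := (1 / 2 - k : ℂ)) hsl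
    have hR2 := ((hP.mul hF2).comp (t : ℂ) hsub).comp_ofReal.const_mul (connectionCoeff k lam)
    have hEq : deriv (fun t : ℝ => ₂F₁ (k + lam) (k - lam) (k + 1 / 2 : ℂ) (t : ℂ)) t =
        deriv (fun t : ℝ => (-1) ^ k * cos (Real.pi * lam) *
          ₂F₁ (k + lam) (k - lam) (k + 1 / 2 : ℂ) (1 - t : ℂ) +
          connectionCoeff k lam * ((1 - t : ℂ) ^ (1 / 2 - k : ℂ) *
          ₂F₁ (1 / 2 - lam) (1 / 2 + lam) (1 / 2 - k + 1 : ℂ) (1 - t : ℂ))) t := by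
      refine EventuallyEq.deriv_eq ?_
      filter_upwards [isOpen_Ioo.mem_nhds ht] with t ht using ih ht
    rw [hL.deriv] at hEq
    have hR := (hR1.add hR2).deriv
    have hEq2 := hEq.trans hR
    have h3 := lower_third (1 / 2 - lam) (1 / 2 + lam) (1 / 2 - k)
      (half_sub_add_natCast_ne_zero k) hun
    have hpw : (1 - t : ℂ) ^ (1 / 2 - k : ℂ) = (1 - t : ℂ) ^ (1 / 2 - k - 1 : ℂ) * (1 - t) := by
      rw [cpow_sub (1 / 2 - k : ℂ) 1 hu0, cpow_one]; field_simp
    have h4 := connectionCoeff_succ k hl1 hl2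
    simp only [id_eq, hpw] at hEq2
    push_cast
    rw [show (1 / 2 - (k + 1) + 1 : ℂ) = 1 / 2 - k by ring,
      show (1 / 2 - (k + 1) : ℂ) = 1 / 2 - k - 1 by ring,
      show (k + 1 + lam : ℂ) = k + lam + 1 by ring, show (k + 1 - lam : ℂ) = k - lam + 1 by ring,
      show (k + 1 + 1 / 2 : ℂ) = k + 1 / 2 + 1 by ring]
    have h5 : ((k + lam) * (k - lam) / (k + 1 / 2) : ℂ) ≠ 0 :=
      div_ne_zero (mul_ne_zero hl1 hl2) e1
    apply mul_left_cancel₀ h5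
    have h6 : (k + lam) * (k - lam) / (k + 1 / 2) * connectionCoeff (k + 1) lam =
        (k - 1 / 2) * connectionCoeff k lam := by
      rw [div_mul_eq_mul_div, h4, div_eq_iff e1]; ring
    rw [pow_succ]
    linear_combination hEq2 - connectionCoeff k lam * (1 - t : ℂ) ^ (1 / 2 - k - 1 : ℂ) * h3 -
      (1 - t : ℂ) ^ (1 / 2 - k - 1 : ℂ) *
        ₂F₁ (1 / 2 - lam) (1 / 2 + lam) (1 / 2 - k : ℂ) (1 - t : ℂ) * h6

theorem norm_ascPochhammer_eval_le {a : ℂ} {R : ℝ} (ha : ‖a‖ ≤ R) (n : ℕ) :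
    ‖(ascPochhammer ℂ n).eval a‖ ≤ ‖(ascPochhammer ℂ n).eval (R : ℂ)‖ := by
  have hR : 0 ≤ R := (norm_nonneg a).trans ha
  induction n with
  | zero => simp
  | succ n ih =>
    rw [ascPochhammer_succ_eval, ascPochhammer_succ_eval, norm_mul, norm_mul]
    gcongr
    refine (norm_add_le _ _).trans ?_
    rw [← ofReal_natCast, ← ofReal_add, norm_real, norm_real, Real.norm_eq_abs, Real.norm_eq_abs,
      abs_of_nonneg n.cast_nonneg, abs_of_nonneg (by positivity : 0 ≤ R + n)]
    gcongr

/-- The hypergeometric series depends continuously on its first two parameters. -/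
theorem continuous_ordinaryHypergeometric_param {a b : ℂ → ℂ} (ha : Continuous a)
    (hb : Continuous b) (c : ℂ) {z : ℂ} (hz : ‖z‖ < 1) :
    Continuous (fun lam => ₂F₁ (a lam) (b lam) c z) := by
  rw [continuous_iff_continuousAt]
  intro l₀
  obtain ⟨R, hR⟩ : ∃ R, max ‖a l₀‖ ‖b l₀‖ < R := exists_gt _
  have hU : {l | ‖a l‖ < R} ∩ {l | ‖b l‖ < R} ∈ 𝓝 l₀ := by
    refine IsOpen.mem_nhds ?_ ⟨(le_max_left _ _).trans_lt hR, (le_max_right _ _).trans_lt hR⟩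
    exact (isOpen_lt ha.norm continuous_const).inter (isOpen_lt hb.norm continuous_const)
  have h : ContinuousOn (fun l => ∑' n, ordinaryHypergeometricCoefficient (a l) (b l) c n * z ^ n)
      ({l | ‖a l‖ < R} ∩ {l | ‖b l‖ < R}) := by
    refine continuousOn_tsum
      (u := fun n => ‖ordinaryHypergeometricCoefficient (R : ℂ) (R : ℂ) c n‖ * ‖z‖ ^ n) ?_
      (summable_norm_hypergeometricCoefficient R R c (norm_nonneg z) hz) ?_
    · intro n
      have h1 := (ascPochhammer ℂ n).continuous.comp ha
      have h2 := (ascPochhammer ℂ n).continuous.comp hb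
      simp only [Function.comp_def] at h1 h2
      exact (((continuous_const.mul h1).mul h2).mul continuous_const |>.mul
        continuous_const).continuousOn
    · intro n l hl
      have h1 := norm_ascPochhammer_eval_le (le_of_lt hl.1) n
      have h2 := norm_ascPochhammer_eval_le (le_of_lt hl.2) n
      simp only [ordinaryHypergeometricCoefficient, norm_mul, norm_pow]
      gcongr
  refine (h.continuousAt hU).congr (Eventually.of_forall fun l => ?_)
  exact (hasSum_ordinaryHypergeometric (a l) (b l) c hz).tsum_eq

theorem continuous_connectionCoeff (k : ℕ) : Continuous (connectionCoeff k) := by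
  have h := differentiable_one_div_Gamma.continuous
  unfold connectionCoeff
  exact continuous_const.mul ((h.comp (by fun_prop : Continuous fun l : ℂ => (k : ℂ) + l)).mul
    (h.comp (by fun_prop : Continuous fun l : ℂ => (k : ℂ) - l)))

/-- The connection formula on the real interval: integral `λ` are reached by continuity. -/
theorem connection_formula_real (k : ℕ) (lam : ℂ) {t : ℝ} (ht : t ∈ Set.Ioo (0 : ℝ) 1) :
    ₂F₁ (k + lam) (k - lam) (k + 1 / 2 : ℂ) (t : ℂ) =
      (-1) ^ k * cos (Real.pi * lam) * ₂F₁ (k + lam) (k - lam) (k + 1 / 2 : ℂ) (1 - t : ℂ) +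
      connectionCoeff k lam * ((1 - t : ℂ) ^ (1 / 2 - k : ℂ) *
        ₂F₁ (1 / 2 - lam) (1 / 2 + lam) (1 / 2 - k + 1 : ℂ) (1 - t : ℂ)) := by
  have htn : ‖(t : ℂ)‖ < 1 := by
    rw [norm_real, Real.norm_eq_abs, abs_of_pos ht.1]; exact ht.2
  have hun : ‖(1 - t : ℂ)‖ < 1 := by
    rw [← ofReal_one, ← ofReal_sub, norm_real, Real.norm_eq_abs, abs_of_pos (by linarith [ht.2])]
    linarith [ht.1]
  have hcount : (Set.range (fun n : ℕ => (n : ℂ)) ∪ Set.range (fun n : ℕ => -(n : ℂ))).Countable :=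
    (Set.countable_range _).union (Set.countable_range _)
  have hdense : Dense (Set.range (fun n : ℕ => (n : ℂ)) ∪ Set.range (fun n : ℕ => -(n : ℂ)))ᶜ :=
    hcount.dense_compl ℝ
  have c1 : Continuous fun l : ℂ => (k : ℂ) + l := by fun_prop
  have c2 : Continuous fun l : ℂ => (k : ℂ) - l := by fun_prop
  have c3 : Continuous fun l : ℂ => (1 / 2 : ℂ) - l := by fun_prop
  have c4 : Continuous fun l : ℂ => (1 / 2 : ℂ) + l := by fun_prop
  have c5 : Continuous fun l : ℂ => (-1 : ℂ) ^ k * cos (Real.pi * l) :=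
    continuous_const.mul (continuous_cos.comp (by fun_prop))
  refine congrFun (Continuous.ext_on hdense
    (continuous_ordinaryHypergeometric_param c1 c2 (k + 1 / 2) htn)
    ((c5.mul (continuous_ordinaryHypergeometric_param c1 c2 (k + 1 / 2) hun)).add
      ((continuous_connectionCoeff k).mul (continuous_const.mul
        (continuous_ordinaryHypergeometric_param c3 c4 (1 / 2 - k + 1) hun)))) ?_) lam
  intro l hl
  refine connection_formula_real_of_ne k (fun n => ⟨fun h => hl (Or.inr ⟨n, ?_⟩),
    fun h => hl (Or.inl ⟨n, ?_⟩)⟩) ht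
  · exact (eq_neg_of_add_eq_zero_right h).symm
  · exact sub_eq_zero.1 h

/-- The connection formula for the continued functions, on `ℂ` without `(-∞, 0]` and `[1, ∞)`. -/
theorem connection_formula (k : ℕ) (lam : ℂ) {z : ℂ} (h1 : 1 - z ∈ slitPlane)
    (h0 : z ∈ slitPlane) :
    hypergeometric (k + lam) (k - lam) (k + 1 / 2) z =
      (-1) ^ k * cos (Real.pi * lam) * hypergeometric (k + lam) (k - lam) (k + 1 / 2) (1 - z) +
      connectionCoeff k lam * ((1 - z) ^ (1 / 2 - k : ℂ) *
        hypergeometric (1 / 2 - lam) (1 / 2 + lam) (1 / 2 - k + 1) (1 - z)) := by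
  set U : Set ℂ := cutPlane ∩ slitPlane with hU
  have hUo : IsOpen U := isOpen_cutPlane.inter isOpen_slitPlane
  have hF := isHypergeometricContinuation_hypergeometric (k + lam) (k - lam) (k + 1 / 2)
    (fun n => by
      have := half_sub_add_natCast_ne_zero 0 (k + n); push_cast at this
      convert this using 1; ring)
  have hF2 := isHypergeometricContinuation_hypergeometric (1 / 2 - lam) (1 / 2 + lam)
    (1 / 2 - k + 1) (fun n => by
      have := half_sub_add_natCast_ne_zero k (n + 1); push_cast at this
      convert this using 1; ring)
  have hsubm : Set.MapsTo (fun z : ℂ => 1 - z) U cutPlane := by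
    intro z hz
    change 1 - (1 - z) ∈ slitPlane
    rw [sub_sub_cancel]; exact hz.2
  have hd1 : DifferentiableOn ℂ (hypergeometric (k + lam) (k - lam) (k + 1 / 2)) U :=
    DifferentiableOn.mono hF.1 Set.inter_subset_left
  have hd2 : DifferentiableOn ℂ
      (fun z => hypergeometric (k + lam) (k - lam) (k + 1 / 2) (1 - z)) U :=
    DifferentiableOn.comp
      (g := hypergeometric (k + lam) (k - lam) (k + 1 / 2)) (t := cutPlane) hF.1 (by fun_prop) hsubm
  have hd3 : DifferentiableOn ℂ
      (fun z => hypergeometric (1 / 2 - lam) (1 / 2 + lam) (1 / 2 - k + 1) (1 - z)) U :=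
    DifferentiableOn.comp
      (g := hypergeometric (1 / 2 - lam) (1 / 2 + lam) (1 / 2 - k + 1)) (t := cutPlane) hF2.1
      (by fun_prop) hsubm
  have hd4 : DifferentiableOn ℂ (fun z : ℂ => (1 - z) ^ (1 / 2 - k : ℂ)) U := by
    intro z hz
    refine DifferentiableAt.differentiableWithinAt ?_
    exact DifferentiableAt.cpow (by fun_prop) (by fun_prop) hz.1
  have hR := (hd2.const_mul ((-1) ^ k * cos (Real.pi * lam))).add
    ((hd4.mul hd3).const_mul (connectionCoeff k lam))
  have hhalf : (1 / 2 : ℂ) ∈ U := by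
    constructor
    · exact mem_cutPlane_of_norm_lt_one (by norm_num)
    · left; norm_num
  have hstar : StarConvex ℝ (1 / 2 : ℂ) U := by
    have e : ∀ w : ℂ, w ∈ slitPlane → ∀ s t : ℝ, 0 ≤ s → 0 ≤ t → s + t = 1 →
        s • (1 / 2 : ℂ) + t • w ∈ slitPlane := by
      intro w hw s t hs ht hst
      have hre : (s • (1 / 2 : ℂ) + t • w).re = s / 2 + t * w.re := by
        simp; ring
      have him : (s • (1 / 2 : ℂ) + t • w).im = t * w.im := by simp
      rcases ht.eq_or_lt with rfl | ht'
      · left; rw [hre]; linarith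
      rcases hw with hw | hw
      · left; rw [hre]; positivity
      · right; rw [him]; exact mul_ne_zero ht'.ne' hw
    intro w hw s t hs ht hst
    refine ⟨?_, e w hw.2 s t hs ht hst⟩
    change 1 - (s • (1 / 2 : ℂ) + t • w) ∈ slitPlane
    have h2 : 1 - (s • (1 / 2 : ℂ) + t • w) = s • (1 / 2 : ℂ) + t • (1 - w) := by
      have : ((s : ℂ) + t) = 1 := by exact_mod_cast hst
      simp only [real_smul]
      linear_combination (-1 : ℂ) * this
    rw [h2]
    exact e _ hw.1 s t hs ht hst
  refine AnalyticOnNhd.eqOn_of_preconnected_of_frequently_eq (hd1.analyticOnNhd hUo)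
    (hR.analyticOnNhd hUo) (hstar.isPathConnected hhalf).isConnected.isPreconnected hhalf ?_
    ⟨h1, h0⟩
  -- the two sides agree on a real interval around `1/2`
  have hne : Tendsto (fun n : ℕ => ((1 / 2 + 1 / ((n : ℝ) + 3) : ℝ) : ℂ)) atTop (𝓝[≠] (1 / 2)) := by
    refine tendsto_nhdsWithin_iff.2 ⟨?_, Eventually.of_forall fun n => ?_⟩
    · have h0 : Tendsto (fun n : ℕ => 1 / 2 + 1 / ((n : ℝ) + 3)) atTop (𝓝 (1 / 2 + 0)) :=
        tendsto_const_nhds.add (tendsto_const_nhds.div_atTop (tendsto_atTop_add_const_right _ _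
          tendsto_natCast_atTop_atTop))
      have h3 : Tendsto (fun n : ℕ => ((1 / 2 + 1 / ((n : ℝ) + 3) : ℝ) : ℂ)) atTop
          (𝓝 ((1 / 2 + 0 : ℝ) : ℂ)) := (continuous_ofReal.tendsto _).comp h0
      rwa [show ((1 / 2 + 0 : ℝ) : ℂ) = 1 / 2 by push_cast; ring] at h3
    · have : (1 / 2 + 1 / ((n : ℝ) + 3) : ℝ) ≠ 1 / 2 := by
        have : 0 < 1 / ((n : ℝ) + 3) := by positivity
        linarith
      intro h
      apply this
      have h' : ((1 / 2 + 1 / ((n : ℝ) + 3) : ℝ) : ℂ) = ((1 / 2 : ℝ) : ℂ) := by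
        rw [Set.mem_singleton_iff.1 h]; push_cast; rfl
      exact_mod_cast h'
  refine hne.frequently (Eventually.of_forall fun n => ?_).frequently
  set t : ℝ := 1 / 2 + 1 / ((n : ℝ) + 3) with ht
  have htm : t ∈ Set.Ioo (0 : ℝ) 1 := by
    have h3 : 0 < 1 / ((n : ℝ) + 3) := by positivity
    have h4 : 1 / ((n : ℝ) + 3) < 1 / 2 := by
      apply one_div_lt_one_div_of_lt (by norm_num)
      have : (0 : ℝ) ≤ n := n.cast_nonneg
      linarith
    constructor <;> simp only [ht] <;> linarith
  have htn : ‖(t : ℂ)‖ < 1 := by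
    rw [norm_real, Real.norm_eq_abs, abs_of_pos htm.1]; exact htm.2
  have hun : ‖(1 - t : ℂ)‖ < 1 := by
    rw [← ofReal_one, ← ofReal_sub, norm_real, Real.norm_eq_abs,
      abs_of_pos (by linarith [htm.2])]
    linarith [htm.1]
  simp only [Pi.add_apply, Pi.mul_apply]
  rw [hF.2 _ htn, hF.2 _ hun, hF2.2 _ hun]
  exact connection_formula_real k lam htm

/-! ### Growth and boundary values of the spherical function -/

/-- The domain `ℂ \ (-∞, -1]` of the spherical function. -/
def sphericalDomain : Set ℂ := {s : ℂ | 1 + s ∈ slitPlane}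

theorem isOpen_sphericalDomain : IsOpen sphericalDomain :=
  isOpen_slitPlane.preimage (continuous_const.add continuous_id)

/-- The spherical function `s ↦ F(k + λ, k - λ; k + 1/2; (1 - s)/2)` in dimension `d = 2k + 1`,
so that `Q_λ(z, w)` is its value at `s = β(z, w̄)`. -/
noncomputable def spherical (k : ℕ) (lam s : ℂ) : ℂ :=
  hypergeometric (k + lam) (k - lam) (k + 1 / 2) ((1 - s) / 2)

theorem div_two_mem_slitPlane {w : ℂ} (hw : w ∈ slitPlane) : w / 2 ∈ slitPlane := by
  rcases hw with h | h
  · left; simpa using h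
  · right; simpa using h

theorem mem_cutPlane_of_mem_sphericalDomain {s : ℂ} (hs : s ∈ sphericalDomain) :
    (1 - s) / 2 ∈ cutPlane := by
  change 1 - (1 - s) / 2 ∈ slitPlane
  rw [show 1 - (1 - s) / 2 = (1 + s) / 2 by ring]
  exact div_two_mem_slitPlane hs

theorem isHypergeometricContinuation_half (k : ℕ) (lam : ℂ) :
    IsHypergeometricContinuation (k + lam) (k - lam) (k + 1 / 2)
      (hypergeometric (k + lam) (k - lam) (k + 1 / 2)) :=
  isHypergeometricContinuation_hypergeometric _ _ _ (fun n => by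
    have := half_sub_add_natCast_ne_zero 0 (k + n); push_cast at this
    convert this using 1; ring)

theorem isHypergeometricContinuation_half_sub (k : ℕ) (lam : ℂ) :
    IsHypergeometricContinuation (1 / 2 - lam) (1 / 2 + lam) (1 / 2 - k + 1)
      (hypergeometric (1 / 2 - lam) (1 / 2 + lam) (1 / 2 - k + 1)) :=
  isHypergeometricContinuation_hypergeometric _ _ _ (fun n => by
    have := half_sub_add_natCast_ne_zero k (n + 1); push_cast at this
    convert this using 1; ring)

theorem isPreconnected_cutPlane : IsPreconnected cutPlane := by
  have hmem : (0 : ℂ) ∈ cutPlane := mem_cutPlane_of_norm_lt_one (by simp)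
  have hstar : StarConvex ℝ (0 : ℂ) cutPlane := by
    rw [starConvex_zero_iff]
    intro z hz t ht0 ht1
    rw [real_smul, mul_comm]
    exact mul_ofReal_mem_cutPlane hz ht0 ht1
  exact (hstar.isPathConnected hmem).isConnected.isPreconnected

theorem hasDerivAt_hypergeometric_half (k : ℕ) (lam : ℂ) {z : ℂ} (hz : z ∈ cutPlane) :
    HasDerivAt (hypergeometric (k + lam) (k - lam) (k + 1 / 2))
      ((k + lam) * (k - lam) / (k + 1 / 2) *
        hypergeometric ((k + 1 : ℕ) + lam) ((k + 1 : ℕ) - lam) ((k + 1 : ℕ) + 1 / 2) z) z := by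
  have h1 := isHypergeometricContinuation_half k lam
  have h2 := isHypergeometricContinuation_half (k + 1) lam
  have hd1 : DifferentiableOn ℂ (hypergeometric (k + lam) (k - lam) (k + 1 / 2)) cutPlane := h1.1
  have hd2 : DifferentiableOn ℂ (hypergeometric ((k + 1 : ℕ) + lam) ((k + 1 : ℕ) - lam)
    ((k + 1 : ℕ) + 1 / 2)) cutPlane := h2.1
  have hk : (k + 1 / 2 : ℂ) ≠ 0 := by
    have := half_sub_add_natCast_ne_zero 0 k
    push_cast at this; rw [sub_zero] at this; rwa [add_comm]
  have key := AnalyticOnNhd.eqOn_of_preconnected_of_eventuallyEq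
    ((hd1.deriv isOpen_cutPlane).analyticOnNhd isOpen_cutPlane)
    ((hd2.const_mul ((k + lam) * (k - lam) / (k + 1 / 2))).analyticOnNhd isOpen_cutPlane)
    isPreconnected_cutPlane (mem_cutPlane_of_norm_lt_one (z := 0) (by simp)) (by
      filter_upwards [Metric.ball_mem_nhds (0 : ℂ) one_pos] with w hw
      have hw' : ‖w‖ < 1 := by simpa using hw
      rw [continuation_deriv h1 hw', (hasDerivAt_ordinaryHypergeometric _ _ _ hk hw').deriv,
        h2.2 w hw']
      push_cast
      ring_nf) hz
  exact (hd1.differentiableAt (isOpen_cutPlane.mem_nhds hz)).hasDerivAt.congr_deriv key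

/-- The derivative of the spherical function is a multiple of the one in two dimensions more. -/
theorem hasDerivAt_spherical (k : ℕ) (lam : ℂ) {s : ℂ} (hs : s ∈ sphericalDomain) :
    HasDerivAt (spherical k lam)
      (-((k + lam) * (k - lam) / (2 * k + 1)) * spherical (k + 1) lam s) s := by
  have h1 := hasDerivAt_hypergeometric_half k lam (mem_cutPlane_of_mem_sphericalDomain hs)
  have h2 : HasDerivAt (fun s : ℂ => (1 - s) / 2) (-1 / 2) s :=
    ((hasDerivAt_id s).const_sub 1).div_const 2
  have h3 := h1.comp s h2
  refine h3.congr_deriv ?_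
  have : (2 * k + 1 : ℂ) = 2 * (k + 1 / 2) := by ring
  rw [spherical, this]
  have hk : (k + 1 / 2 : ℂ) ≠ 0 := by
    have := half_sub_add_natCast_ne_zero 0 k
    push_cast at this; rw [sub_zero] at this; rwa [add_comm]
  field_simp

theorem differentiableOn_spherical (k : ℕ) (lam : ℂ) :
    DifferentiableOn ℂ (spherical k lam) sphericalDomain := fun _ hs =>
  (hasDerivAt_spherical k lam hs).differentiableAt.differentiableWithinAt

/-- Holomorphic functions on `ℂ \ (-∞, -1]` that grow at most like `|1 + s|⁻ᵐ` near the cut,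
locally uniformly. -/
def ModerateGrowth (m : ℕ) (f : ℂ → ℂ) : Prop :=
  DifferentiableOn ℂ f sphericalDomain ∧
    ∀ R : ℝ, ∃ C : ℝ, 0 ≤ C ∧ ∀ s ∈ sphericalDomain, ‖s‖ ≤ R → ‖f s‖ ≤ C * (‖1 + s‖⁻¹) ^ m

theorem spherical_eq_connection (k : ℕ) (lam : ℂ) {s : ℂ} (hs : s ∈ sphericalDomain)
    (hre : (1 + s).re < 2) :
    spherical k lam s = (-1) ^ k * cos (Real.pi * lam) *
        hypergeometric (k + lam) (k - lam) (k + 1 / 2) ((1 + s) / 2) +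
      connectionCoeff k lam * (((1 + s) / 2) ^ (1 / 2 - k : ℂ) *
        hypergeometric (1 / 2 - lam) (1 / 2 + lam) (1 / 2 - k + 1) ((1 + s) / 2)) := by
  have h := connection_formula k lam (mem_cutPlane_of_mem_sphericalDomain hs) (by
    left
    rw [show (1 - s) / 2 = 1 - (1 + s) / 2 by ring, sub_re, one_re, div_ofNat_re]
    linarith)
  rw [show 1 - (1 - s) / 2 = (1 + s) / 2 by ring] at h
  exact h

/-- By the connection formula, the spherical function is `O(|1 + s|^(1/2 - k))` at the cut. -/
theorem moderateGrowth_spherical (k : ℕ) (lam : ℂ) : ModerateGrowth k (spherical k lam) := by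
  refine ⟨differentiableOn_spherical k lam, fun R => ?_⟩
  -- `Re (1 + s) ≥ 1` is away from the cut
  have hK1 : IsCompact {s : ℂ | ‖s‖ ≤ R ∧ 1 ≤ (1 + s).re} := by
    have : {s : ℂ | ‖s‖ ≤ R ∧ 1 ≤ (1 + s).re} = Metric.closedBall 0 R ∩ {s | 1 ≤ (1 + s).re} := by
      ext s; simp
    rw [this]
    exact (isCompact_closedBall 0 R).inter_right
      (isClosed_le continuous_const (continuous_re.comp (by fun_prop)))
  have hK2 : IsCompact {u : ℂ | ‖u‖ ≤ 1 + R ∧ u.re ≤ 1 / 2} := by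
    have : {u : ℂ | ‖u‖ ≤ 1 + R ∧ u.re ≤ 1 / 2} =
        Metric.closedBall 0 (1 + R) ∩ {u | u.re ≤ 1 / 2} := by
      ext s; simp
    rw [this]
    exact (isCompact_closedBall 0 _).inter_right (isClosed_le continuous_re continuous_const)
  have hsub2 : {u : ℂ | ‖u‖ ≤ 1 + R ∧ u.re ≤ 1 / 2} ⊆ cutPlane := by
    rintro u ⟨-, hu⟩
    left
    rw [sub_re, one_re]; linarith
  have hc1 : ContinuousOn (hypergeometric (k + lam) (k - lam) (k + 1 / 2)) cutPlane :=
    (isHypergeometricContinuation_half k lam).1.continuousOn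
  have hc2 : ContinuousOn (hypergeometric (1 / 2 - lam) (1 / 2 + lam) (1 / 2 - k + 1)) cutPlane :=
    (isHypergeometricContinuation_half_sub k lam).1.continuousOn
  obtain ⟨C1, hC1⟩ := hK1.exists_bound_of_continuousOn
    ((differentiableOn_spherical k lam).continuousOn.mono (fun s hs => Or.inl (by
      linarith [hs.2])))
  obtain ⟨C2, hC2⟩ := hK2.exists_bound_of_continuousOn (hc1.mono hsub2)
  obtain ⟨C3, hC3⟩ := hK2.exists_bound_of_continuousOn (hc2.mono hsub2)
  set A := ‖(-1) ^ k * cos (Real.pi * lam)‖ with hA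
  set B := ‖connectionCoeff k lam‖ with hB
  set S := 1 + |R| with hS
  have hS1 : 1 ≤ S := by simp [hS]
  refine ⟨(|C1| + A * |C2|) * S ^ k + B * (S ^ (1 / 2 : ℝ) * 2 ^ k * |C3|), by positivity, ?_⟩
  intro s hs hsR
  have hR0 : 0 ≤ R := (norm_nonneg s).trans hsR
  have hs0 : 1 + s ≠ 0 := slitPlane_ne_zero hs
  have hn0 : 0 < ‖1 + s‖ := norm_pos_iff.2 hs0
  have hnS : ‖1 + s‖ ≤ S := by
    refine (norm_add_le _ _).trans ?_
    rw [norm_one, hS, abs_of_nonneg hR0]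
    linarith
  have hone : 1 ≤ S ^ k * (‖1 + s‖⁻¹) ^ k := by
    rw [← mul_pow]
    apply one_le_pow₀
    rw [← div_eq_mul_inv, le_div_iff₀ hn0]
    linarith
  by_cases hre : 1 ≤ (1 + s).re
  · calc ‖spherical k lam s‖ ≤ |C1| := (hC1 s ⟨hsR, hre⟩).trans (le_abs_self _)
      _ ≤ |C1| * (S ^ k * (‖1 + s‖⁻¹) ^ k) := le_mul_of_one_le_right (abs_nonneg _) hone
      _ ≤ ((|C1| + A * |C2|) * S ^ k + B * (S ^ (1 / 2 : ℝ) * 2 ^ k * |C3|)) *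
          (‖1 + s‖⁻¹) ^ k := by
        rw [← mul_assoc]
        gcongr
        have h1 : 0 ≤ A * |C2| * S ^ k := by positivity
        have h2 : 0 ≤ B * (S ^ (1 / 2 : ℝ) * 2 ^ k * |C3|) := by positivity
        linarith
  · push Not at hre
    have hu : (1 + s) / 2 ∈ {u : ℂ | ‖u‖ ≤ 1 + R ∧ u.re ≤ 1 / 2} := by
      constructor
      · rw [norm_div, RCLike.norm_ofNat]
        rw [hS, abs_of_nonneg hR0] at hnS
        linarith
      · rw [div_ofNat_re]; linarith
    rw [spherical_eq_connection k lam hs (by linarith)]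
    have hpow : ‖((1 + s) / 2) ^ (1 / 2 - k : ℂ)‖ ≤ S ^ (1 / 2 : ℝ) * 2 ^ k * (‖1 + s‖⁻¹) ^ k := by
      have hu0 : (1 + s) / 2 ≠ 0 := div_ne_zero hs0 two_ne_zero
      have hup : 0 < ‖(1 + s) / 2‖ := norm_pos_iff.2 hu0
      rw [norm_cpow_of_ne_zero hu0]
      have him : (1 / 2 - k : ℂ).im = 0 := by simp
      have hre' : (1 / 2 - k : ℂ).re = 1 / 2 - k := by simp
      rw [him, hre', mul_zero, Real.exp_zero, div_one, Real.rpow_sub hup, Real.rpow_natCast,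
        div_eq_mul_inv, ← inv_pow, mul_assoc, ← mul_pow]
      have h2 : ‖(1 + s) / 2‖⁻¹ = 2 * ‖1 + s‖⁻¹ := by
        rw [norm_div, RCLike.norm_ofNat, inv_div]; ring
      rw [h2]
      gcongr
      rw [norm_div, RCLike.norm_ofNat]
      linarith
    calc _ ≤ A * |C2| + B * ((S ^ (1 / 2 : ℝ) * 2 ^ k * (‖1 + s‖⁻¹) ^ k) * |C3|) := by
          refine (norm_add_le _ _).trans ?_
          rw [norm_mul, norm_mul (connectionCoeff k lam),
            norm_mul (((1 + s) / 2) ^ (1 / 2 - k : ℂ))]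
          gcongr
          · exact (hC2 _ hu).trans (le_abs_self _)
          · exact (hC3 _ hu).trans (le_abs_self _)
      _ ≤ A * |C2| * (S ^ k * (‖1 + s‖⁻¹) ^ k) +
          B * ((S ^ (1 / 2 : ℝ) * 2 ^ k * (‖1 + s‖⁻¹) ^ k) * |C3|) := by
          have := le_mul_of_one_le_right (by positivity : 0 ≤ A * |C2|) hone
          linarith
      _ ≤ _ := by
          have : 0 ≤ |C1| * S ^ k * (‖1 + s‖⁻¹) ^ k := by positivity
          linarith

theorem moderateGrowth_deriv_spherical (k : ℕ) (lam : ℂ) :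
    ModerateGrowth (k + 1) (deriv (spherical k lam)) := by
  refine ⟨(differentiableOn_spherical k lam).deriv isOpen_sphericalDomain, fun R => ?_⟩
  obtain ⟨C, hC0, hC⟩ := (moderateGrowth_spherical (k + 1) lam).2 R
  refine ⟨‖((k + lam) * (k - lam) / (2 * k + 1) : ℂ)‖ * C, by positivity, fun s hs hsR => ?_⟩
  rw [(hasDerivAt_spherical k lam hs).deriv, norm_mul, norm_neg, mul_assoc]
  gcongr
  exact hC s hs hsR

/-- The boundary value of the spherical function at `r < -1`, from the upper half plane for
`σ = 1` and from the lower half plane for `σ = -1`. -/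
noncomputable def sphericalBoundary (k : ℕ) (lam : ℂ) (σ r : ℝ) : ℂ :=
  (-1) ^ k * cos (Real.pi * lam) *
      hypergeometric (k + lam) (k - lam) (k + 1 / 2) (((1 + r) / 2 : ℝ) : ℂ) +
    connectionCoeff k lam * (exp ((Real.log ‖(1 + r) / 2‖ + σ * Real.pi * I) * (1 / 2 - k)) *
      hypergeometric (1 / 2 - lam) (1 / 2 + lam) (1 / 2 - k + 1) (((1 + r) / 2 : ℝ) : ℂ))

theorem tendsto_spherical_of_tendsto_log (k : ℕ) (lam : ℂ) {r σ : ℝ} (hr : r < -1) {l : Filter ℂ}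
    (hl : l ≤ 𝓝 (r : ℂ)) (hdom : ∀ᶠ s in l, s ∈ sphericalDomain)
    (hlog : Tendsto (fun s : ℂ => log ((1 + s) / 2)) l
      (𝓝 (Real.log ‖(1 + r) / 2‖ + σ * Real.pi * I))) :
    Tendsto (spherical k lam) l (𝓝 (sphericalBoundary k lam σ r)) := by
  have hu : Tendsto (fun s : ℂ => (1 + s) / 2) l (𝓝 (((1 + r) / 2 : ℝ) : ℂ)) := by
    have : Tendsto (fun s : ℂ => (1 + s) / 2) (𝓝 (r : ℂ)) (𝓝 ((1 + (r : ℂ)) / 2)) :=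
      Continuous.tendsto (by fun_prop) _
    push_cast
    exact this.mono_left hl
  have hcut : (((1 + r) / 2 : ℝ) : ℂ) ∈ cutPlane := by
    left
    rw [← ofReal_one, ← ofReal_sub, ofReal_re]
    linarith
  have hc1 := ((isHypergeometricContinuation_half k lam).1.continuousOn.continuousAt
    (isOpen_cutPlane.mem_nhds hcut)).tendsto.comp hu
  have hc2 := ((isHypergeometricContinuation_half_sub k lam).1.continuousOn.continuousAt
    (isOpen_cutPlane.mem_nhds hcut)).tendsto.comp hu
  have hp : Tendsto (fun s : ℂ => ((1 + s) / 2) ^ (1 / 2 - k : ℂ)) l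
      (𝓝 (exp ((Real.log ‖(1 + r) / 2‖ + σ * Real.pi * I) * (1 / 2 - k)))) := by
    refine ((continuous_exp.tendsto _).comp (hlog.mul_const (1 / 2 - k : ℂ))).congr' ?_
    filter_upwards [hdom] with s hs
    rw [cpow_def_of_ne_zero (div_ne_zero (slitPlane_ne_zero hs) two_ne_zero)]
    rfl
  refine ((hc1.const_mul ((-1) ^ k * cos (Real.pi * lam))).add
    ((hp.mul hc2).const_mul (connectionCoeff k lam))).congr' ?_
  have hre : ∀ᶠ s in l, (1 + s).re < 2 := by
    refine hl ?_
    refine (isOpen_lt (continuous_re.comp (by fun_prop)) continuous_const).mem_nhds ?_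
    simp only [Function.comp, Set.mem_ofPred_eq, add_re, one_re, ofReal_re]
    linarith
  filter_upwards [hdom, hre] with s hs hs2
  rw [spherical_eq_connection k lam hs hs2]
  rfl

theorem tendsto_spherical_above (k : ℕ) (lam : ℂ) {r : ℝ} (hr : r < -1) :
    Tendsto (spherical k lam) (𝓝[{s : ℂ | 0 < s.im}] (r : ℂ))
      (𝓝 (sphericalBoundary k lam 1 r)) := by
  refine tendsto_spherical_of_tendsto_log k lam hr nhdsWithin_le_nhds ?_ ?_
  · filter_upwards [self_mem_nhdsWithin] with s hs
    right
    simpa using (ne_of_gt hs)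
  · have h := tendsto_log_nhdsWithin_im_nonneg_of_re_neg_of_im_zero
      (z := (((1 + r) / 2 : ℝ) : ℂ)) (by rw [ofReal_re]; linarith) (by simp)
    have h2 : Tendsto (fun s : ℂ => (1 + s) / 2) (𝓝[{s : ℂ | 0 < s.im}] (r : ℂ))
        (𝓝[{z : ℂ | 0 ≤ z.im}] (((1 + r) / 2 : ℝ) : ℂ)) := by
      refine tendsto_nhdsWithin_iff.2 ⟨?_, ?_⟩
      · have : Tendsto (fun s : ℂ => (1 + s) / 2) (𝓝 (r : ℂ)) (𝓝 ((1 + (r : ℂ)) / 2)) :=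
          Continuous.tendsto (by fun_prop) _
        push_cast
        exact this.mono_left nhdsWithin_le_nhds
      · filter_upwards [self_mem_nhdsWithin] with s hs
        simp only [div_ofNat_im, add_im, one_im, zero_add]
        exact div_nonneg (le_of_lt hs) two_pos.le
    have h3 := h.comp h2
    rw [norm_real] at h3
    simpa [Function.comp_def] using h3

theorem tendsto_spherical_below (k : ℕ) (lam : ℂ) {r : ℝ} (hr : r < -1) :
    Tendsto (spherical k lam) (𝓝[{s : ℂ | s.im < 0}] (r : ℂ))
      (𝓝 (sphericalBoundary k lam (-1) r)) := by
  refine tendsto_spherical_of_tendsto_log k lam hr nhdsWithin_le_nhds ?_ ?_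
  · filter_upwards [self_mem_nhdsWithin] with s hs
    right
    simpa using (ne_of_lt hs)
  · have h := tendsto_log_nhdsWithin_im_neg_of_re_neg_of_im_zero
      (z := (((1 + r) / 2 : ℝ) : ℂ)) (by rw [ofReal_re]; linarith) (by simp)
    have h2 : Tendsto (fun s : ℂ => (1 + s) / 2) (𝓝[{s : ℂ | s.im < 0}] (r : ℂ))
        (𝓝[{z : ℂ | z.im < 0}] (((1 + r) / 2 : ℝ) : ℂ)) := by
      refine tendsto_nhdsWithin_iff.2 ⟨?_, ?_⟩
      · have : Tendsto (fun s : ℂ => (1 + s) / 2) (𝓝 (r : ℂ)) (𝓝 ((1 + (r : ℂ)) / 2)) :=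
          Continuous.tendsto (by fun_prop) _
        push_cast
        exact this.mono_left nhdsWithin_le_nhds
      · filter_upwards [self_mem_nhdsWithin] with s hs
        simp only [div_ofNat_im, add_im, one_im, zero_add]
        exact div_neg_of_neg_of_pos hs two_pos
    have h3 := h.comp h2
    rw [norm_real] at h3
    simpa [Function.comp_def, sub_eq_add_neg] using h3

/-- The jump of the spherical function across the cut. -/
theorem sphericalBoundary_sub (k : ℕ) (lam : ℂ) {r : ℝ} (hr : r < -1) :
    sphericalBoundary k lam 1 r - sphericalBoundary k lam (-1) r =
      2 * I * (-1) ^ k * connectionCoeff k lam *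
        ((((-((1 + r) / 2)) ^ (1 / 2 - k : ℝ) : ℝ) : ℂ) *
          hypergeometric (1 / 2 - lam) (1 / 2 + lam) (1 / 2 - k + 1) (((1 + r) / 2 : ℝ) : ℂ)) := by
  have hpos : 0 < -((1 + r) / 2) := by linarith
  have hnorm : ‖(1 + r) / 2‖ = -((1 + r) / 2) := by
    rw [Real.norm_eq_abs, abs_of_neg (by linarith)]
  have hpow : (((-((1 + r) / 2)) ^ (1 / 2 - k : ℝ) : ℝ) : ℂ) =
      exp (Real.log ‖(1 + r) / 2‖ * (1 / 2 - k)) := by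
    rw [Real.rpow_def_of_pos hpos, ofReal_exp, hnorm]
    push_cast
    rfl
  have hphase : exp (Real.pi * I * (1 / 2 - k)) - exp (-(Real.pi * I * (1 / 2 - k))) =
      2 * I * (-1) ^ k := by
    have h1 : exp (Real.pi * I * (1 / 2 - k)) = I * (-1) ^ k := by
      rw [show (Real.pi * I * (1 / 2 - k) : ℂ) = Real.pi / 2 * I - k * (Real.pi * I) by ring,
        exp_sub, exp_pi_div_two_mul_I, exp_nat_mul, exp_pi_mul_I, div_eq_mul_inv, ← inv_pow]
      norm_num
    rw [exp_neg, h1, mul_inv, ← inv_pow, inv_I]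
    norm_num
    ring
  simp only [sphericalBoundary, hpow]
  rw [add_mul, add_mul, exp_add, exp_add]
  rw [show ((1 : ℝ) * Real.pi * I * (1 / 2 - k) : ℂ) = Real.pi * I * (1 / 2 - k) by push_cast; ring,
    show (((-1 : ℝ) : ℂ) * Real.pi * I * (1 / 2 - k) : ℂ) = -(Real.pi * I * (1 / 2 - k)) by
      push_cast; ring]
  linear_combination connectionCoeff k lam * exp (Real.log ‖(1 + r) / 2‖ * (1 / 2 - k)) *
    hypergeometric (1 / 2 - lam) (1 / 2 + lam) (1 / 2 - k + 1) (((1 + r) / 2 : ℝ) : ℂ) * hphase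

/-! ### The Lorentzian form and Lorentz frames -/

section Form

variable {R : Type*} [CommRing R] {d : ℕ}

theorem beta_comm (x y : Fin (d + 1) → R) : beta x y = beta y x := by
  simp only [beta, mul_comm]

theorem beta_add_right (x y z : Fin (d + 1) → R) : beta x (y + z) = beta x y + beta x z := by
  simp only [beta, Pi.add_apply, mul_add, Finset.sum_add_distrib]
  ring

theorem beta_smul_right (x : Fin (d + 1) → R) (r : R) (y : Fin (d + 1) → R) :
    beta x (r • y) = r * beta x y := by
  simp only [beta, Pi.smul_apply, smul_eq_mul, mul_sub, Finset.mul_sum]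
  congr 1
  · ring
  · exact Finset.sum_congr rfl fun i _ => by ring

theorem beta_add_left (x y z : Fin (d + 1) → R) : beta (x + y) z = beta x z + beta y z := by
  rw [beta_comm, beta_add_right, beta_comm z, beta_comm z]

theorem beta_smul_left (r : R) (x y : Fin (d + 1) → R) : beta (r • x) y = r * beta x y := by
  rw [beta_comm, beta_smul_right, beta_comm]

theorem beta_neg_left (x y : Fin (d + 1) → R) : beta (-x) y = -beta x y := by
  rw [← neg_one_smul R x, beta_smul_left, neg_one_mul]

theorem beta_neg_right (x y : Fin (d + 1) → R) : beta x (-y) = -beta x y := by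
  rw [beta_comm, beta_neg_left, beta_comm]

theorem beta_sub_left (x y z : Fin (d + 1) → R) : beta (x - y) z = beta x z - beta y z := by
  rw [sub_eq_add_neg, beta_add_left, beta_neg_left, sub_eq_add_neg]

theorem beta_sub_right (x y z : Fin (d + 1) → R) : beta x (y - z) = beta x y - beta x z := by
  rw [sub_eq_add_neg, beta_add_right, beta_neg_right, sub_eq_add_neg]

end Form

variable {d : ℕ}

theorem contDiff_beta : ContDiff ℝ ⊤
    (fun p : (Fin (d + 1) → ℝ) × (Fin (d + 1) → ℝ) => beta p.1 p.2) := by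
  unfold beta
  fun_prop

theorem continuous_beta : Continuous
    (fun p : (Fin (d + 1) → ℝ) × (Fin (d + 1) → ℝ) => beta p.1 p.2) :=
  contDiff_beta.continuous

@[fun_prop]
theorem continuous_beta_comp {X : Type*} [TopologicalSpace X] {f g : X → Fin (d + 1) → ℝ}
    (hf : Continuous f) (hg : Continuous g) : Continuous (fun x => beta (f x) (g x)) :=
  continuous_beta.comp (hf.prodMk hg)

@[fun_prop]
theorem contDiff_beta_comp {X : Type*} [NormedAddCommGroup X] [NormedSpace ℝ X] {m : WithTop ℕ∞}
    {f g : X → Fin (d + 1) → ℝ}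
    (hf : ContDiff ℝ m f) (hg : ContDiff ℝ m g) : ContDiff ℝ m (fun x => beta (f x) (g x)) := by
  unfold beta
  fun_prop

/-- On the orthogonal complement of a timelike vector the form is negative semidefinite. -/
theorem beta_self_nonpos_of_orthogonal {n w : Fin (d + 1) → ℝ} (hn : 0 < beta n n)
    (hw : beta n w = 0) : beta w w ≤ 0 := by
  have hcs := Finset.sum_mul_sq_le_sq_mul_sq Finset.univ (fun i : Fin d => n i.succ)
    (fun i => w i.succ)
  simp only [beta] at hn hw ⊢
  simp only [← sq] at hn ⊢
  have hS : 0 ≤ ∑ i : Fin d, n i.succ ^ 2 := Finset.sum_nonneg fun i _ => sq_nonneg _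
  have hW : 0 ≤ ∑ i : Fin d, w i.succ ^ 2 := Finset.sum_nonneg fun i _ => sq_nonneg _
  have h1 : (n 0 * w 0) ^ 2 ≤ (∑ i : Fin d, n i.succ ^ 2) * ∑ i : Fin d, w i.succ ^ 2 := by
    rw [sub_eq_zero.1 hw]; exact hcs
  have h0 : 0 < n 0 ^ 2 := by linarith
  have h2 : n 0 ^ 2 * w 0 ^ 2 ≤ n 0 ^ 2 * ∑ i : Fin d, w i.succ ^ 2 := by
    rw [← mul_pow]
    refine h1.trans ?_
    gcongr
    linarith
  linarith [le_of_mul_le_mul_left h2 h0]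

/-- `x` is a point of de Sitter space and `n` a timelike unit vector orthogonal to it. -/
structure IsFrame (x n : Fin (d + 1) → ℝ) : Prop where
  beta_left : beta x x = -1
  beta_right : beta n n = 1
  beta_mixed : beta n x = 0

theorem IsFrame.beta_mixed' {x n : Fin (d + 1) → ℝ} (h : IsFrame x n) : beta x n = 0 := by
  rw [beta_comm]; exact h.beta_mixed

theorem IsFrame.neg {x n : Fin (d + 1) → ℝ} (h : IsFrame x n) : IsFrame x (-n) :=
  ⟨h.beta_left, by rw [beta_neg_left, beta_neg_right, neg_neg, h.beta_right],
    by rw [beta_neg_left, h.beta_mixed, neg_zero]⟩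

theorem IsFrame.sq_beta_le {x n y : Fin (d + 1) → ℝ} (h : IsFrame x n) (hy : y ∈ deSitter d) :
    beta x y ^ 2 ≤ 1 + beta n y ^ 2 := by
  have hy' : beta y y = -1 := hy
  have h1 := beta_self_nonpos_of_orthogonal (n := n)
    (w := y - beta n y • n + beta x y • x) (by rw [h.beta_right]; exact one_pos) (by
      simp only [beta_add_right, beta_sub_right, beta_smul_right, h.beta_right, h.beta_mixed]
      ring)
  simp only [beta_add_right, beta_sub_right, beta_smul_right, beta_add_left, beta_sub_left,
    beta_smul_left, h.beta_right, h.beta_mixed, h.beta_mixed', h.beta_left, hy', beta_comm y] at h1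
  linarith

/-- The value `β(z, y)` at `z = sin(t) x + i cos(t) n`. -/
noncomputable def frameParam (x n : Fin (d + 1) → ℝ) (t : ℝ) (y : Fin (d + 1) → ℝ) : ℂ :=
  (Real.sin t * beta x y : ℝ) + (Real.cos t * beta n y : ℝ) * I

theorem frameParam_re (x n : Fin (d + 1) → ℝ) (t : ℝ) (y : Fin (d + 1) → ℝ) :
    (frameParam x n t y).re = Real.sin t * beta x y := by
  simp only [frameParam, add_re, mul_re, ofReal_re, ofReal_im, I_re, I_im]
  ring

theorem frameParam_im (x n : Fin (d + 1) → ℝ) (t : ℝ) (y : Fin (d + 1) → ℝ) :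
    (frameParam x n t y).im = Real.cos t * beta n y := by
  simp only [frameParam, add_im, mul_im, ofReal_re, ofReal_im, I_re, I_im]
  ring

/-- Either the imaginary part of `1 + β(z, y)` or its real part is at least of order `cos⁴ t`. -/
theorem IsFrame.re_or_im_ge {x n y : Fin (d + 1) → ℝ} (h : IsFrame x n) (hy : y ∈ deSitter d)
    {t : ℝ} (ht : 0 < Real.cos t) :
    Real.cos t ^ 4 / 2 ≤ (1 + frameParam x n t y).re ∨
      Real.cos t ^ 4 / 2 ≤ |(1 + frameParam x n t y).im| := by
  have hpq := h.sq_beta_le hy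
  simp only [add_re, add_im, one_re, one_im, zero_add, frameParam_re, frameParam_im]
  set c := Real.cos t
  have hc1 : c ≤ 1 := Real.cos_le_one t
  have hc2 : c ^ 2 ≤ 1 := pow_le_one₀ ht.le hc1
  have hsc := Real.sin_sq_add_cos_sq t
  by_cases hq : c ≤ |beta n y|
  · right
    rw [abs_mul, abs_of_pos ht]
    have h1 : c * c ≤ c * |beta n y| := by gcongr
    nlinarith [sq_nonneg c]
  · left
    push Not at hq
    have hq2 : beta n y ^ 2 ≤ c ^ 2 := by
      rw [← sq_abs (beta n y)]
      gcongr
    have h2 : (Real.sin t * beta x y) ^ 2 ≤ (1 - c ^ 4 / 2) ^ 2 := by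
      rw [mul_pow]
      have h3 : Real.sin t ^ 2 * beta x y ^ 2 ≤ (1 - c ^ 2) * (1 + c ^ 2) := by
        have : Real.sin t ^ 2 = 1 - c ^ 2 := by linarith
        rw [this]
        have : 0 ≤ 1 - c ^ 2 := by linarith
        gcongr
        linarith
      nlinarith [sq_nonneg (c ^ 4)]
    have h4 : 0 ≤ 1 - c ^ 4 / 2 := by nlinarith [sq_nonneg c]
    have := abs_le_of_sq_le_sq' h2 h4
    linarith [this.1]

theorem IsFrame.mem_sphericalDomain {x n y : Fin (d + 1) → ℝ} (h : IsFrame x n)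
    (hy : y ∈ deSitter d) {t : ℝ} (ht : 0 < Real.cos t) :
    frameParam x n t y ∈ sphericalDomain := by
  have hc : 0 < Real.cos t ^ 4 / 2 := by positivity
  rcases h.re_or_im_ge hy ht with h1 | h1
  · exact Or.inl (hc.trans_le h1)
  · exact Or.inr (abs_pos.1 (hc.trans_le h1))

theorem IsFrame.le_norm {x n y : Fin (d + 1) → ℝ} (h : IsFrame x n) (hy : y ∈ deSitter d)
    {t : ℝ} (ht : 0 < Real.cos t) : Real.cos t ^ 4 / 2 ≤ ‖1 + frameParam x n t y‖ := by
  rcases h.re_or_im_ge hy ht with h1 | h1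
  · exact h1.trans (re_le_norm _)
  · exact h1.trans (abs_im_le_norm _)

theorem norm_frameParam_le (x n : Fin (d + 1) → ℝ) (t : ℝ) (y : Fin (d + 1) → ℝ) :
    ‖frameParam x n t y‖ ≤ |beta x y| + |beta n y| := by
  refine (norm_add_le _ _).trans ?_
  rw [norm_mul, norm_I, mul_one, norm_real, norm_real, Real.norm_eq_abs, Real.norm_eq_abs, abs_mul,
    abs_mul]
  gcongr
  · exact mul_le_of_le_one_left (abs_nonneg _) (Real.abs_sin_le_one t)
  · exact mul_le_of_le_one_left (abs_nonneg _) (Real.abs_cos_le_one t)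

/-- The infinitesimal boost in the plane spanned by `x` and `n`. -/
noncomputable def boostGen (x n v : Fin (d + 1) → ℝ) : Fin (d + 1) → ℝ :=
  beta n v • x - beta x v • n

/-- The boost by `τ` in the plane spanned by `x` and `n`, the exponential of `τ • boostGen x n`. -/
noncomputable def boost (x n : Fin (d + 1) → ℝ) (τ : ℝ) (v : Fin (d + 1) → ℝ) :
    Fin (d + 1) → ℝ :=
  v + (Real.sinh τ * beta n v - (Real.cosh τ - 1) * beta x v) • x +
    ((Real.cosh τ - 1) * beta n v - Real.sinh τ * beta x v) • n

theorem IsFrame.beta_boost_left {x n : Fin (d + 1) → ℝ} (h : IsFrame x n) (τ : ℝ)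
    (v : Fin (d + 1) → ℝ) :
    beta x (boost x n τ v) = Real.cosh τ * beta x v - Real.sinh τ * beta n v := by
  simp only [boost, beta_add_right, beta_smul_right, h.beta_left, h.beta_mixed']
  ring

theorem IsFrame.beta_boost_right {x n : Fin (d + 1) → ℝ} (h : IsFrame x n) (τ : ℝ)
    (v : Fin (d + 1) → ℝ) :
    beta n (boost x n τ v) = Real.cosh τ * beta n v - Real.sinh τ * beta x v := by
  simp only [boost, beta_add_right, beta_smul_right, h.beta_right, h.beta_mixed]
  ring

theorem IsFrame.beta_boost_self {x n : Fin (d + 1) → ℝ} (h : IsFrame x n) (τ : ℝ)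
    (v : Fin (d + 1) → ℝ) : beta (boost x n τ v) (boost x n τ v) = beta v v := by
  have hcs := Real.cosh_sq τ
  simp only [boost, beta_add_right, beta_smul_right, beta_add_left, beta_smul_left, h.beta_right,
    h.beta_mixed, h.beta_mixed', h.beta_left, beta_comm v]
  linear_combination (beta n v ^ 2 - beta x v ^ 2) * hcs

theorem IsFrame.boost_neg_boost {x n : Fin (d + 1) → ℝ} (h : IsFrame x n) (τ : ℝ)
    (v : Fin (d + 1) → ℝ) : boost x n (-τ) (boost x n τ v) = v := by
  have hcs := Real.cosh_sq τ
  conv_lhs => rw [boost]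
  rw [h.beta_boost_left, h.beta_boost_right, Real.sinh_neg, Real.cosh_neg, boost]
  ext i
  simp only [Pi.add_apply, Pi.smul_apply, smul_eq_mul]
  linear_combination (beta n v * n i - beta x v * x i) * hcs

theorem IsFrame.hasDerivAt_boost {x n : Fin (d + 1) → ℝ} (h : IsFrame x n) (τ : ℝ)
    (v : Fin (d + 1) → ℝ) :
    HasDerivAt (fun τ => boost x n τ v) (boostGen x n (boost x n τ v)) τ := by
  have hs := Real.hasDerivAt_sinh τ
  have hc := (Real.hasDerivAt_cosh τ).sub_const 1
  have h1 := (((hs.mul_const (beta n v)).sub (hc.mul_const (beta x v))).smul_const x).const_add v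
  have h2 := ((hc.mul_const (beta n v)).sub (hs.mul_const (beta x v))).smul_const n
  refine (h1.add h2).congr_deriv ?_
  rw [boostGen, h.beta_boost_left, h.beta_boost_right]
  ext i
  simp only [Pi.add_apply, Pi.sub_apply, Pi.smul_apply, smul_eq_mul]
  ring

theorem boost_zero (x n v : Fin (d + 1) → ℝ) : boost x n 0 v = v := by
  simp [boost]

theorem continuous_boost (x n : Fin (d + 1) → ℝ) :
    Continuous (fun p : ℝ × (Fin (d + 1) → ℝ) => boost x n p.1 p.2) := by
  have := Real.continuous_sinh
  have := Real.continuous_cosh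
  unfold boost
  fun_prop

/-- The boost as a linear map. -/
noncomputable def boostLinear (x n : Fin (d + 1) → ℝ) (τ : ℝ) :
    (Fin (d + 1) → ℝ) →ₗ[ℝ] (Fin (d + 1) → ℝ) where
  toFun := boost x n τ
  map_add' v w := by
    ext i
    simp only [boost, beta_add_right, Pi.add_apply, Pi.smul_apply, smul_eq_mul]
    ring
  map_smul' r v := by
    ext i
    simp only [boost, beta_smul_right, Pi.add_apply, Pi.smul_apply, smul_eq_mul, RingHom.id_apply]
    ring

/-- The motion of `β(z_t, y)` in `t` is `i` times the infinitesimal boost of `y`. -/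
theorem IsFrame.hasDerivAt_frameParam {x n : Fin (d + 1) → ℝ} (h : IsFrame x n) (t : ℝ)
    (y : Fin (d + 1) → ℝ) :
    HasDerivAt (fun t => frameParam x n t y) (I * frameParam x n t (boostGen x n y)) t := by
  have h1 := ((Real.hasDerivAt_sin t).mul_const (beta x y)).ofReal_comp
  have h2 := (((Real.hasDerivAt_cos t).mul_const (beta n y)).ofReal_comp).mul_const I
  refine (h1.add h2).congr_deriv ?_
  simp only [frameParam, boostGen, beta_sub_right, beta_smul_right, h.beta_left, h.beta_right,
    h.beta_mixed, h.beta_mixed']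
  push_cast
  linear_combination (Complex.cos t * beta x y : ℂ) * I_sq

@[fun_prop]
theorem continuous_frameParam {X : Type*} [TopologicalSpace X] (x : Fin (d + 1) → ℝ)
    {ν : X → Fin (d + 1) → ℝ} {τ : X → ℝ} {c : X → Fin (d + 1) → ℝ} (hν : Continuous ν)
    (hτ : Continuous τ) (hc : Continuous c) :
    Continuous (fun p => frameParam x (ν p) (τ p) (c p)) := by
  unfold frameParam
  fun_prop

@[fun_prop]
theorem contDiff_boostGen {X : Type*} [NormedAddCommGroup X] [NormedSpace ℝ X] {m : WithTop ℕ∞}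
    (x : Fin (d + 1) → ℝ) {ν c : X → Fin (d + 1) → ℝ} (hν : ContDiff ℝ m ν)
    (hc : ContDiff ℝ m c) : ContDiff ℝ m (fun p => boostGen x (ν p) (c p)) := by
  unfold boostGen
  fun_prop

/-! ### The invariant volume -/

theorem isClosed_deSitter : IsClosed (deSitter d) :=
  isClosed_eq (by fun_prop) continuous_const

/-- The radial projection of the spacelike vectors onto de Sitter space. -/
noncomputable def radialProj (v : Fin (d + 1) → ℝ) : Fin (d + 1) → ℝ :=
  (Real.sqrt (-beta v v))⁻¹ • v

theorem measurable_radialProj : Measurable (radialProj (d := d)) := by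
  have h : Measurable (fun v : Fin (d + 1) → ℝ => beta v v) :=
    (continuous_beta_comp continuous_id continuous_id).measurable
  exact ((Real.continuous_sqrt.measurable.comp h.neg).inv).smul measurable_id

theorem radialProj_mem_deSitter {v : Fin (d + 1) → ℝ} (hv : beta v v < 0) :
    radialProj v ∈ deSitter d := by
  change beta _ _ = -1
  have h1 : 0 < -beta v v := by linarith
  have h2 : Real.sqrt (-beta v v) ≠ 0 := (Real.sqrt_pos.2 h1).ne'
  rw [radialProj, beta_smul_left, beta_smul_right]
  field_simp
  rw [Real.sq_sqrt h1.le, neg_neg]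

/-- The shell `{v : -1 < β(v, v) < 0}` that carries the cone measure. -/
def shell (d : ℕ) : Set (Fin (d + 1) → ℝ) := {v | -1 < beta v v ∧ beta v v < 0}

theorem measurableSet_shell : MeasurableSet (shell d) := by
  have h : Continuous (fun v : Fin (d + 1) → ℝ => beta v v) := by fun_prop
  exact ((isOpen_lt continuous_const h).inter (isOpen_lt h continuous_const)).measurableSet

theorem volumeMeasure_eq : volumeMeasure d =
    ((d : ENNReal) + 1) • (volume.restrict (shell d)).map radialProj := rfl

theorem volumeMeasure_apply {s : Set (Fin (d + 1) → ℝ)} (hs : MeasurableSet s) :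
    volumeMeasure d s = ((d : ENNReal) + 1) * volume (radialProj ⁻¹' s ∩ shell d) := by
  rw [volumeMeasure_eq, Measure.smul_apply, Measure.map_apply measurable_radialProj hs,
    Measure.restrict_apply (measurable_radialProj hs), smul_eq_mul]

theorem ae_mem_deSitter : ∀ᵐ y ∂volumeMeasure d, y ∈ deSitter d := by
  rw [ae_iff]
  change volumeMeasure d (deSitter d)ᶜ = 0
  rw [volumeMeasure_apply isClosed_deSitter.measurableSet.compl]
  have : radialProj ⁻¹' (deSitter d)ᶜ ∩ shell d = ∅ := by
    ext v
    simp only [Set.mem_inter_iff, Set.mem_preimage, Set.mem_compl_iff, Set.mem_empty_iff_false,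
      iff_false, not_and]
    intro h1 h2
    exact h1 (radialProj_mem_deSitter h2.2)
  rw [this, measure_empty, mul_zero]

instance : IsFiniteMeasureOnCompacts (volumeMeasure d) where
  lt_top_of_isCompact := by
    intro K hK
    rw [volumeMeasure_apply hK.measurableSet]
    refine ENNReal.mul_lt_top (by finiteness) ?_
    obtain ⟨R, hR⟩ := hK.isBounded.exists_norm_le
    refine lt_of_le_of_lt (measure_mono (t := Metric.closedBall 0 R) ?_)
      (isCompact_closedBall 0 R).measure_lt_top
    rintro v ⟨hv1, hv2⟩
    rw [mem_closedBall_zero_iff]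
    refine le_trans ?_ (hR _ hv1)
    have h1 : 0 < Real.sqrt (-beta v v) := Real.sqrt_pos.2 (by linarith [hv2.2])
    have h2 : Real.sqrt (-beta v v) ≤ 1 := Real.sqrt_le_one.2 (by linarith [hv2.1])
    rw [radialProj, norm_smul, norm_inv, Real.norm_eq_abs, abs_of_pos h1]
    exact le_mul_of_one_le_left (norm_nonneg _) (one_le_inv_iff₀.2 ⟨h1, h2⟩)

/-- A linear map preserving the form has determinant `±1`. -/
theorem abs_det_of_beta_eq {L : (Fin (d + 1) → ℝ) →ₗ[ℝ] (Fin (d + 1) → ℝ)}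
    (hL : ∀ v, beta (L v) (L v) = beta v v) : |LinearMap.det L| = 1 := by
  have hpol : ∀ v w, beta (L v) (L w) = beta v w := by
    intro v w
    have h := hL (v + w)
    simp only [map_add, beta_add_left, beta_add_right, hL, beta_comm (L w), beta_comm w] at h
    linarith
  set J : Matrix (Fin (d + 1)) (Fin (d + 1)) ℝ := Matrix.diagonal (Fin.cons 1 fun _ => -1) with hJ
  have hβ : ∀ v w : Fin (d + 1) → ℝ, beta v w = v ⬝ᵥ (J.mulVec w) := by
    intro v w
    simp only [hJ, dotProduct, Matrix.mulVec_diagonal, Fin.sum_univ_succ, beta, Fin.cons_zero,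
      Fin.cons_succ]
    rw [sub_eq_add_neg, ← Finset.sum_neg_distrib]
    congr 1
    · ring
    · exact Finset.sum_congr rfl fun i _ => by ring
  set M := LinearMap.toMatrix' L with hM
  have hLM : ∀ v, L v = M.mulVec v := fun v => by
    rw [hM, ← Matrix.toLin'_apply, Matrix.toLin'_toMatrix']
  have hMJ : M.transpose * J * M = J := by
    ext i j
    have h := hpol (Pi.single i 1) (Pi.single j 1)
    rw [hβ, hβ, hLM, hLM, Matrix.mulVec_mulVec, Matrix.dotProduct_mulVec, Matrix.vecMul_mulVec,
      ← Matrix.dotProduct_mulVec, single_one_dotProduct, single_one_dotProduct,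
      Matrix.mulVec_single_one, Matrix.mulVec_single_one] at h
    simpa [Matrix.mul_assoc] using h
  have hdet := congrArg Matrix.det hMJ
  have hJ0 : J.det ≠ 0 := by
    rw [hJ, Matrix.det_diagonal, Finset.prod_ne_zero_iff]
    intro i _
    refine Fin.cases ?_ (fun i => ?_) i <;> simp
  rw [Matrix.det_mul, Matrix.det_mul, Matrix.det_transpose] at hdet
  have h2 : M.det * M.det = 1 := by
    apply mul_right_cancel₀ hJ0
    linear_combination hdet
  have h3 : LinearMap.det L = M.det := (LinearMap.det_toMatrix' L).symm
  rw [h3, ← sq_eq_sq₀ (abs_nonneg _) zero_le_one, sq_abs, one_pow, sq, h2]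

/-- The volume on de Sitter space is Lorentz invariant. -/
theorem map_volumeMeasure {L : (Fin (d + 1) → ℝ) →ₗ[ℝ] (Fin (d + 1) → ℝ)}
    (hL : ∀ v, beta (L v) (L v) = beta v v) : (volumeMeasure d).map L = volumeMeasure d := by
  have hmeas : Measurable L := (LinearMap.continuous_of_finiteDimensional L).measurable
  have hdet := abs_det_of_beta_eq hL
  have hdet0 : LinearMap.det L ≠ 0 := by
    intro h0; rw [h0, abs_zero] at hdet; exact zero_ne_one hdet
  have hvol : Measure.map L volume = volume := by
    rw [Measure.map_linearMap_addHaar_eq_smul_addHaar volume hdet0, abs_inv, hdet]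
    simp
  have hcomm : L ∘ radialProj = radialProj ∘ L := by
    ext1 v
    simp only [Function.comp_apply, radialProj, map_smul, hL]
  have hpre : L ⁻¹' shell d = shell d := by
    ext v
    simp only [shell, Set.mem_preimage, Set.mem_ofPred_eq, hL]
  have hres : (volume.restrict (shell d)).map L = volume.restrict (shell d) := by
    have := Measure.restrict_map (μ := volume) hmeas (measurableSet_shell (d := d))
    rw [hvol, hpre] at this
    exact this.symm
  rw [volumeMeasure_eq, Measure.map_smul, Measure.map_map hmeas measurable_radialProj, hcomm,
    ← Measure.map_map measurable_radialProj hmeas, hres]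

theorem IsFrame.integral_comp_boost {x n : Fin (d + 1) → ℝ} (h : IsFrame x n) (τ : ℝ)
    {g : (Fin (d + 1) → ℝ) → ℂ} (hg : AEStronglyMeasurable g (volumeMeasure d)) :
    ∫ y, g (boost x n τ y) ∂volumeMeasure d = ∫ y, g y ∂volumeMeasure d := by
  have h1 : (volumeMeasure d).map (boostLinear x n τ) = volumeMeasure d :=
    map_volumeMeasure (L := boostLinear x n τ) fun v => h.beta_boost_self τ v
  have h2 := integral_map (μ := volumeMeasure d) (φ := boostLinear x n τ) (f := g)
    (LinearMap.continuous_of_finiteDimensional _).aemeasurable (by rwa [h1])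
  rw [h1] at h2
  exact h2.symm

/-! ### Integrals over de Sitter space -/

theorem aestronglyMeasurable_of_continuousOn {g : (Fin (d + 1) → ℝ) → ℂ}
    (hg : ContinuousOn g (deSitter d)) : AEStronglyMeasurable g (volumeMeasure d) := by
  have h := hg.aestronglyMeasurable (μ := volumeMeasure d) isClosed_deSitter.measurableSet
  rwa [Measure.restrict_eq_self_of_ae_mem ae_mem_deSitter] at h

theorem integrable_of_continuousOn {g : (Fin (d + 1) → ℝ) → ℂ}
    (hg : ContinuousOn g (deSitter d)) {K : Set (Fin (d + 1) → ℝ)} (hK : IsCompact K)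
    (h0 : ∀ y ∈ deSitter d, y ∉ K → g y = 0) : Integrable g (volumeMeasure d) := by
  have h1 : IntegrableOn g (K ∩ deSitter d) (volumeMeasure d) :=
    (hg.mono Set.inter_subset_right).integrableOn_compact (hK.inter_right isClosed_deSitter)
  refine h1.integrable_of_ae_notMem_eq_zero ?_
  filter_upwards [ae_mem_deSitter] with y hy hyK
  exact h0 y hy fun h => hyK ⟨h, hy⟩

theorem norm_integral_deSitter_le {g : (Fin (d + 1) → ℝ) → ℂ} {K : Set (Fin (d + 1) → ℝ)}
    (hK : IsCompact K) (h0 : ∀ y ∈ deSitter d, y ∉ K → g y = 0) {C : ℝ}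
    (hC : ∀ y ∈ deSitter d, y ∈ K → ‖g y‖ ≤ C) :
    ‖∫ y, g y ∂volumeMeasure d‖ ≤ C * (volumeMeasure d).real K := by
  rw [← setIntegral_eq_integral_of_ae_compl_eq_zero (s := K) (by
    filter_upwards [ae_mem_deSitter] with y hy hyK using h0 y hy hyK)]
  refine norm_setIntegral_le_of_norm_le_const_ae hK.measure_lt_top ?_
  rw [ae_restrict_iff' hK.measurableSet]
  filter_upwards [ae_mem_deSitter] with y hy hyK using hC y hy hyK

/-- Differentiation under the integral over de Sitter space. -/
theorem hasDerivAt_integral_deSitter {G G' : ℝ → (Fin (d + 1) → ℝ) → ℂ} {J : Set ℝ}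
    (hJ : IsOpen J) {τ₀ : ℝ} (hτ₀ : τ₀ ∈ J) {K : Set (Fin (d + 1) → ℝ)} (hK : IsCompact K)
    (hG : ContinuousOn (Function.uncurry G) (J ×ˢ deSitter d))
    (hG' : ContinuousOn (Function.uncurry G') (J ×ˢ deSitter d))
    (hd : ∀ τ ∈ J, ∀ y ∈ deSitter d, HasDerivAt (fun τ => G τ y) (G' τ y) τ)
    (h0 : ∀ τ ∈ J, ∀ y ∈ deSitter d, y ∉ K → G τ y = 0) :
    HasDerivAt (fun τ => ∫ y, G τ y ∂volumeMeasure d) (∫ y, G' τ₀ y ∂volumeMeasure d) τ₀ := by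
  have h0' : ∀ τ ∈ J, ∀ y ∈ deSitter d, y ∉ K → G' τ y = 0 := by
    intro τ hτ y hy hyK
    refine (hd τ hτ y hy).unique ((hasDerivAt_const τ (0 : ℂ)).congr_of_eventuallyEq ?_)
    filter_upwards [hJ.mem_nhds hτ] with σ hσ using h0 σ hσ y hy hyK
  have hslice : ∀ {F : ℝ → (Fin (d + 1) → ℝ) → ℂ},
      ContinuousOn (Function.uncurry F) (J ×ˢ deSitter d) → ∀ τ ∈ J,
      ContinuousOn (F τ) (deSitter d) := by
    intro F hF τ hτ
    exact hF.comp (f := fun y => (τ, y)) (by fun_prop) fun y hy => ⟨hτ, hy⟩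
  obtain ⟨r, hr, hrJ⟩ := Metric.isOpen_iff.1 hJ τ₀ hτ₀
  have hcb : Metric.closedBall τ₀ (r / 2) ⊆ J :=
    (Metric.closedBall_subset_ball (by linarith)).trans hrJ
  obtain ⟨C, hC⟩ := ((isCompact_closedBall τ₀ (r / 2)).prod
    (hK.inter_right isClosed_deSitter)).exists_bound_of_continuousOn
    (hG'.mono (Set.prod_mono hcb Set.inter_subset_right))
  refine (hasDerivAt_integral_of_dominated_loc_of_deriv_le (μ := volumeMeasure d)
    (F := G) (F' := G') (bound := K.indicator fun _ => C)
    (Metric.closedBall_mem_nhds τ₀ (by positivity : 0 < r / 2)) ?_ ?_ ?_ ?_ ?_ ?_).2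
  · filter_upwards [hJ.mem_nhds hτ₀] with τ hτ
    exact aestronglyMeasurable_of_continuousOn (hslice hG τ hτ)
  · exact integrable_of_continuousOn (hslice hG τ₀ hτ₀) hK (h0 τ₀ hτ₀)
  · exact aestronglyMeasurable_of_continuousOn (hslice hG' τ₀ hτ₀)
  · filter_upwards [ae_mem_deSitter] with y hy τ hτ
    by_cases hyK : y ∈ K
    · rw [Set.indicator_of_mem hyK]
      exact hC (τ, y) ⟨hτ, hyK, hy⟩
    · rw [Set.indicator_of_notMem hyK, h0' τ (hcb hτ) y hy hyK, norm_zero]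
  · rw [integrable_indicator_iff hK.measurableSet]
    exact integrableOn_const hK.measure_lt_top.ne
  · filter_upwards [ae_mem_deSitter] with y hy τ hτ
    exact hd τ (hcb hτ) y hy

/-- The regularized pairing `∫ f(β(z_t, y)) φ(y) dy`, where `z_t = sin(t) x + i cos(t) n`. -/
noncomputable def framePairing (f : ℂ → ℂ) (x n : Fin (d + 1) → ℝ) (t : ℝ)
    (φ : (Fin (d + 1) → ℝ) → ℝ) : ℂ :=
  ∫ y, f (frameParam x n t y) * (φ y : ℂ) ∂volumeMeasure d

theorem IsFrame.continuousOn_comp_frameParam {x n : Fin (d + 1) → ℝ} (h : IsFrame x n)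
    {f : ℂ → ℂ} (hf : ContinuousOn f sphericalDomain) :
    ContinuousOn (Function.uncurry fun t y => f (frameParam x n t y))
      ({t : ℝ | 0 < Real.cos t} ×ˢ deSitter d) := by
  refine hf.comp (f := fun p : ℝ × (Fin (d + 1) → ℝ) => frameParam x n p.1 p.2) ?_ ?_
  · exact (continuous_frameParam x continuous_const continuous_fst continuous_snd).continuousOn
  · rintro ⟨t, y⟩ ⟨ht, hy⟩
    exact h.mem_sphericalDomain hy ht

theorem IsFrame.continuousOn_comp_frameParam_right {x n : Fin (d + 1) → ℝ} (h : IsFrame x n)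
    {f : ℂ → ℂ} (hf : ContinuousOn f sphericalDomain) {t : ℝ} (ht : 0 < Real.cos t) :
    ContinuousOn (fun y => f (frameParam x n t y)) (deSitter d) :=
  (h.continuousOn_comp_frameParam hf).comp (f := fun y => (t, y)) (by fun_prop)
    fun _ hy => ⟨ht, hy⟩

/-- The derivative of a function along the infinitesimal boost. -/
noncomputable def boostDeriv (x n : Fin (d + 1) → ℝ) (φ : (Fin (d + 1) → ℝ) → ℝ)
    (y : Fin (d + 1) → ℝ) : ℝ :=
  fderiv ℝ φ y (boostGen x n y)

theorem contDiff_boostDeriv (x n : Fin (d + 1) → ℝ) {φ : (Fin (d + 1) → ℝ) → ℝ}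
    (hφ : ContDiff ℝ ∞ φ) : ContDiff ℝ ∞ (boostDeriv x n φ) :=
  (hφ.fderiv_right (m := ∞) (by simp)).clm_apply (contDiff_boostGen x contDiff_const contDiff_id)

theorem boostDeriv_eq_zero (x n : Fin (d + 1) → ℝ) {φ : (Fin (d + 1) → ℝ) → ℝ}
    {K : Set (Fin (d + 1) → ℝ)} (hK : IsClosed K) (h0 : ∀ y ∉ K, φ y = 0) :
    ∀ y ∉ K, boostDeriv x n φ y = 0 := by
  intro y hy
  have h : φ =ᶠ[𝓝 y] fun _ => 0 := by
    filter_upwards [hK.isOpen_compl.mem_nhds hy] with w hw using h0 w hw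
  rw [boostDeriv, h.fderiv_eq]
  simp

theorem hasDerivAt_beta_comp {x c' : Fin (d + 1) → ℝ} {c : ℝ → Fin (d + 1) → ℝ} {τ : ℝ}
    (hc : HasDerivAt c c' τ) : HasDerivAt (fun τ => beta x (c τ)) (beta x c') τ := by
  have h := hasDerivAt_pi.1 hc
  unfold beta
  refine ((h 0).const_mul (x 0)).sub ?_
  exact HasDerivAt.fun_sum fun i _ => (h i.succ).const_mul (x i.succ)

theorem hasDerivAt_frameParam_comp {x n c' : Fin (d + 1) → ℝ} {c : ℝ → Fin (d + 1) → ℝ} {τ : ℝ}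
    (t : ℝ) (hc : HasDerivAt c c' τ) :
    HasDerivAt (fun τ => frameParam x n t (c τ)) (frameParam x n t c') τ := by
  have h1 := ((hasDerivAt_beta_comp (x := x) hc).const_mul (Real.sin t)).ofReal_comp
  have h2 := (((hasDerivAt_beta_comp (x := n) hc).const_mul (Real.cos t)).ofReal_comp).mul_const I
  exact h1.add h2

/-- Integration by parts along the boost: the invariance of the volume, differentiated. -/
theorem IsFrame.integral_deriv_boost {x n : Fin (d + 1) → ℝ} (h : IsFrame x n)
    {f : ℂ → ℂ} (hf : DifferentiableOn ℂ f sphericalDomain) {φ : (Fin (d + 1) → ℝ) → ℝ}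
    (hφ : ContDiff ℝ ∞ φ) {K : Set (Fin (d + 1) → ℝ)} (hK : IsCompact K)
    (h0 : ∀ y ∉ K, φ y = 0) {t : ℝ} (ht : 0 < Real.cos t) :
    ∫ y, deriv f (frameParam x n t y) * frameParam x n t (boostGen x n y) * (φ y : ℂ)
      ∂volumeMeasure d = -framePairing f x n t (boostDeriv x n φ) := by
  have hfd : DifferentiableOn ℂ (deriv f) sphericalDomain := hf.deriv isOpen_sphericalDomain
  have hsA : Continuous (fun y => frameParam x n t (boostGen x n y)) := by fun_prop
  have hφ' : Continuous (boostDeriv x n φ) := (contDiff_boostDeriv x n hφ).continuous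
  have hφc := hφ.continuous
  have hbs : ∀ τ, ∀ y ∈ deSitter d, boost x n τ y ∈ deSitter d := fun τ y hy =>
    (h.beta_boost_self τ y).trans hy
  have hcont : ∀ {g : (Fin (d + 1) → ℝ) → ℂ}, ContinuousOn g (deSitter d) →
      ContinuousOn (Function.uncurry fun τ y => g (boost x n τ y))
        (Set.Ioo (-1 : ℝ) 1 ×ˢ deSitter d) := by
    intro g hg
    exact hg.comp (continuous_boost x n).continuousOn fun p hp => hbs p.1 p.2 hp.2
  have hg1 : ContinuousOn (fun y => f (frameParam x n t y) * (φ y : ℂ)) (deSitter d) :=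
    (h.continuousOn_comp_frameParam_right hf.continuousOn ht).mul
      (continuous_ofReal.comp hφc).continuousOn
  have hg2 : ContinuousOn (fun y => deriv f (frameParam x n t y) *
      frameParam x n t (boostGen x n y) * (φ y : ℂ)) (deSitter d) :=
    ((h.continuousOn_comp_frameParam_right hfd.continuousOn ht).mul
      hsA.continuousOn).mul (continuous_ofReal.comp hφc).continuousOn
  have hg3 : ContinuousOn (fun y => f (frameParam x n t y) * (boostDeriv x n φ y : ℂ))
      (deSitter d) :=
    (h.continuousOn_comp_frameParam_right hf.continuousOn ht).mul
      (continuous_ofReal.comp hφ').continuousOn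
  -- a compact set containing the supports of all `φ ∘ boost τ`, `|τ| ≤ 1`
  set K' := (fun p : ℝ × (Fin (d + 1) → ℝ) => boost x n (-p.1) p.2) ''
    (Set.Icc (-1 : ℝ) 1 ×ˢ K) with hK'
  have hK'c : IsCompact K' := (isCompact_Icc.prod hK).image
    ((continuous_boost x n).comp ((continuous_fst.neg).prodMk continuous_snd))
  have key := hasDerivAt_integral_deSitter
    (G := fun τ y => f (frameParam x n t (boost x n τ y)) * (φ (boost x n τ y) : ℂ))
    (G' := fun τ y => deriv f (frameParam x n t (boost x n τ y)) *
        frameParam x n t (boostGen x n (boost x n τ y)) * (φ (boost x n τ y) : ℂ) +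
      f (frameParam x n t (boost x n τ y)) * (boostDeriv x n φ (boost x n τ y) : ℂ))
    (J := Set.Ioo (-1 : ℝ) 1) isOpen_Ioo (τ₀ := 0) (by norm_num) hK'c (hcont hg1)
    ((hcont hg2).add (hcont hg3)) ?_ ?_
  · have hconst : (fun τ => ∫ y, f (frameParam x n t (boost x n τ y)) *
        (φ (boost x n τ y) : ℂ) ∂volumeMeasure d) = fun _ => framePairing f x n t φ := by
      ext τ
      exact h.integral_comp_boost τ (aestronglyMeasurable_of_continuousOn hg1)
    rw [hconst] at key
    have h1 := (hasDerivAt_const (0 : ℝ) (framePairing f x n t φ)).unique key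
    simp only [boost_zero] at h1
    rw [integral_add (integrable_of_continuousOn hg2 hK fun y _ hy => by simp [h0 y hy])
      (integrable_of_continuousOn hg3 hK fun y _ hy => by
        simp [boostDeriv_eq_zero x n hK.isClosed h0 y hy])] at h1
    exact eq_neg_of_add_eq_zero_left h1.symm
  · intro τ _ y hy
    have hb := h.hasDerivAt_boost τ y
    have h1 := hasDerivAt_frameParam_comp (x := x) (n := n) t hb
    have h2 := (hf.differentiableAt (isOpen_sphericalDomain.mem_nhds
      (h.mem_sphericalDomain (hbs τ y hy) ht))).hasDerivAt.scomp τ h1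
    have h3 := ((hφ.differentiable (by simp)).differentiableAt
      (x := boost x n τ y)).hasFDerivAt.comp_hasDerivAt τ hb
    refine (h2.mul h3.ofReal_comp).congr_deriv ?_
    simp only [smul_eq_mul, Function.comp_apply, boostDeriv]
    ring
  · intro τ hτ y _ hy
    rw [h0, ofReal_zero, mul_zero]
    intro hmem
    exact hy ⟨(τ, boost x n τ y), ⟨Set.Ioo_subset_Icc_self hτ, hmem⟩, h.boost_neg_boost τ y⟩

/-- Differentiation of the pairing in `t` is a boost derivative of the test function. -/
theorem IsFrame.hasDerivAt_framePairing {x n : Fin (d + 1) → ℝ} (h : IsFrame x n)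
    {f : ℂ → ℂ} (hf : DifferentiableOn ℂ f sphericalDomain) {φ : (Fin (d + 1) → ℝ) → ℝ}
    (hφ : ContDiff ℝ ∞ φ) {K : Set (Fin (d + 1) → ℝ)} (hK : IsCompact K)
    (h0 : ∀ y ∉ K, φ y = 0) {t : ℝ} (ht : 0 < Real.cos t) :
    HasDerivAt (fun t => framePairing f x n t φ)
      (-I * framePairing f x n t (boostDeriv x n φ)) t := by
  have hfd : DifferentiableOn ℂ (deriv f) sphericalDomain := hf.deriv isOpen_sphericalDomain
  have hφc : Continuous (fun p : ℝ × (Fin (d + 1) → ℝ) => (φ p.2 : ℂ)) :=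
    continuous_ofReal.comp (hφ.continuous.comp continuous_snd)
  have hsA : Continuous (fun p : ℝ × (Fin (d + 1) → ℝ) =>
      frameParam x n p.1 (boostGen x n p.2)) := by fun_prop
  have key := hasDerivAt_integral_deSitter
    (G := fun t y => f (frameParam x n t y) * (φ y : ℂ))
    (G' := fun t y => I * (deriv f (frameParam x n t y) * frameParam x n t (boostGen x n y) *
      (φ y : ℂ)))
    (J := {t : ℝ | 0 < Real.cos t}) (isOpen_lt continuous_const Real.continuous_cos) ht hK
    ((h.continuousOn_comp_frameParam hf.continuousOn).mul hφc.continuousOn)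
    (continuousOn_const.mul (((h.continuousOn_comp_frameParam hfd.continuousOn).mul
      hsA.continuousOn).mul hφc.continuousOn)) ?_ ?_
  · refine key.congr_deriv ?_
    rw [integral_const_mul, h.integral_deriv_boost hf hφ hK h0 ht]
    ring
  · intro t ht y hy
    have h2 := (hf.differentiableAt (isOpen_sphericalDomain.mem_nhds
      (h.mem_sphericalDomain hy ht))).hasDerivAt.scomp t (h.hasDerivAt_frameParam t y)
    refine (h2.mul_const (φ y : ℂ)).congr_deriv ?_
    simp only [smul_eq_mul]
    ring
  · intro t _ y _ hy
    simp [h0 y hy]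

/-! ### Boundary values by repeated integration -/

section Iterate

variable {T B : ℝ}

theorem hasDerivAt_sub_rpow {T s : ℝ} (hs : s < T) (p : ℝ) :
    HasDerivAt (fun s => (T - s) ^ p) (-(p * (T - s) ^ (p - 1))) s := by
  have h := ((hasDerivAt_id s).const_sub T).rpow_const (p := p) (Or.inl (by simp; linarith))
  refine h.congr_deriv ?_
  simp

/-- Integration lowers the order of a singularity by one. -/
theorem norm_le_of_norm_deriv_le_rpow {u v : ℝ → ℂ}
    (hu : ∀ t ∈ Set.Ico (T - 1) T, HasDerivAt u (v t) t) {p : ℝ} (hp : 1 / 2 ≤ p) (hB : 0 ≤ B)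
    (hv : ∀ t ∈ Set.Ico (T - 1) T, ‖v t‖ ≤ B * (T - t) ^ (-(p + 1))) (hu0 : ‖u (T - 1)‖ ≤ B)
    {t : ℝ} (ht : t ∈ Set.Ico (T - 1) T) : ‖u t‖ ≤ 2 * B * (T - t) ^ (-p) := by
  have hsub : Set.Icc (T - 1) t ⊆ Set.Ico (T - 1) T := fun s hs => ⟨hs.1, hs.2.trans_lt ht.2⟩
  have hD : ∀ s ∈ Set.Icc (T - 1) t, HasDerivAt (fun s => 2 * B * (T - s) ^ (-p))
      (2 * B * (p * (T - s) ^ (-(p + 1)))) s := by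
    intro s hs
    refine ((hasDerivAt_sub_rpow (hsub hs).2 (-p)).const_mul (2 * B)).congr_deriv ?_
    rw [show -p - 1 = -(p + 1) by ring]
    ring
  refine image_norm_le_of_norm_deriv_right_le_deriv_boundary' (a := T - 1) (b := t) (f := u)
    (f' := v) (B := fun s => 2 * B * (T - s) ^ (-p))
    (B' := fun s => 2 * B * (p * (T - s) ^ (-(p + 1))))
    (fun s hs => (hu s (hsub hs)).continuousAt.continuousWithinAt)
    (fun s hs => (hu s (hsub ⟨hs.1, hs.2.le⟩)).hasDerivWithinAt) ?_
    (fun s hs => (hD s hs).continuousAt.continuousWithinAt)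
    (fun s hs => (hD s ⟨hs.1, hs.2.le⟩).hasDerivWithinAt) ?_ ⟨ht.1, le_rfl⟩
  · rw [sub_sub_cancel, Real.one_rpow]; linarith
  · intro s hs
    have hs' := hsub ⟨hs.1, hs.2.le⟩
    refine (hv s hs').trans ?_
    have h1 : 0 ≤ (T - s) ^ (-(p + 1)) := Real.rpow_nonneg (by linarith [hs'.2]) _
    have h2 : 0 ≤ B * (T - s) ^ (-(p + 1)) := mul_nonneg hB h1
    nlinarith

theorem norm_le_of_norm_deriv_le_rpow_half {u v : ℝ → ℂ}
    (hu : ∀ t ∈ Set.Ico (T - 1) T, HasDerivAt u (v t) t) (hB : 0 ≤ B)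
    (hv : ∀ t ∈ Set.Ico (T - 1) T, ‖v t‖ ≤ B * (T - t) ^ (-(1 / 2) : ℝ))
    (hu0 : ‖u (T - 1)‖ ≤ B) {t : ℝ} (ht : t ∈ Set.Ico (T - 1) T) : ‖u t‖ ≤ 3 * B := by
  have hsub : Set.Icc (T - 1) t ⊆ Set.Ico (T - 1) T := fun s hs => ⟨hs.1, hs.2.trans_lt ht.2⟩
  have hD : ∀ s ∈ Set.Icc (T - 1) t,
      HasDerivAt (fun s => 3 * B - 2 * B * (T - s) ^ (1 / 2 : ℝ))
        (B * (T - s) ^ (-(1 / 2) : ℝ)) s := by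
    intro s hs
    refine (((hasDerivAt_sub_rpow (hsub hs).2 (1 / 2)).const_mul (2 * B)).const_sub
      (3 * B)).congr_deriv ?_
    rw [show (1 / 2 - 1 : ℝ) = -(1 / 2) by norm_num]
    ring
  have := image_norm_le_of_norm_deriv_right_le_deriv_boundary' (a := T - 1) (b := t) (f := u)
    (f' := v) (B := fun s => 3 * B - 2 * B * (T - s) ^ (1 / 2 : ℝ))
    (B' := fun s => B * (T - s) ^ (-(1 / 2) : ℝ))
    (fun s hs => (hu s (hsub hs)).continuousAt.continuousWithinAt)
    (fun s hs => (hu s (hsub ⟨hs.1, hs.2.le⟩)).hasDerivWithinAt)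
    (by rw [sub_sub_cancel, Real.one_rpow]; linarith)
    (fun s hs => (hD s hs).continuousAt.continuousWithinAt)
    (fun s hs => (hD s ⟨hs.1, hs.2.le⟩).hasDerivWithinAt)
    (fun s hs => hv s (hsub ⟨hs.1, hs.2.le⟩)) (x := t) ⟨ht.1, le_rfl⟩
  have h1 : 0 ≤ (T - t) ^ (1 / 2 : ℝ) := Real.rpow_nonneg (by linarith [ht.2]) _
  have h2 : 0 ≤ 2 * B * (T - t) ^ (1 / 2 : ℝ) := by positivity
  linarith

/-- If all members of a chain of iterated derivatives have moderate growth, the first one is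
bounded: each integration lowers the order of the singularity at `T` by one. -/
theorem norm_le_of_chain (j : ℕ) (h : ℕ → ℝ → ℂ)
    (hd : ∀ k, ∀ t ∈ Set.Ico (T - 1) T, HasDerivAt (h k) (-I * h (k + 1) t) t) (hB : 0 ≤ B)
    (hb : ∀ k ≤ j + 1, ∀ t ∈ Set.Ico (T - 1) T, ‖h k t‖ ≤ B * (T - t) ^ (-(j + 1 / 2) : ℝ))
    {t : ℝ} (ht : t ∈ Set.Ico (T - 1) T) : ‖h 0 t‖ ≤ 3 * 2 ^ j * B := by
  have hT : T - 1 ∈ Set.Ico (T - 1) T := ⟨le_rfl, by linarith⟩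
  induction j generalizing B with
  | zero =>
    rw [pow_zero, mul_one]
    refine norm_le_of_norm_deriv_le_rpow_half (hd 0) hB (fun s hs => ?_) ?_ ht
    · rw [norm_mul, norm_neg, norm_I, one_mul]
      simpa using hb 1 le_rfl s hs
    · simpa using hb 0 (by simp) (T - 1) hT
  | succ j ih =>
    have := ih (B := 2 * B) (by positivity) (fun k hk s hs => ?_)
    · calc _ ≤ _ := this
        _ = _ := by ring
    · refine norm_le_of_norm_deriv_le_rpow (hd k) (p := j + 1 / 2)
        (by have : (0 : ℝ) ≤ j := j.cast_nonneg
            linarith) hB (fun r hr => ?_) ?_ hs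
      · rw [norm_mul, norm_neg, norm_I, one_mul]
        have := hb (k + 1) (by lia) r hr
        rwa [show (-((j + 1 : ℕ) + 1 / 2) : ℝ) = -(j + 1 / 2 + 1) by push_cast; ring] at this
      · simpa using hb k (by lia) (T - 1) hT

/-- One more integration shows that the first member is Lipschitz, so it has a limit at `T`. -/
theorem exists_tendsto_of_chain (j : ℕ) (h : ℕ → ℝ → ℂ)
    (hd : ∀ k, ∀ t ∈ Set.Ico (T - 1) T, HasDerivAt (h k) (-I * h (k + 1) t) t) (hB : 0 ≤ B)
    (hb : ∀ k ≤ j + 2, ∀ t ∈ Set.Ico (T - 1) T, ‖h k t‖ ≤ B * (T - t) ^ (-(j + 1 / 2) : ℝ)) :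
    ∃ L, Tendsto (h 0) (𝓝[<] T) (𝓝 L) := by
  have h1 : ∀ t ∈ Set.Ico (T - 1) T, ‖-I * h 1 t‖ ≤ 3 * 2 ^ j * B := by
    intro t ht
    rw [norm_mul, norm_neg, norm_I, one_mul]
    exact norm_le_of_chain j (fun k => h (k + 1)) (fun k => hd (k + 1)) hB
      (fun k hk => hb (k + 1) (by lia)) ht
  have hlip : LipschitzOnWith (Real.toNNReal (3 * 2 ^ j * B)) (h 0) (Set.Ico (T - 1) T) := by
    refine (convex_Ico _ _).lipschitzOnWith_of_nnnorm_hasDerivWithin_le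
      (fun t ht => (hd 0 t ht).hasDerivWithinAt) fun t ht => ?_
    rw [← NNReal.coe_le_coe, coe_nnnorm, Real.coe_toNNReal _ (by positivity)]
    exact h1 t ht
  have hle : 𝓝[<] T ≤ 𝓟 (Set.Ico (T - 1) T) :=
    le_principal_iff.2 (Ico_mem_nhdsLT (by linarith))
  have hc : Cauchy (𝓝[<] T) := cauchy_nhds.mono nhdsWithin_le_nhds
  exact CompleteSpace.complete (hc.map_of_le hlip.uniformContinuousOn hle)

end Iterate

/-! ### Uniform estimates and existence of boundary values -/

theorem half_sub_le_cos {t : ℝ} (ht : t ∈ Set.Ico (Real.pi / 2 - 1) (Real.pi / 2)) :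
    (Real.pi / 2 - t) / 2 ≤ Real.cos t := by
  have h1 := Real.mul_le_sin (x := Real.pi / 2 - t) (by linarith [ht.2]) (by
    linarith [ht.1, Real.pi_gt_three])
  rw [Real.sin_pi_div_two_sub] at h1
  refine le_trans ?_ h1
  have h2 : (1 / 2 : ℝ) ≤ 2 / Real.pi := by
    rw [div_le_div_iff₀ two_pos Real.pi_pos]
    linarith [Real.pi_le_four]
  have h3 : 0 ≤ Real.pi / 2 - t := by linarith [ht.2]
  nlinarith

theorem cos_pos_of_mem {t : ℝ} (ht : t ∈ Set.Ico (Real.pi / 2 - 1) (Real.pi / 2)) :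
    0 < Real.cos t :=
  lt_of_lt_of_le (by linarith [ht.2]) (half_sub_le_cos ht)

/-- A function of moderate growth is dominated by a power of `π/2 - t` along `β(z_t, ·)`. The
exponent is enlarged by `1/2` so that repeated integration never meets a logarithm. -/
theorem ModerateGrowth.exists_norm_comp_le {m : ℕ} {f : ℂ → ℂ} (hf : ModerateGrowth m f)
    (R : ℝ) : ∃ C, 0 ≤ C ∧ ∀ x n y : Fin (d + 1) → ℝ, IsFrame x n → y ∈ deSitter d →
      |beta x y| + |beta n y| ≤ R → ∀ t ∈ Set.Ico (Real.pi / 2 - 1) (Real.pi / 2),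
        ‖f (frameParam x n t y)‖ ≤
          C * (Real.pi / 2 - t) ^ (-((4 * m : ℕ) + 1 / 2) : ℝ) := by
  obtain ⟨C, hC, h⟩ := hf.2 R
  -- `|1 + β(z_t, y)| ≥ cos⁴ t / 2` and `cos t ≥ ε / 2` for `ε = π/2 - t` give the constant `32`
  refine ⟨C * 32 ^ m, by positivity, fun x n y hxn hy hR t ht => ?_⟩
  have hc := half_sub_le_cos ht
  have hc0 := cos_pos_of_mem ht
  set ε := Real.pi / 2 - t with hε
  have hε0 : 0 < ε := by linarith [ht.2]
  have hε1 : ε ≤ 1 := by linarith [ht.1]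
  have h1 : ε ^ 4 / 32 ≤ ‖1 + frameParam x n t y‖ := by
    refine le_trans ?_ (hxn.le_norm hy hc0)
    have : (ε / 2) ^ 4 ≤ Real.cos t ^ 4 := by gcongr
    linarith [div_pow ε 2 4]
  have h2 : (‖1 + frameParam x n t y‖⁻¹) ^ m ≤ 32 ^ m * ε ^ (-(4 * m : ℕ) : ℝ) := by
    rw [Real.rpow_neg hε0.le, Real.rpow_natCast, pow_mul, ← inv_pow, ← mul_pow]
    gcongr
    rw [inv_le_comm₀ (lt_of_lt_of_le (by positivity) h1) (by positivity), mul_inv, inv_inv]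
    linarith
  refine (h _ (hxn.mem_sphericalDomain hy hc0) ((norm_frameParam_le x n t y).trans hR)).trans ?_
  rw [mul_assoc]
  refine mul_le_mul_of_nonneg_left (h2.trans ?_) hC
  refine mul_le_mul_of_nonneg_left ?_ (by positivity)
  exact Real.rpow_le_rpow_of_exponent_ge hε0 hε1 (by linarith)

theorem contDiff_iterate_boostDeriv (x n : Fin (d + 1) → ℝ) {φ : (Fin (d + 1) → ℝ) → ℝ}
    (hφ : ContDiff ℝ ∞ φ) (k : ℕ) : ContDiff ℝ ∞ ((boostDeriv x n)^[k] φ) := by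
  induction k with
  | zero => exact hφ
  | succ k ih =>
    rw [Function.iterate_succ_apply']
    exact contDiff_boostDeriv x n ih

theorem iterate_boostDeriv_eq_zero (x n : Fin (d + 1) → ℝ) {φ : (Fin (d + 1) → ℝ) → ℝ}
    {K : Set (Fin (d + 1) → ℝ)} (hK : IsClosed K) (h0 : ∀ y ∉ K, φ y = 0) (k : ℕ) :
    ∀ y ∉ K, (boostDeriv x n)^[k] φ y = 0 := by
  induction k with
  | zero => exact h0
  | succ k ih =>
    rw [Function.iterate_succ_apply']
    exact boostDeriv_eq_zero x n hK ih

theorem IsFrame.hasDerivAt_framePairing_iterate {x n : Fin (d + 1) → ℝ} (h : IsFrame x n)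
    {f : ℂ → ℂ} (hf : DifferentiableOn ℂ f sphericalDomain) {φ : (Fin (d + 1) → ℝ) → ℝ}
    (hφ : ContDiff ℝ ∞ φ) {K : Set (Fin (d + 1) → ℝ)} (hK : IsCompact K)
    (h0 : ∀ y ∉ K, φ y = 0) {t : ℝ} (ht : 0 < Real.cos t) (k : ℕ) :
    HasDerivAt (fun t => framePairing f x n t ((boostDeriv x n)^[k] φ))
      (-I * framePairing f x n t ((boostDeriv x n)^[k + 1] φ)) t := by
  rw [Function.iterate_succ_apply']
  exact h.hasDerivAt_framePairing hf (contDiff_iterate_boostDeriv x n hφ k) hK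
    (iterate_boostDeriv_eq_zero x n hK.isClosed h0 k) ht

theorem norm_framePairing_le {f : ℂ → ℂ} {x n : Fin (d + 1) → ℝ} {t : ℝ}
    {ψ : (Fin (d + 1) → ℝ) → ℝ} {K : Set (Fin (d + 1) → ℝ)} (hK : IsCompact K)
    (h0 : ∀ y ∉ K, ψ y = 0) {C M : ℝ} (hM : ∀ y ∈ K, |ψ y| ≤ M) (hC0 : 0 ≤ C)
    (hC : ∀ y ∈ deSitter d, y ∈ K → ‖f (frameParam x n t y)‖ ≤ C) :
    ‖framePairing f x n t ψ‖ ≤ C * M * (volumeMeasure d).real K := by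
  refine norm_integral_deSitter_le hK (fun y _ hy => by simp [h0 y hy]) fun y hy hyK => ?_
  rw [norm_mul, norm_real, Real.norm_eq_abs]
  exact mul_le_mul (hC y hy hyK) (hM y hyK) (abs_nonneg _) hC0

/-- The regularized pairings are bounded, uniformly in `t` and in the frame, by finitely many
boost derivatives of the test function. -/
theorem ModerateGrowth.exists_norm_framePairing_le {m : ℕ} {f : ℂ → ℂ} (hf : ModerateGrowth m f)
    {K : Set (Fin (d + 1) → ℝ)} (hK : IsCompact K) (R : ℝ) :
    ∃ C, 0 ≤ C ∧ ∀ x n : Fin (d + 1) → ℝ, IsFrame x n →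
      (∀ y ∈ K, |beta x y| + |beta n y| ≤ R) → ∀ φ : (Fin (d + 1) → ℝ) → ℝ, ContDiff ℝ ∞ φ →
      (∀ y ∉ K, φ y = 0) → ∀ M, 0 ≤ M →
      (∀ k ≤ 4 * m + 1, ∀ y ∈ K, |(boostDeriv x n)^[k] φ y| ≤ M) →
      ∀ t ∈ Set.Ico (Real.pi / 2 - 1) (Real.pi / 2), ‖framePairing f x n t φ‖ ≤ C * M := by
  obtain ⟨C, hC, h⟩ := hf.exists_norm_comp_le (d := d) R
  refine ⟨3 * 2 ^ (4 * m) * (C * (volumeMeasure d).real K), by positivity,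
    fun x n hxn hR φ hφ h0 M hM hφM t ht => ?_⟩
  have key := norm_le_of_chain (T := Real.pi / 2) (B := C * M * (volumeMeasure d).real K) (4 * m)
    (fun k t => framePairing f x n t ((boostDeriv x n)^[k] φ))
    (fun k t ht => hxn.hasDerivAt_framePairing_iterate hf.1 hφ hK h0 (cos_pos_of_mem ht) k)
    (by positivity) (fun k hk t ht => ?_) ht
  · refine key.trans (le_of_eq ?_)
    ring
  · have hr : 0 ≤ (Real.pi / 2 - t) ^ (-((4 * m : ℕ) + 1 / 2) : ℝ) :=
      Real.rpow_nonneg (by linarith [ht.2]) _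
    refine (norm_framePairing_le hK (iterate_boostDeriv_eq_zero x n hK.isClosed h0 k)
      (hφM k hk) (mul_nonneg hC hr) fun y hy hyK => h x n y hxn hy (hR y hyK) t ht).trans
      (le_of_eq ?_)
    ring

theorem exists_abs_beta_le {K : Set (Fin (d + 1) → ℝ)} (hK : IsCompact K)
    (x n : Fin (d + 1) → ℝ) : ∃ R, ∀ y ∈ K, |beta x y| + |beta n y| ≤ R := by
  obtain ⟨R, hR⟩ := hK.exists_bound_of_continuousOn
    (f := fun y => |beta x y| + |beta n y|) (by fun_prop)
  exact ⟨R, fun y hy => (le_abs_self _).trans (hR y hy)⟩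

/-- The boundary value of `f(β(z_t, ·))` exists in the sense of distributions. -/
theorem IsFrame.exists_tendsto_framePairing {x n : Fin (d + 1) → ℝ} (hxn : IsFrame x n) {m : ℕ}
    {f : ℂ → ℂ} (hf : ModerateGrowth m f) {φ : (Fin (d + 1) → ℝ) → ℝ} (hφ : ContDiff ℝ ∞ φ)
    (hφc : HasCompactSupport φ) :
    ∃ L, Tendsto (fun t => framePairing f x n t φ) (𝓝[<] (Real.pi / 2)) (𝓝 L) := by
  have h0 : ∀ y ∉ tsupport φ, φ y = 0 := fun y hy => image_eq_zero_of_notMem_tsupport hy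
  have hK : IsCompact (tsupport φ) := hφc
  obtain ⟨R, hR⟩ := exists_abs_beta_le hK x n
  obtain ⟨C, hC, h⟩ := hf.exists_norm_comp_le (d := d) R
  obtain ⟨M, hM⟩ := hK.exists_bound_of_continuousOn
    (f := fun y => ∑ k ∈ Finset.range (4 * m + 3), |(boostDeriv x n)^[k] φ y|)
    (continuous_finsetSum _ fun k _ =>
      (contDiff_iterate_boostDeriv x n hφ k).continuous.abs).continuousOn
  have hM' : ∀ k ≤ 4 * m + 2, ∀ y ∈ tsupport φ, |(boostDeriv x n)^[k] φ y| ≤ |M| :=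
    fun k hk y hy => (Finset.single_le_sum
      (f := fun k => |(boostDeriv x n)^[k] φ y|) (fun _ _ => abs_nonneg _)
      (Finset.mem_range.2 (by lia))).trans
        ((le_abs_self _).trans ((hM y hy).trans (le_abs_self M)))
  refine exists_tendsto_of_chain (T := Real.pi / 2)
    (B := C * |M| * (volumeMeasure d).real (tsupport φ)) (4 * m)
    (fun k t => framePairing f x n t ((boostDeriv x n)^[k] φ))
    (fun k t ht => hxn.hasDerivAt_framePairing_iterate hf.1 hφ hK h0 (cos_pos_of_mem ht) k)
    (by positivity) (fun k hk t ht => ?_)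
  have hr : 0 ≤ (Real.pi / 2 - t) ^ (-((4 * m : ℕ) + 1 / 2) : ℝ) :=
    Real.rpow_nonneg (by linarith [ht.2]) _
  refine (norm_framePairing_le hK (iterate_boostDeriv_eq_zero x n hK.isClosed h0 k)
    (hM' k hk) (mul_nonneg hC hr) fun y hy hyK => h x n y hxn hy (hR y hyK) t ht).trans
    (le_of_eq ?_)
  ring

/-! ### Independence of the frame -/

/-- The iterated boost derivatives are jointly smooth in the point and the parameter of a curve of
frames. -/
theorem contDiff_uncurry_iterate_boostDeriv (x : Fin (d + 1) → ℝ) {ν : ℝ → Fin (d + 1) → ℝ}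
    (hν : ContDiff ℝ ∞ ν) {Ψ : ℝ → (Fin (d + 1) → ℝ) → ℝ}
    (hΨ : ContDiff ℝ ∞ (Function.uncurry Ψ)) (k : ℕ) :
    ContDiff ℝ ∞ (Function.uncurry fun s => (boostDeriv x (ν s))^[k] (Ψ s)) := by
  induction k with
  | zero => exact hΨ
  | succ k ih =>
    simp only [Function.iterate_succ_apply']
    have h1 : ContDiff ℝ ∞ (fun p : ℝ × (Fin (d + 1) → ℝ) =>
        fderiv ℝ ((boostDeriv x (ν p.1))^[k] (Ψ p.1)) p.2) :=
      ContDiff.fderiv (f := fun p : ℝ × (Fin (d + 1) → ℝ) =>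
        (boostDeriv x (ν p.1))^[k] (Ψ p.1)) (n := ∞) (m := ∞)
        (ih.comp (f := fun q : (ℝ × (Fin (d + 1) → ℝ)) × (Fin (d + 1) → ℝ) => (q.1.1, q.2))
          (by fun_prop)) contDiff_snd (by simp)
    exact h1.clm_apply (contDiff_boostGen x (hν.comp contDiff_fst) contDiff_snd)

/-- Moving the frame along a smooth curve changes the regularized pairing by `O(cos t)`, because
the derivative of `β(z_t, y)` along the curve carries the factor `cos t`. -/
theorem tendsto_framePairing_sub {x : Fin (d + 1) → ℝ} {ν : ℝ → Fin (d + 1) → ℝ}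
    (hν : ContDiff ℝ ∞ ν) (hxν : ∀ s, IsFrame x (ν s)) {m : ℕ} {f : ℂ → ℂ}
    (hf : DifferentiableOn ℂ f sphericalDomain) (hf' : ModerateGrowth m (deriv f))
    {φ : (Fin (d + 1) → ℝ) → ℝ} (hφ : ContDiff ℝ ∞ φ) (hφc : HasCompactSupport φ) {ℓ : ℝ}
    (hℓ : 0 ≤ ℓ) :
    Tendsto (fun t => framePairing f x (ν ℓ) t φ - framePairing f x (ν 0) t φ)
      (𝓝[<] (Real.pi / 2)) (𝓝 0) := by
  have h0 : ∀ y ∉ tsupport φ, φ y = 0 := fun y hy => image_eq_zero_of_notMem_tsupport hy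
  have hK : IsCompact (tsupport φ) := hφc
  have hν' : ContDiff ℝ ∞ (deriv ν) := (contDiff_infty_iff_deriv.1 hν).2
  set Ψ : ℝ → (Fin (d + 1) → ℝ) → ℝ := fun s y => beta (deriv ν s) y * φ y with hΨdef
  have hΨ : ContDiff ℝ ∞ (Function.uncurry Ψ) :=
    (contDiff_beta_comp (hν'.comp contDiff_fst) contDiff_snd).mul (hφ.comp contDiff_snd)
  have hIK : IsCompact (Set.Icc 0 ℓ ×ˢ tsupport φ) := isCompact_Icc.prod hK
  have hνc := hν.continuous
  obtain ⟨R, hR⟩ := hIK.exists_bound_of_continuousOn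
    (f := fun p => |beta x p.2| + |beta (ν p.1) p.2|) (by fun_prop)
  obtain ⟨M, hM⟩ := hIK.exists_bound_of_continuousOn
    (f := fun p => ∑ k ∈ Finset.range (4 * m + 2), |(boostDeriv x (ν p.1))^[k] (Ψ p.1) p.2|)
    (continuous_finsetSum _ fun k _ =>
      (contDiff_uncurry_iterate_boostDeriv x hν hΨ k).continuous.abs).continuousOn
  obtain ⟨C, hC, h⟩ := hf'.exists_norm_framePairing_le hK R
  have hbound : ∀ s ∈ Set.Icc 0 ℓ, ∀ t ∈ Set.Ico (Real.pi / 2 - 1) (Real.pi / 2),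
      ‖framePairing (deriv f) x (ν s) t (Ψ s)‖ ≤ C * |M| := by
    intro s hs t ht
    refine h x (ν s) (hxν s) (fun y hy => (le_abs_self _).trans (hR (s, y) ⟨hs, hy⟩)) (Ψ s)
      (hΨ.comp (f := fun y => (s, y)) (by fun_prop)) (fun y hy => by simp [Ψ, h0 y hy]) |M|
      (abs_nonneg _) (fun k hk y hy => ?_) t ht
    exact (Finset.single_le_sum (f := fun k => |(boostDeriv x (ν s))^[k] (Ψ s) y|)
      (fun _ _ => abs_nonneg _) (Finset.mem_range.2 (by lia))).trans
        ((le_abs_self _).trans ((hM (s, y) ⟨hs, hy⟩).trans (le_abs_self M)))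
  have hφc' : Continuous (fun p : ℝ × (Fin (d + 1) → ℝ) => (φ p.2 : ℂ)) :=
    continuous_ofReal.comp (hφ.continuous.comp continuous_snd)
  have hcont : ∀ {g : ℂ → ℂ}, ContinuousOn g sphericalDomain → ∀ t, 0 < Real.cos t →
      ContinuousOn (Function.uncurry fun s y => g (frameParam x (ν s) t y))
        (Set.univ ×ˢ deSitter d) := by
    intro g hg t ht
    refine hg.comp (f := fun p : ℝ × (Fin (d + 1) → ℝ) => frameParam x (ν p.1) t p.2)
      (by fun_prop) ?_
    rintro ⟨s, y⟩ ⟨_, hy⟩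
    exact (hxν s).mem_sphericalDomain hy ht
  have hderiv : ∀ t, 0 < Real.cos t → ∀ s, HasDerivAt (fun s => framePairing f x (ν s) t φ)
      (I * Real.cos t * framePairing (deriv f) x (ν s) t (Ψ s)) s := by
    intro t ht s
    have key := hasDerivAt_integral_deSitter
      (G := fun s y => f (frameParam x (ν s) t y) * (φ y : ℂ))
      (G' := fun s y => I * Real.cos t * (deriv f (frameParam x (ν s) t y) * (Ψ s y : ℂ)))
      (J := Set.univ) isOpen_univ (Set.mem_univ s) hK
      ((hcont hf.continuousOn t ht).mul hφc'.continuousOn)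
      (continuousOn_const.mul ((hcont hf'.1.continuousOn t ht).mul
        (continuous_ofReal.comp hΨ.continuous).continuousOn)) ?_ ?_
    · refine key.congr_deriv ?_
      rw [integral_const_mul, framePairing]
    · intro s _ y hy
      have hn : HasDerivAt (fun s => beta (ν s) y) (beta (deriv ν s) y) s := by
        have := hasDerivAt_beta_comp (x := y)
          ((hν.differentiable (by simp)).differentiableAt (x := s)).hasDerivAt
        simpa only [beta_comm y] using this
      have h1 : HasDerivAt (fun s => frameParam x (ν s) t y)
          ((Real.cos t * beta (deriv ν s) y : ℝ) * I) s :=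
        (((hn.const_mul (Real.cos t)).ofReal_comp).mul_const I).const_add _
      have h2 := (hf.differentiableAt (isOpen_sphericalDomain.mem_nhds
        ((hxν s).mem_sphericalDomain hy ht))).hasDerivAt.scomp s h1
      refine (h2.mul_const (φ y : ℂ)).congr_deriv ?_
      simp only [smul_eq_mul, Ψ]
      push_cast
      ring
    · intro s _ y _ hy
      simp [h0 y hy]
  have hle : ∀ t ∈ Set.Ico (Real.pi / 2 - 1) (Real.pi / 2),
      ‖framePairing f x (ν ℓ) t φ - framePairing f x (ν 0) t φ‖ ≤
        Real.cos t * (C * |M| * ℓ) := by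
    intro t ht
    have hc := cos_pos_of_mem ht
    have := (convex_Icc 0 ℓ).norm_image_sub_le_of_norm_hasDerivWithin_le
      (C := Real.cos t * (C * |M|))
      (fun s _ => (hderiv t hc s).hasDerivWithinAt) (fun s hs => by
        rw [norm_mul, norm_mul, norm_I, one_mul, norm_real, Real.norm_eq_abs, abs_of_pos hc]
        exact mul_le_mul_of_nonneg_left (hbound s hs t ht) hc.le)
      (Set.left_mem_Icc.2 hℓ) (Set.right_mem_Icc.2 hℓ)
    rwa [sub_zero, Real.norm_eq_abs, abs_of_nonneg hℓ, mul_assoc] at this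
  refine squeeze_zero_norm' (a := fun t => Real.cos t * (C * |M| * ℓ)) ?_ ?_
  · filter_upwards [Ico_mem_nhdsLT (show Real.pi / 2 - 1 < Real.pi / 2 by linarith)] with t ht
      using hle t ht
  · have : Tendsto (fun t => Real.cos t * (C * |M| * ℓ)) (𝓝 (Real.pi / 2))
        (𝓝 (Real.cos (Real.pi / 2) * (C * |M| * ℓ))) :=
      (Real.continuous_cos.mul continuous_const).tendsto _
    rw [Real.cos_pi_div_two, zero_mul] at this
    exact this.mono_left nhdsWithin_le_nhds

/-- Frames at `x` with the same time orientation give the same boundary value. -/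
theorem IsFrame.tendsto_framePairing_sub {x n n' : Fin (d + 1) → ℝ} (hn : IsFrame x n)
    (hn' : IsFrame x n') (hpos : 0 < beta n n') {m : ℕ} {f : ℂ → ℂ}
    (hf : DifferentiableOn ℂ f sphericalDomain) (hf' : ModerateGrowth m (deriv f))
    {φ : (Fin (d + 1) → ℝ) → ℝ} (hφ : ContDiff ℝ ∞ φ) (hφc : HasCompactSupport φ) :
    Tendsto (fun t => framePairing f x n' t φ - framePairing f x n t φ)
      (𝓝[<] (Real.pi / 2)) (𝓝 0) := by
  -- the segment from `n` to `n'`, reparametrized by `sin²` and normalized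
  set w : ℝ → Fin (d + 1) → ℝ := fun s => Real.cos s ^ 2 • n + Real.sin s ^ 2 • n' with hw
  have hww : ∀ s, beta (w s) (w s) =
      Real.cos s ^ 4 + Real.sin s ^ 4 + 2 * (Real.cos s * Real.sin s) ^ 2 * beta n n' := by
    intro s
    simp only [hw, beta_add_left, beta_add_right, beta_smul_left, beta_smul_right, hn.beta_right,
      hn'.beta_right, beta_comm n' n]
    ring
  have hw0 : ∀ s, 0 < beta (w s) (w s) := by
    intro s
    rw [hww]
    have h1 := Real.sin_sq_add_cos_sq s
    have h2 : 0 < Real.cos s ^ 4 + Real.sin s ^ 4 := by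
      nlinarith [sq_nonneg (Real.cos s ^ 2 - Real.sin s ^ 2)]
    positivity
  have hwc : ContDiff ℝ ∞ w :=
    ((Real.contDiff_cos.pow 2).smul contDiff_const).add
      ((Real.contDiff_sin.pow 2).smul contDiff_const)
  set ν : ℝ → Fin (d + 1) → ℝ := fun s => (Real.sqrt (beta (w s) (w s)))⁻¹ • w s with hν
  have hs0 : ∀ s, Real.sqrt (beta (w s) (w s)) ≠ 0 := fun s => (Real.sqrt_pos.2 (hw0 s)).ne'
  have hνc : ContDiff ℝ ∞ ν :=
    (((contDiff_beta_comp hwc hwc).sqrt fun s => (hw0 s).ne').inv hs0).smul hwc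
  have hframe : ∀ s, IsFrame x (ν s) := by
    intro s
    refine ⟨hn.beta_left, ?_, ?_⟩
    · simp only [hν, beta_smul_left, beta_smul_right]
      have := hs0 s
      field_simp
      rw [Real.sq_sqrt (hw0 s).le]
    · simp only [hν, hw, beta_smul_left, beta_add_left, hn.beta_mixed, hn'.beta_mixed]
      ring
  have key := DeSitter.tendsto_framePairing_sub hνc hframe hf hf' hφ hφc
    (ℓ := Real.pi / 2) (by positivity)
  have e0 : ν 0 = n := by
    simp [hν, hw, hn.beta_right]
  have e1 : ν (Real.pi / 2) = n' := by
    simp [hν, hw, hn'.beta_right]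
  rwa [e0, e1] at key

/-! ### The boundary value as a distribution -/

theorem eventually_cos_pos : ∀ᶠ t in 𝓝[<] (Real.pi / 2), 0 < Real.cos t := by
  filter_upwards [Ico_mem_nhdsLT (show Real.pi / 2 - 1 < Real.pi / 2 by linarith)] with t ht
    using cos_pos_of_mem ht

theorem IsFrame.integrable_framePairing {x n : Fin (d + 1) → ℝ} (h : IsFrame x n) {f : ℂ → ℂ}
    (hf : ContinuousOn f sphericalDomain) {φ : (Fin (d + 1) → ℝ) → ℝ} (hφ : Continuous φ)
    (hφc : HasCompactSupport φ) {t : ℝ} (ht : 0 < Real.cos t) :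
    Integrable (fun y => f (frameParam x n t y) * (φ y : ℂ)) (volumeMeasure d) :=
  integrable_of_continuousOn ((h.continuousOn_comp_frameParam_right hf ht).mul
    (continuous_ofReal.comp hφ).continuousOn) hφc fun y _ hy => by
      simp [image_eq_zero_of_notMem_tsupport hy]

/-- The boundary value of `f(β(z_t, ·))` at `t = π/2`, applied to `φ`. The limit exists for `f` of
moderate growth and smooth compactly supported `φ`, see `IsFrame.tendsto_boundaryValue`. -/
noncomputable def boundaryValue (f : ℂ → ℂ) (x n : Fin (d + 1) → ℝ)
    (φ : (Fin (d + 1) → ℝ) → ℝ) : ℂ :=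
  limUnder (𝓝[<] (Real.pi / 2)) fun t => framePairing f x n t φ

section

variable {x n : Fin (d + 1) → ℝ} {m : ℕ} {f : ℂ → ℂ}

theorem IsFrame.tendsto_boundaryValue (h : IsFrame x n) (hf : ModerateGrowth m f)
    {φ : (Fin (d + 1) → ℝ) → ℝ} (hφ : ContDiff ℝ ∞ φ) (hφc : HasCompactSupport φ) :
    Tendsto (fun t => framePairing f x n t φ) (𝓝[<] (Real.pi / 2))
      (𝓝 (boundaryValue f x n φ)) :=
  tendsto_nhds_limUnder (h.exists_tendsto_framePairing hf hφ hφc)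

theorem IsFrame.boundaryValue_add (h : IsFrame x n) (hf : ModerateGrowth m f)
    (φ ψ : AmbientTest d) :
    boundaryValue f x n ⇑(φ + ψ) = boundaryValue f x n φ + boundaryValue f x n ψ := by
  refine tendsto_nhds_unique
    (h.tendsto_boundaryValue hf (φ + ψ).contDiff (φ + ψ).hasCompactSupport)
    (((h.tendsto_boundaryValue hf φ.contDiff φ.hasCompactSupport).add
      (h.tendsto_boundaryValue hf ψ.contDiff ψ.hasCompactSupport)).congr' ?_)
  filter_upwards [eventually_cos_pos] with t ht
  rw [framePairing, framePairing, framePairing, ← integral_add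
    (h.integrable_framePairing hf.1.continuousOn φ.continuous φ.hasCompactSupport ht)
    (h.integrable_framePairing hf.1.continuousOn ψ.continuous ψ.hasCompactSupport ht)]
  refine integral_congr_ae (ae_of_all _ fun y => ?_)
  have : (φ + ψ) y = φ y + ψ y := rfl
  simp only [this]
  push_cast
  ring

theorem IsFrame.boundaryValue_smul (h : IsFrame x n) (hf : ModerateGrowth m f) (c : ℝ)
    (φ : AmbientTest d) : boundaryValue f x n ⇑(c • φ) = c • boundaryValue f x n φ := by
  refine tendsto_nhds_unique
    (h.tendsto_boundaryValue hf (c • φ).contDiff (c • φ).hasCompactSupport)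
    (((h.tendsto_boundaryValue hf φ.contDiff φ.hasCompactSupport).const_smul c).congr
      fun t => ?_)
  rw [framePairing, framePairing, ← integral_smul]
  refine integral_congr_ae (ae_of_all _ fun y => ?_)
  have : (c • φ) y = c * φ y := rfl
  simp only [this, real_smul]
  push_cast
  ring

open TopologicalSpace (Compacts)

/-- The boost derivative on the smooth functions supported in `K`. -/
noncomputable def boostDerivCLM (x n : Fin (d + 1) → ℝ) (K : Compacts (Fin (d + 1) → ℝ)) :
    𝓓_{K}(Fin (d + 1) → ℝ, ℝ) →L[ℝ] 𝓓_{K}(Fin (d + 1) → ℝ, ℝ) :=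
  (ContDiffMapSupportedIn.bilinLeftCLM (g := boostGen x n)
    (ContinuousLinearMap.id ℝ ((Fin (d + 1) → ℝ) →L[ℝ] ℝ))
    (contDiff_boostGen x contDiff_const contDiff_id)).comp
    (ContDiffMapSupportedIn.fderivCLM ℝ ⊤ ⊤)

theorem boostDerivCLM_apply (x n : Fin (d + 1) → ℝ) (K : Compacts (Fin (d + 1) → ℝ))
    (φ : 𝓓_{K}(Fin (d + 1) → ℝ, ℝ)) : ⇑(boostDerivCLM x n K φ) = boostDeriv x n φ := by
  ext y
  simp [boostDerivCLM, boostDeriv]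

theorem iterate_boostDerivCLM_apply (x n : Fin (d + 1) → ℝ) (K : Compacts (Fin (d + 1) → ℝ))
    (φ : 𝓓_{K}(Fin (d + 1) → ℝ, ℝ)) (k : ℕ) :
    ⇑((boostDerivCLM x n K)^[k] φ) = (boostDeriv x n)^[k] φ := by
  induction k with
  | zero => rfl
  | succ k ih => rw [Function.iterate_succ_apply', Function.iterate_succ_apply',
      boostDerivCLM_apply, ih]

/-- By the uniform estimate, the boundary value is bounded on the test functions supported in a
compact set by finitely many suprema of boost derivatives, so it is continuous. -/
theorem IsFrame.continuous_boundaryValue (h : IsFrame x n) (hf : ModerateGrowth m f)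
    (T : AmbientTest d →ₗ[ℝ] ℂ) (hT : ∀ φ, T φ = boundaryValue f x n φ) : Continuous T := by
  rw [TestFunction.continuous_iff_continuous_comp]
  intro K hKΩ
  obtain ⟨R, hR⟩ := exists_abs_beta_le K.isCompact x n
  obtain ⟨C, hC, hb⟩ := hf.exists_norm_framePairing_le K.isCompact R
  set q : 𝓓_{K}(Fin (d + 1) → ℝ, ℝ) → ℝ := fun φ => C * ∑ k ∈ Finset.range (4 * m + 2),
    ‖ContDiffMapSupportedIn.toBoundedContinuousFunctionCLM ℝ
      ((boostDerivCLM x n K)^[k] φ)‖ with hq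
  have hqc : Continuous q := by
    refine continuous_const.mul (continuous_finsetSum _ fun k _ => ?_)
    exact ((ContinuousLinearMap.continuous _).comp
      ((boostDerivCLM x n K).continuous.iterate k)).norm
  have hq0 : q 0 = 0 := by
    have : ∀ k, (boostDerivCLM x n K)^[k] 0 = 0 := fun k =>
      Function.iterate_fixed (map_zero _) k
    simp only [hq, this, map_zero, norm_zero, Finset.sum_const_zero, mul_zero]
  have hle : ∀ φ : 𝓓_{K}(Fin (d + 1) → ℝ, ℝ), ‖T (TestFunction.ofSupportedIn hKΩ φ)‖ ≤ q φ := by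
    intro φ
    rw [hT]
    have hφ0 : ∀ y ∉ (K : Set (Fin (d + 1) → ℝ)), φ y = 0 := fun y hy => φ.zero_on_compl hy
    refine le_of_tendsto (h.tendsto_boundaryValue hf φ.contDiff φ.hasCompactSupport).norm ?_
    filter_upwards [Ico_mem_nhdsLT (show Real.pi / 2 - 1 < Real.pi / 2 by linarith)] with t ht
    refine hb x n h hR φ φ.contDiff hφ0 _ (Finset.sum_nonneg fun _ _ => norm_nonneg _)
      (fun k hk y _ => ?_) t ht
    refine le_trans ?_ (Finset.single_le_sum (f := fun k =>
      ‖ContDiffMapSupportedIn.toBoundedContinuousFunctionCLM ℝ ((boostDerivCLM x n K)^[k] φ)‖)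
      (fun _ _ => norm_nonneg _) (Finset.mem_range.2 (Nat.lt_succ_of_le hk)))
    rw [← iterate_boostDerivCLM_apply]
    exact BoundedContinuousFunction.norm_coe_le_norm
      (ContDiffMapSupportedIn.toBoundedContinuousFunctionCLM ℝ ((boostDerivCLM x n K)^[k] φ)) y
  refine continuous_of_continuousAt_zero
    (T.comp (TestFunction.ofSupportedInCLM ℝ hKΩ).toLinearMap) ?_
  rw [ContinuousAt, map_zero]
  refine squeeze_zero_norm hle ?_
  rw [← hq0]
  exact hqc.tendsto 0

/-- The boundary value of `f(β(z_t, ·))` at `t = π/2`, as a distribution on de Sitter space. -/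
noncomputable def boundaryDistribution (h : IsFrame x n) (hf : ModerateGrowth m f) :
    distributions d :=
  ⟨{ toFun := fun φ => boundaryValue f x n φ
     map_add' := h.boundaryValue_add hf
     map_smul' := h.boundaryValue_smul hf
     cont := h.continuous_boundaryValue hf
       ⟨⟨fun φ => boundaryValue f x n φ, h.boundaryValue_add hf⟩, h.boundaryValue_smul hf⟩
       fun _ => rfl }, by
    intro φ hφ
    refine tendsto_nhds_unique (h.tendsto_boundaryValue hf φ.contDiff φ.hasCompactSupport)
      (tendsto_const_nhds.congr fun t => ?_)
    rw [framePairing, integral_eq_zero_of_ae]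
    filter_upwards [ae_mem_deSitter] with y hy
    simp [hφ y hy]⟩

end

/-- The boundary distribution is the limit along every frame of the same time orientation. -/
theorem hasLeftLimit_boundaryDistribution {x n n' : Fin (d + 1) → ℝ} (h : IsFrame x n)
    (h' : IsFrame x n') (hpos : 0 < beta n n') {m m' : ℕ} {f : ℂ → ℂ} (hf : ModerateGrowth m f)
    (hf' : ModerateGrowth m' (deriv f)) :
    HasLeftLimit (fun t y => f (frameParam x n' t y)) (Real.pi / 2)
      (boundaryDistribution h hf) := by
  intro φ
  refine ⟨?_, ?_⟩
  · filter_upwards [eventually_cos_pos] with t ht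
    exact h'.integrable_framePairing hf.1.continuousOn φ.continuous φ.hasCompactSupport ht
  · have h1 := (h.tendsto_boundaryValue hf φ.contDiff φ.hasCompactSupport).add
      (h.tendsto_framePairing_sub h' hpos hf.1 hf' φ.contDiff φ.hasCompactSupport)
    rw [add_zero] at h1
    refine h1.congr fun t => ?_
    rw [add_sub_cancel, framePairing]

/-! ### Time orientation and the causal structure -/

theorem beta_single_zero_left (x : Fin (d + 1) → ℝ) : beta (Pi.single 0 1) x = x 0 := by
  simp [beta]

/-- The reverse Cauchy–Schwarz inequality, in the form that two future-directed timelike vectors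
have positive product. -/
theorem beta_pos_of_timelike {n w : Fin (d + 1) → ℝ} (hn : 0 < beta n n) (hn0 : 0 < n 0)
    (hw : 0 < beta w w) (hw0 : 0 < w 0) : 0 < beta n w := by
  have hcs := Finset.sum_mul_sq_le_sq_mul_sq Finset.univ (fun i : Fin d => n i.succ)
    (fun i => w i.succ)
  simp only [beta, ← sq, sub_pos] at hn hw ⊢
  have hW : 0 ≤ ∑ i : Fin d, w i.succ ^ 2 := Finset.sum_nonneg fun i _ => sq_nonneg _
  refine lt_of_abs_lt (abs_lt_of_sq_lt_sq ?_ (by positivity))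
  rw [mul_pow]
  exact hcs.trans_lt ((mul_le_mul_of_nonneg_right hn.le hW).trans_lt
    (mul_lt_mul_of_pos_left hw (by positivity)))

/-- At every point of de Sitter space there is a future-directed frame. -/
theorem exists_isFrame {x : Fin (d + 1) → ℝ} (hx : x ∈ deSitter d) :
    ∃ n, IsFrame x n ∧ 0 < n 0 := by
  have hx' : beta x x = -1 := hx
  set c : ℝ := Real.sqrt (1 + x 0 ^ 2) with hc
  have hcpos : 0 < c := Real.sqrt_pos.2 (by positivity)
  have hc2 : c ^ 2 = 1 + x 0 ^ 2 := Real.sq_sqrt (by positivity)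
  refine ⟨c⁻¹ • (Pi.single 0 1 + x 0 • x), ⟨hx', ?_, ?_⟩, ?_⟩
  · simp only [beta_smul_left, beta_smul_right, beta_add_left, beta_add_right,
      beta_single_zero_left, beta_comm x (Pi.single 0 1), hx', Pi.single_eq_same]
    field_simp
    rw [hc2]
    ring
  · simp only [beta_smul_left, beta_add_left, beta_single_zero_left, hx']
    ring
  · simp only [Pi.smul_apply, Pi.add_apply, Pi.single_eq_same, smul_eq_mul]
    have : 0 < 1 + x 0 * x 0 := by nlinarith
    positivity

theorem beta_sub_self {x y : Fin (d + 1) → ℝ} (hx : x ∈ deSitter d) (hy : y ∈ deSitter d) :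
    beta (y - x) (y - x) = -2 - 2 * beta x y := by
  have hx' : beta x x = -1 := hx
  have hy' : beta y y = -1 := hy
  simp only [beta_sub_left, beta_sub_right, hx', hy', beta_comm y x]
  ring

theorem mem_chronological_iff {x y : Fin (d + 1) → ℝ} (hx : x ∈ deSitter d) :
    y ∈ chronological x ↔ y ∈ deSitter d ∧ beta x y < -1 := by
  refine and_congr_right fun hy => ?_
  rw [beta_sub_self hx hy]
  constructor <;> intro h <;> linarith

/-- The points that are not spacelike to `x` lie in the closure of `I(x)`: moving `y` along the
hyperbola through `y` with a timelike tangent vector `n` at `y`, `β(x, n) ≤ 0`, makes `β(x, y)`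
smaller. -/
theorem mem_closure_chronological {x y : Fin (d + 1) → ℝ} (hx : x ∈ deSitter d)
    (hy : y ∈ deSitter d) (hxy : beta x y ≤ -1) : y ∈ closure (chronological x) := by
  obtain ⟨n, hn, hxn⟩ : ∃ n, IsFrame y n ∧ beta x n ≤ 0 := by
    obtain ⟨n, hn, -⟩ := exists_isFrame hy
    rcases le_total (beta x n) 0 with h | h
    · exact ⟨n, hn, h⟩
    · exact ⟨-n, hn.neg, by rw [beta_neg_right]; linarith⟩
  set c : ℝ → Fin (d + 1) → ℝ := fun τ => Real.cosh τ • y + Real.sinh τ • n with hc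
  have hcc : Continuous c :=
    (Real.continuous_cosh.smul continuous_const).add (Real.continuous_sinh.smul continuous_const)
  have hlim : Tendsto c (𝓝[>] 0) (𝓝 y) := by
    have := hcc.tendsto 0
    simp only [hc, Real.cosh_zero, Real.sinh_zero, one_smul, zero_smul, add_zero] at this
    exact this.mono_left nhdsWithin_le_nhds
  refine mem_closure_of_tendsto hlim ?_
  filter_upwards [self_mem_nhdsWithin] with τ hτ
  have hτ : 0 < τ := hτ
  rw [mem_chronological_iff hx]
  constructor
  · change beta _ _ = -1
    simp only [hc, beta_add_left, beta_add_right, beta_smul_left, beta_smul_right, hn.beta_left,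
      hn.beta_right, hn.beta_mixed, hn.beta_mixed']
    linear_combination -Real.cosh_sq τ
  · simp only [hc, beta_add_right, beta_smul_right]
    have h1 : 1 < Real.cosh τ := Real.one_lt_cosh.2 hτ.ne'
    have h2 : 0 < Real.sinh τ := Real.sinh_pos_iff.2 hτ
    nlinarith [mul_nonneg h2.le (neg_nonneg.2 hxn)]

theorem IsFrame.beta_pos_of_chronologicalFuture {x n y : Fin (d + 1) → ℝ} (h : IsFrame x n)
    (hn : 0 < n 0) (hy : y ∈ chronologicalFuture x) : 0 < beta n y := by
  have := beta_pos_of_timelike (by rw [h.beta_right]; exact one_pos) hn hy.1.2 hy.2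
  rwa [beta_sub_right, h.beta_mixed, sub_zero] at this

theorem IsFrame.beta_neg_of_chronologicalPast {x n y : Fin (d + 1) → ℝ} (h : IsFrame x n)
    (hn : 0 < n 0) (hy : y ∈ chronologicalPast x) : beta n y < 0 := by
  have h1 : 0 < beta (x - y) (x - y) := by
    rw [← neg_sub, beta_neg_left, beta_neg_right, neg_neg]; exact hy.1.2
  have h2 : 0 < (x - y) 0 := by
    have h := hy.2
    simp only [Pi.sub_apply] at h ⊢
    linarith
  have := beta_pos_of_timelike (by rw [h.beta_right]; exact one_pos) hn h1 h2
  rw [beta_sub_right, h.beta_mixed, zero_sub] at this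
  linarith

/-! ### The kernel in terms of frames -/

theorem beta_toComplex (x y : Fin (d + 1) → ℝ) :
    beta (toComplex x) (toComplex y) = ((beta x y : ℝ) : ℂ) := by
  simp [beta, toComplex]

theorem star_toComplex (y : Fin (d + 1) → ℝ) : star (toComplex y) = toComplex y := by
  ext i
  simp [toComplex]

theorem act_single (g : Matrix (Fin (d + 1)) (Fin (d + 1)) ℝ) (i : Fin (d + 1)) :
    act g (Pi.single i 1) = toComplex (g.mulVec (Pi.single i 1)) := by
  ext j
  simp [act, toComplex]

theorem star_zPoint (t : ℝ) : star (zPoint d t) =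
    (-(I * (Real.cos t : ℂ))) • Pi.single 0 1 + (Real.sin t : ℂ) • Pi.single 1 1 := by
  have h : ∀ i : Fin (d + 1), star (Pi.single i 1 : Fin (d + 1) → ℂ) = Pi.single i 1 := by
    intro i
    ext j
    rcases eq_or_ne j i with rfl | hj
    · simp
    · simp [hj]
  rw [zPoint, star_add, star_smul, star_smul, h, h]
  simp [-ofReal_cos, -ofReal_sin, conj_ofReal]

theorem beta_act_zPoint (g : Matrix (Fin (d + 1)) (Fin (d + 1)) ℝ) (t : ℝ)
    (y : Fin (d + 1) → ℝ) : beta (act g (zPoint d t)) (toComplex y) =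
      frameParam (g.mulVec (basePoint d)) (g.mulVec (Pi.single 0 1)) t y := by
  have h : act g (zPoint d t) = (I * (Real.cos t : ℂ)) • act g (Pi.single 0 1) +
      (Real.sin t : ℂ) • act g (Pi.single 1 1) := by
    rw [zPoint, act, Matrix.mulVec_add, Matrix.mulVec_smul, Matrix.mulVec_smul, act, act]
  rw [h, beta_add_left, beta_smul_left, beta_smul_left, act_single, act_single, beta_toComplex,
    beta_toComplex, frameParam, basePoint]
  push_cast
  ring

theorem beta_act_star_zPoint (g : Matrix (Fin (d + 1)) (Fin (d + 1)) ℝ) (t : ℝ)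
    (y : Fin (d + 1) → ℝ) : beta (toComplex y) (act g (star (zPoint d t))) =
      frameParam (g.mulVec (basePoint d)) (-g.mulVec (Pi.single 0 1)) t y := by
  have h : act g (star (zPoint d t)) = (-(I * (Real.cos t : ℂ))) • act g (Pi.single 0 1) +
      (Real.sin t : ℂ) • act g (Pi.single 1 1) := by
    rw [star_zPoint, act, Matrix.mulVec_add, Matrix.mulVec_smul, Matrix.mulVec_smul, act, act]
  rw [h, beta_comm, beta_add_left, beta_smul_left, beta_smul_left, act_single, act_single,
    beta_toComplex, beta_toComplex, frameParam, basePoint, beta_neg_left]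
  push_cast
  ring

theorem kernel_act_zPoint {k : ℕ} (hd : d = 2 * k + 1) (lam : ℂ)
    (g : Matrix (Fin (d + 1)) (Fin (d + 1)) ℝ) (t : ℝ) (y : Fin (d + 1) → ℝ) :
    kernel lam (act g (zPoint d t)) (toComplex y) = spherical k lam
      (frameParam (g.mulVec (basePoint d)) (g.mulVec (Pi.single 0 1)) t y) := by
  have e1 : (d : ℂ) / 2 = k + 1 / 2 := by rw [hd]; push_cast; ring
  have e2 : ((d : ℂ) - 1) / 2 = k := by rw [hd]; push_cast; ring
  rw [kernel, star_toComplex, beta_act_zPoint, spherical, e1, e2]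

theorem conjKernel_act_star_zPoint {k : ℕ} (hd : d = 2 * k + 1) (lam : ℂ)
    (g : Matrix (Fin (d + 1)) (Fin (d + 1)) ℝ) (t : ℝ) (y : Fin (d + 1) → ℝ) :
    conjKernel lam (act g (star (zPoint d t))) (toComplex y) = spherical k lam
      (frameParam (g.mulVec (basePoint d)) (-g.mulVec (Pi.single 0 1)) t y) := by
  have e1 : (d : ℂ) / 2 = k + 1 / 2 := by rw [hd]; push_cast; ring
  have e2 : ((d : ℂ) - 1) / 2 = k := by rw [hd]; push_cast; ring
  rw [conjKernel, kernel, star_toComplex, star_star, beta_act_star_zPoint, spherical, e1, e2]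

/-- A Lorentz transformation carries the standard frame at `e₁` to a future-directed frame. -/
theorem isFrame_mulVec {g : Matrix (Fin (d + 1)) (Fin (d + 1)) ℝ} (hg : g ∈ lorentzGroup d)
    (hd : d ≠ 0) {x : Fin (d + 1) → ℝ} (hx : x ∈ deSitter d) (hgx : g.mulVec (basePoint d) = x) :
    IsFrame x (g.mulVec (Pi.single 0 1)) ∧ 0 < g.mulVec (Pi.single 0 1) 0 := by
  refine ⟨⟨hx, ?_, ?_⟩, ?_⟩
  · rw [hg.1, beta_single_zero_left, Pi.single_eq_same]
  · have : NeZero d := ⟨hd⟩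
    rw [← hgx, hg.1, beta_single_zero_left, basePoint, Pi.single_eq_of_ne]
    exact Fin.zero_ne_one'
  · exact (hg.2.2 _ ⟨by simp, by rw [beta_single_zero_left]; simp⟩).1

/-! ### The boundary values away from the light cone -/

theorem tendsto_frameParam (x n y : Fin (d + 1) → ℝ) :
    Tendsto (fun t => frameParam x n t y) (𝓝[<] (Real.pi / 2)) (𝓝 ((beta x y : ℝ) : ℂ)) := by
  have h : Continuous fun t => frameParam x n t y := by fun_prop
  have := h.tendsto (Real.pi / 2)
  rw [frameParam, Real.sin_pi_div_two, Real.cos_pi_div_two] at this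
  simp only [one_mul, zero_mul, ofReal_zero, add_zero] at this
  exact this.mono_left nhdsWithin_le_nhds

/-- Away from the light cone of `x` the boundary distribution is given by the pointwise limit. -/
theorem IsFrame.boundaryValue_eq_integral {x n : Fin (d + 1) → ℝ} (h : IsFrame x n) {m : ℕ}
    {f : ℂ → ℂ} (hf : ModerateGrowth m f) (φ : AmbientTest d) {S : Set (Fin (d + 1) → ℝ)}
    (hS : IsClosed S) (hφS : ∀ y ∈ deSitter d, φ y ≠ 0 → y ∈ S) (hSx : ∀ y ∈ S, beta x y ≠ -1)
    {F : (Fin (d + 1) → ℝ) → ℂ}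
    (hF : ∀ y ∈ deSitter d, y ∈ S →
      Tendsto (fun t => f (frameParam x n t y)) (𝓝[<] (Real.pi / 2)) (𝓝 (F y))) :
    Integrable (fun y => F y * (φ y : ℂ)) (volumeMeasure d) ∧
      boundaryValue f x n φ = ∫ y, F y * (φ y : ℂ) ∂volumeMeasure d := by
  have hK : IsCompact (tsupport φ ∩ S) := φ.hasCompactSupport.inter_right hS
  obtain ⟨R, hR⟩ := exists_abs_beta_le hK x n
  obtain ⟨D, hD⟩ := hK.exists_bound_of_continuousOn (f := fun y => (1 + beta x y)⁻¹)
    (ContinuousOn.inv₀ (by fun_prop) fun y hy h0 => hSx y hy.2 (by linarith))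
  obtain ⟨M, hM⟩ := hK.exists_bound_of_continuousOn φ.continuous.continuousOn
  obtain ⟨C, hC, hgrowth⟩ := hf.2 R
  -- `1 / D'` is a lower bound for `|1 + β(x, y)|` on the support of `φ`
  set D' := |D| + 1 with hD'
  have hD'0 : 0 < D' := by positivity
  have hlow : ∀ y ∈ tsupport φ ∩ S, D'⁻¹ ≤ |1 + beta x y| := by
    intro y hy
    have h0 : 0 < |1 + beta x y| := abs_pos.2 fun h0 => hSx y hy.2 (by linarith)
    rw [inv_le_comm₀ hD'0 h0, ← abs_inv]
    exact (hD y hy).trans (by linarith [le_abs_self D])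
  have hsupp : ∀ y ∈ deSitter d, y ∉ tsupport φ ∩ S → φ y = 0 := by
    intro y hy hyn
    by_contra hne
    exact hyn ⟨subset_tsupport _ hne, hφS y hy hne⟩
  have hsin : ∀ᶠ t in 𝓝[<] (Real.pi / 2), (1 - Real.sin t) * |R| < D'⁻¹ / 2 := by
    have h1 : Tendsto (fun t => (1 - Real.sin t) * |R|) (𝓝 (Real.pi / 2))
        (𝓝 ((1 - Real.sin (Real.pi / 2)) * |R|)) :=
      ((continuous_const.sub Real.continuous_sin).mul continuous_const).tendsto _
    rw [Real.sin_pi_div_two, sub_self, zero_mul] at h1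
    exact (h1.mono_left nhdsWithin_le_nhds).eventually_lt_const (by positivity)
  set B := C * (2 * D') ^ m * M with hB
  have hbound : ∀ᶠ t in 𝓝[<] (Real.pi / 2), ∀ y ∈ deSitter d,
      ‖f (frameParam x n t y) * (φ y : ℂ)‖ ≤ (tsupport φ ∩ S).indicator (fun _ => B) y := by
    filter_upwards [hsin, eventually_cos_pos] with t ht htc y hy
    by_cases hyK : y ∈ tsupport φ ∩ S
    · rw [Set.indicator_of_mem hyK, norm_mul, norm_real]
      refine mul_le_mul ?_ (hM y hyK) (norm_nonneg _) (by positivity)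
      refine (hgrowth _ (h.mem_sphericalDomain hy htc)
        ((norm_frameParam_le x n t y).trans (hR y hyK))).trans ?_
      have h1 : D'⁻¹ / 2 ≤ ‖1 + frameParam x n t y‖ := by
        refine le_trans ?_ (abs_re_le_norm _)
        rw [add_re, one_re, frameParam_re]
        have h2 : |1 + beta x y| ≤ |1 + Real.sin t * beta x y| +
            |(1 - Real.sin t) * beta x y| := by
          refine le_trans (le_of_eq ?_) (abs_add_le _ _)
          congr 1
          ring
        have h3 : |(1 - Real.sin t) * beta x y| ≤ (1 - Real.sin t) * |R| := by
          have h4 : 0 ≤ 1 - Real.sin t := by linarith [Real.sin_le_one t]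
          rw [abs_mul, abs_of_nonneg h4]
          exact mul_le_mul_of_nonneg_left
            (by linarith [hR y hyK, abs_nonneg (beta n y), le_abs_self R]) h4
        linarith [hlow y hyK]
      gcongr
      rw [inv_le_comm₀ (lt_of_lt_of_le (by positivity) h1) (by positivity)]
      refine le_trans (le_of_eq ?_) h1
      rw [mul_inv]
      ring
    · rw [Set.indicator_of_notMem hyK, hsupp y hy hyK, ofReal_zero, mul_zero, norm_zero]
  have hint : Integrable ((tsupport φ ∩ S).indicator fun _ => B) (volumeMeasure d) := by
    rw [integrable_indicator_iff hK.measurableSet]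
    exact integrableOn_const hK.measure_lt_top.ne
  have hmeas : ∀ᶠ t in 𝓝[<] (Real.pi / 2),
      AEStronglyMeasurable (fun y => f (frameParam x n t y) * (φ y : ℂ)) (volumeMeasure d) := by
    filter_upwards [eventually_cos_pos] with t ht
    exact (h.integrable_framePairing hf.1.continuousOn φ.continuous φ.hasCompactSupport ht).1
  have hlim : ∀ y ∈ deSitter d, Tendsto (fun t => f (frameParam x n t y) * (φ y : ℂ))
      (𝓝[<] (Real.pi / 2)) (𝓝 (F y * (φ y : ℂ))) := by
    intro y hy
    by_cases h0 : φ y = 0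
    · simp [h0]
    · exact (hF y hy (hφS y hy h0)).mul_const _
  refine ⟨hint.mono' ?_ ?_, ?_⟩
  · obtain ⟨u, hu⟩ := exists_seq_tendsto (𝓝[<] (Real.pi / 2))
    obtain ⟨N, hN⟩ := eventually_atTop.1 (hu.eventually hmeas)
    refine aestronglyMeasurable_of_tendsto_ae atTop
      (f := fun i y => f (frameParam x n (u (i + N)) y) * (φ y : ℂ))
      (fun i => hN _ (by lia)) ?_
    filter_upwards [ae_mem_deSitter] with y hy
    exact (hlim y hy).comp (hu.comp (tendsto_add_atTop_nat N))
  · filter_upwards [ae_mem_deSitter] with y hy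
    exact le_of_tendsto (hlim y hy).norm (hbound.mono fun t ht => ht y hy)
  · refine tendsto_nhds_unique (h.tendsto_boundaryValue hf φ.contDiff φ.hasCompactSupport) ?_
    refine tendsto_integral_filter_of_dominated_convergence _ hmeas ?_ hint ?_
    · filter_upwards [hbound] with t ht
      filter_upwards [ae_mem_deSitter] with y hy using ht y hy
    · filter_upwards [ae_mem_deSitter] with y hy using hlim y hy

/-- On `β(x, y) > -1` both boundary values are the value of `f` itself. -/
theorem tendsto_comp_frameParam_of_lt {f : ℂ → ℂ} (hf : ContinuousOn f sphericalDomain)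
    {x n y : Fin (d + 1) → ℝ} (hxy : -1 < beta x y) :
    Tendsto (fun t => f (frameParam x n t y)) (𝓝[<] (Real.pi / 2)) (𝓝 (f (beta x y : ℝ))) := by
  have hmem : ((beta x y : ℝ) : ℂ) ∈ sphericalDomain := by
    left
    simp only [add_re, one_re, ofReal_re]
    linarith
  exact (hf.continuousAt (isOpen_sphericalDomain.mem_nhds hmem)).tendsto.comp
    (tendsto_frameParam x n y)

theorem tendsto_frameParam_above {x n y : Fin (d + 1) → ℝ} (hn : 0 < beta n y) :
    Tendsto (fun t => frameParam x n t y) (𝓝[<] (Real.pi / 2))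
      (𝓝[{s : ℂ | 0 < s.im}] ((beta x y : ℝ) : ℂ)) := by
  refine tendsto_nhdsWithin_iff.2 ⟨tendsto_frameParam x n y, ?_⟩
  filter_upwards [eventually_cos_pos] with t ht
  simp only [frameParam_im]
  positivity

theorem tendsto_frameParam_below {x n y : Fin (d + 1) → ℝ} (hn : beta n y < 0) :
    Tendsto (fun t => frameParam x n t y) (𝓝[<] (Real.pi / 2))
      (𝓝[{s : ℂ | s.im < 0}] ((beta x y : ℝ) : ℂ)) := by
  refine tendsto_nhdsWithin_iff.2 ⟨tendsto_frameParam x n y, ?_⟩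
  filter_upwards [eventually_cos_pos] with t ht
  simp only [frameParam_im]
  exact mul_neg_of_pos_of_neg ht hn

/-- The difference of the boundary distributions of the two time orientations is given, away from
the light cone, by the difference of the pointwise boundary values. -/
theorem isGivenOn_boundaryDistribution_sub {x n : Fin (d + 1) → ℝ} (h : IsFrame x n) {m : ℕ}
    {f : ℂ → ℂ} (hf : ModerateGrowth m f) {U : Set (Fin (d + 1) → ℝ)}
    (hU : ∀ y ∈ U, beta x y ≠ -1) {F F' G : (Fin (d + 1) → ℝ) → ℂ}
    (hF : ∀ y ∈ deSitter d, y ∈ U →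
      Tendsto (fun t => f (frameParam x n t y)) (𝓝[<] (Real.pi / 2)) (𝓝 (F y)))
    (hF' : ∀ y ∈ deSitter d, y ∈ U →
      Tendsto (fun t => f (frameParam x (-n) t y)) (𝓝[<] (Real.pi / 2)) (𝓝 (F' y)))
    (hG : ∀ y ∈ deSitter d, y ∈ U → F y - F' y = G y) :
    IsGivenOn (boundaryDistribution h hf - boundaryDistribution h.neg hf) U G := by
  intro φ hφ
  have hφS : ∀ y ∈ deSitter d, φ y ≠ 0 → y ∈ closure {y | y ∈ deSitter d ∧ φ y ≠ 0} :=
    fun y hy h0 => subset_closure ⟨hy, h0⟩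
  obtain ⟨hi, he⟩ := h.boundaryValue_eq_integral hf φ isClosed_closure hφS
    (fun y hy => hU y (hφ hy)) (F := F) fun y hy hyS => hF y hy (hφ hyS)
  obtain ⟨hi', he'⟩ := h.neg.boundaryValue_eq_integral hf φ isClosed_closure hφS
    (fun y hy => hU y (hφ hy)) (F := F') fun y hy hyS => hF' y hy (hφ hyS)
  have hae : (fun y => F y * (φ y : ℂ) - F' y * (φ y : ℂ)) =ᵐ[volumeMeasure d]
      fun y => G y * (φ y : ℂ) := by
    filter_upwards [ae_mem_deSitter] with y hy
    by_cases h0 : φ y = 0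
    · simp [h0]
    · rw [← sub_mul, hG y hy (hφ (hφS y hy h0))]
  refine ⟨(hi.sub hi').congr hae, ?_⟩
  change boundaryValue f x n φ - boundaryValue f x (-n) φ = _
  rw [he, he', ← integral_sub hi hi']
  exact integral_congr_ae hae

/-! ### The jump -/

/-- The jump of the spherical function across the cut in terms of `d = 2k + 1`. -/
theorem sphericalBoundary_sub_eq_jump {k : ℕ} (hd : d = 2 * k + 1) (lam : ℂ)
    {x y : Fin (d + 1) → ℝ} (hxy : beta x y < -1) :
    sphericalBoundary k lam 1 (beta x y) - sphericalBoundary k lam (-1) (beta x y) =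
      jumpConstant d lam * jumpProfile lam x y := by
  rw [sphericalBoundary_sub k lam hxy, jumpConstant, jumpProfile, connectionCoeff]
  have e1 : (d - 1) / 2 = k := by lia
  have e2 : (d : ℂ) / 2 = k + 1 / 2 := by rw [hd]; push_cast; ring
  have e3 : ((d : ℂ) - 2) / 2 = k - 1 / 2 := by rw [hd]; push_cast; ring
  have e4 : ((d : ℂ) - 1) / 2 = k := by rw [hd]; push_cast; ring
  have e5 : (4 - (d : ℂ)) / 2 = 1 / 2 - k + 1 := by rw [hd]; push_cast; ring
  have e6 : (2 - (d : ℝ)) / 2 = 1 / 2 - k := by rw [hd]; push_cast; ring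
  rw [e1, e2, e3, e4, e5, e6, ← mul_inv, ← div_eq_mul_inv]

end DeSitter

theorem mainTheorem7 (d : ℕ) (hd : 3 ≤ d) (hodd : Odd d) (lam : ℂ)
    (x : Fin (d + 1) → ℝ) (hx : x ∈ DeSitter.deSitter d) :
    ∃ Dplus Dminus : DeSitter.distributions d,
      DeSitter.IsDPlus lam x Dplus ∧ DeSitter.IsDMinus lam x Dminus ∧
      DeSitter.IsGivenOn (Dplus - Dminus)
        (DeSitter.deSitter d \ closure (DeSitter.chronological x)) (fun _ => 0) ∧
      DeSitter.IsGivenOn (Dplus - Dminus) (DeSitter.chronologicalFuture x)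
        (fun y => DeSitter.jumpConstant d lam * DeSitter.jumpProfile lam x y) ∧
      DeSitter.IsGivenOn (Dplus - Dminus) (DeSitter.chronologicalPast x)
        (fun y => -(DeSitter.jumpConstant d lam * DeSitter.jumpProfile lam x y)) := by
  obtain ⟨k, hk⟩ := hodd
  have hd0 : d ≠ 0 := by lia
  obtain ⟨n, hn, hn0⟩ := DeSitter.exists_isFrame hx
  have hf := DeSitter.moderateGrowth_spherical k lam
  have hf' := DeSitter.moderateGrowth_deriv_spherical k lam
  have hgn : ∀ g ∈ DeSitter.lorentzGroup d, g.mulVec (DeSitter.basePoint d) = x →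
      DeSitter.IsFrame x (g.mulVec (Pi.single 0 1)) ∧
        0 < DeSitter.beta n (g.mulVec (Pi.single 0 1)) := by
    intro g hg hgx
    obtain ⟨h1, h2⟩ := DeSitter.isFrame_mulVec hg hd0 hx hgx
    exact ⟨h1, DeSitter.beta_pos_of_timelike (by rw [hn.beta_right]; exact one_pos) hn0
      (by rw [h1.beta_right]; exact one_pos) h2⟩
  refine ⟨DeSitter.boundaryDistribution hn hf, DeSitter.boundaryDistribution hn.neg hf,
    ?_, ?_, ?_, ?_, ?_⟩
  · intro g hg hgx
    obtain ⟨h1, h2⟩ := hgn g hg hgx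
    have := DeSitter.hasLeftLimit_boundaryDistribution hn h1 h2 hf hf'
    simpa only [DeSitter.kernel_act_zPoint hk, hgx] using this
  · intro g hg hgx
    obtain ⟨h1, h2⟩ := hgn g hg hgx
    have := DeSitter.hasLeftLimit_boundaryDistribution hn.neg h1.neg
      (by rwa [DeSitter.beta_neg_left, DeSitter.beta_neg_right, neg_neg]) hf hf'
    simpa only [DeSitter.conjKernel_act_star_zPoint hk, hgx] using this
  · have hlt : ∀ y ∈ DeSitter.deSitter d \ closure (DeSitter.chronological x),
        -1 < DeSitter.beta x y := fun y hy =>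
      not_le.1 fun h => hy.2 (DeSitter.mem_closure_chronological hx hy.1 h)
    exact DeSitter.isGivenOn_boundaryDistribution_sub hn hf (fun y hy => (hlt y hy).ne')
      (fun y _ hy => DeSitter.tendsto_comp_frameParam_of_lt hf.1.continuousOn (hlt y hy))
      (fun y _ hy => DeSitter.tendsto_comp_frameParam_of_lt hf.1.continuousOn (hlt y hy))
      (fun y _ _ => sub_self _)
  · have hlt : ∀ y ∈ DeSitter.chronologicalFuture x, DeSitter.beta x y < -1 := fun y hy =>
      ((DeSitter.mem_chronological_iff hx).1 hy.1).2
    refine DeSitter.isGivenOn_boundaryDistribution_sub hn hf (fun y hy => (hlt y hy).ne)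
      (fun y _ hy => (DeSitter.tendsto_spherical_above k lam (hlt y hy)).comp
        (DeSitter.tendsto_frameParam_above (hn.beta_pos_of_chronologicalFuture hn0 hy)))
      (fun y _ hy => (DeSitter.tendsto_spherical_below k lam (hlt y hy)).comp
        (DeSitter.tendsto_frameParam_below ?_))
      (fun y _ hy => DeSitter.sphericalBoundary_sub_eq_jump hk lam (hlt y hy))
    rw [DeSitter.beta_neg_left]
    exact neg_neg_of_pos (hn.beta_pos_of_chronologicalFuture hn0 hy)
  · have hlt : ∀ y ∈ DeSitter.chronologicalPast x, DeSitter.beta x y < -1 := fun y hy =>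
      ((DeSitter.mem_chronological_iff hx).1 hy.1).2
    refine DeSitter.isGivenOn_boundaryDistribution_sub hn hf (fun y hy => (hlt y hy).ne)
      (fun y _ hy => (DeSitter.tendsto_spherical_below k lam (hlt y hy)).comp
        (DeSitter.tendsto_frameParam_below (hn.beta_neg_of_chronologicalPast hn0 hy)))
      (fun y _ hy => (DeSitter.tendsto_spherical_above k lam (hlt y hy)).comp
        (DeSitter.tendsto_frameParam_above ?_))
      (fun y _ hy => by
        rw [← neg_sub, DeSitter.sphericalBoundary_sub_eq_jump hk lam (hlt y hy)])
    rw [DeSitter.beta_neg_left]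
    exact neg_pos_of_neg (hn.beta_neg_of_chronologicalPast hn0 hy)
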